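/- **Setting.** Let $\lambda_0>0$, $0<h_1<1$, and let $f$ be a probability density on $(0,\infty)$ with $\int_0^\infty e^{\theta_0 t}f(t)\,dt<\infty$ for some $\theta_0>0$. A *cluster with parameter $(h,g)$* ($h>0$, $g$ a probability density on $(0,\infty)$) arriving at time $\tau$ is the random finite list of events generated as follows: the first event, the immigrant, occurs at time $\tau$; events are processed in order of their index, and an event at time $s$ gets a Poisson$(h)$ number of children whose birth times (time of child minus time of parent) are i.i.d. with density $g$ (so the children form a Poisson process with intensity $h\,g(\cdot-s)$); the children are appended to the list, with their times and the index of their parent, and everything is independent. For a cluster $C$ let $|C|$ be its number of events, $L$ its length (time of the last event minus time of the immigrant), and $B$ its total birth time (the sum of the birth times of all non-immigrant events). Let $\mathbb P$ be the law of a cluster with parameter $(h_1,f)$, $p(t)=\mathbb P(L>t)$, $\psi_B(\theta)=\log \mathbb E[e^{\theta B}]$ and $\psi_f(\theta)=\log\int_0^\infty e^{\theta t}f(t)\,dt$. In the stationary Hawkes process the immigrants form a Poisson process of rate $\lambda_0$ on $\mathbb R$, with points $\dots\le\tau_{-2}\le\tau_{-1}\le 0<\tau_1\le\tau_2\le\cdots$,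 and the immigrants generate independent clusters $C_m$ with parameter $(h_1,f)$, arriving at $\tau_m$. Let $N_0=\{C_m: m\le -1,\ L_m>-\tau_m\}$, the clusters that arrive before $0$ and last past $0$. **Algorithm** (tilting parameter $\eta>0$ with $\psi_B(\eta)<\infty$). Generate a Poisson process on $(-\infty,0]$ with intensity $\tilde\gamma(t)=\lambda_0 e^{\psi_B(\eta)+\eta t}$ and list its points as $\tau_1,\dots,\tau_K$. For each $m\le K$, independently, generate a cluster $C_m$ arriving at $\tau_m$ with parameter $(h_1e^{\psi_f(\eta)+\psi_B(\eta)},f_\eta)$, where $f_\eta(t)=f(t)e^{\eta t-\psi_f(\eta)}$, and an independent $X_m$ uniform on $[0,1]$; accept $C_m$ if $L_m>-\tau_m$ and $X_m\le e^{-\eta(B_m+\tau_m)}$. Return the collection of accepted clusters. The number of random variables generated is counted as $\sum_{m=1}^K(|C_m|+1)$: one for each event of each generated cluster (the immigrant included) and one uniform variable for each cluster. **Theorem.** There is $\theta_1>0$ such that $\psi_B(\theta)<\infty$ for all $0<\theta<\theta_1$. For every such $\theta_1$ and every $0<\eta<\theta_1$, the collection of clusters returned by the algorithm has exactly the distribution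 of $N_0$ (as a point process on the space of clusters). In particular: 1. The arrival times of the returned clusters form a Poisson process on $(-\infty,0]$ with intensity $\gamma(t)=\lambda_0\,p(-t)$. 2. Given $K$, the arrival times $\tau_1,\dots,\tau_K$ and which of the clusters are accepted, the accepted clusters are independent, and an accepted cluster $C_m$ follows the conditional distribution of a cluster with parameter $(h_1,f)$ arriving at $\tau_m$ given that its length is $>-\tau_m$. Moreover, the expected total number of random variables generated by the algorithm is $$\frac{\lambda_0\,e^{\psi_B(\eta)}\,\bigl(2-h_1-\psi_B(\eta)\bigr)}{\eta\,\bigl(1-h_1-\psi_B(\eta)\bigr)}.$$ -/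

import Mathlib

open MeasureTheory ProbabilityTheory
open scoped ENNReal

noncomputable section

namespace Hawkes

/-! ### Clusters -/

/-- A cluster, listed in order of generation: the number of events, and for each event its arrival
time and the (one-based) index of its parent, which is `0` for the immigrant.  The position `k`
holds the event with index `k + 1`; position `0` is the immigrant.
Size `0` is reserved for a generating procedure that never stops. -/
abbrev Cluster : Type := (n : ℕ) × (Fin n → ℝ × ℕ)

namespace Cluster

/-- Arrival time of the event at position `k`. -/
def time (c : Cluster) (k : ℕ) : ℝ := if h : k < c.1 then (c.2 ⟨k, h⟩).1 else 0

/-- One-based index of the parent of the event at position `k`. -/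
def parent (c : Cluster) (k : ℕ) : ℕ := if h : k < c.1 then (c.2 ⟨k, h⟩).2 else 0

/-- Number of events, infinite for a generating procedure that never stops. -/
def card (c : Cluster) : ℕ∞ := if c.1 = 0 then ⊤ else (c.1 : ℕ∞)

/-- Cluster length: time between the immigrant and the last event. -/
def length (c : Cluster) : ℝ := ⨆ k : Fin c.1, (c.time k - c.time 0)

/-- Total birth time: sum over the non-immigrant events of the arrival time minus the arrival time
of the parent. -/
def totalBirth (c : Cluster) : ℝ :=
  ∑ k ∈ Finset.Ico 1 c.1, (c.time k - c.time (c.parent k - 1))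

/-- Translate all arrival times by `s`. -/
def shift (s : ℝ) (c : Cluster) : Cluster := ⟨c.1, fun k => ((c.2 k).1 + s, (c.2 k).2)⟩

end Cluster

/-! ### Generating a cluster

`L k` is the number of children of the event at position `k`, and `b j` the birth time of the event
at position `j`.  Events are processed in order of index, the children of the processed event being
appended at the end of the list. -/

/-- Parent index of the event at position `j`: the number of events that have to be processed until
`j` non-immigrant events have been generated. -/
def parentIndex (L : ℕ → ℕ) (j : ℕ) : ℕ := sInf {k | j ≤ ∑ i ∈ Finset.range k, L i}

/-- Arrival time of the event at position `j`, the immigrant arriving at time `0`.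
As long as the procedure has not stopped, the parent of the event at position `j + 1` sits at a
position `≤ j`, so that the minimum only serves to make the recursion well-founded. -/
def eventTime (L : ℕ → ℕ) (b : ℕ → ℝ) : ℕ → ℝ
  | 0 => 0
  | j + 1 => eventTime L b (min (parentIndex L (j + 1) - 1) j) + b (j + 1)
termination_by j => j
decreasing_by omega

/-- The procedure stops at the first `n` for which the first `n` events have been processed and
exactly `n` events have been generated. -/
def generate (L : ℕ → ℕ) (b : ℕ → ℝ) : Cluster :=
  open Classical in
  if h : ∃ n, 1 + ∑ i ∈ Finset.range n, L i = n then
    ⟨Nat.find h, fun k => (eventTime L b k, parentIndex L k)⟩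
  else ⟨0, Fin.elim0⟩

/-- `f` is a probability density on `(0, ∞)`. -/
structure IsDensity (f : ℝ → ℝ) : Prop where
  measurable : Measurable f
  nonneg : ∀ t, 0 ≤ t → 0 ≤ f t
  lintegral_eq_one : ∫⁻ t in Set.Ioi 0, ENNReal.ofReal (f t) = 1

/-- The distribution on `(0, ∞)` with density `f`. -/
def birthLaw (f : ℝ → ℝ) : Measure ℝ :=
  (volume.restrict (Set.Ioi 0)).withDensity fun t => ENNReal.ofReal (f t)

/-- Law of a cluster with parameter `(h₁, f)` whose immigrant arrives at time `0`: the numbers of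
children are i.i.d. Poisson with mean `h₁`, the birth times are i.i.d. with density `f`, and both
are independent (the children of an event at time `s` thus form a Poisson process with
intensity `h₁ * f (t - s)`). -/
def clusterLaw (h₁ : ℝ) (f : ℝ → ℝ) : Measure Cluster :=
  ((Measure.infinitePi fun _ : ℕ => poissonMeasure h₁.toNNReal).prod
    (Measure.infinitePi fun _ : ℕ => birthLaw f)).map fun s => generate s.1 s.2

/-- Law of a cluster whose immigrant arrives at time `s`. -/
def clusterLawAt (h₁ : ℝ) (f : ℝ → ℝ) (s : ℝ) : Measure Cluster :=
  (clusterLaw h₁ f).map (Cluster.shift s)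

/-- `p t`, the probability that a cluster has length `> t`. -/
def tailProb (h₁ : ℝ) (f : ℝ → ℝ) (t : ℝ) : ℝ :=
  (clusterLaw h₁ f).real {c | t < c.length}

/-- Cumulant generating function of the birth time. -/
def psiF (f : ℝ → ℝ) (θ : ℝ) : ℝ :=
  Real.log (∫ t in Set.Ioi 0, Real.exp (θ * t) * f t)

/-- Cumulant generating function of the total birth time of a cluster. -/
def psiB (h₁ : ℝ) (f : ℝ → ℝ) (θ : ℝ) : ℝ :=
  cgf Cluster.totalBirth (clusterLaw h₁ f) θ

/-- The exponentially tilted birth density. -/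
def tiltedDensity (f : ℝ → ℝ) (η : ℝ) (t : ℝ) : ℝ := f t * Real.exp (η * t - psiF f η)

/-! ### Poisson processes -/

/-- The random measure `Φ` is a Poisson process with intensity measure `μ`. -/
structure IsPoissonProcess {Ω E : Type*} [MeasurableSpace Ω] [MeasurableSpace E]
    (P : Measure Ω) (Φ : Ω → Measure E) (μ : Measure E) : Prop where
  measurable : Measurable Φ
  hasLaw : ∀ A : Set E, MeasurableSet A → μ A ≠ ∞ →
    HasLaw (fun ω => Φ ω A) ((poissonMeasure (μ A).toNNReal).map fun n : ℕ => (n : ℝ≥0∞)) P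
  indep : ∀ (n : ℕ) (A : Fin n → Set E), (∀ i, MeasurableSet (A i)) →
    Pairwise (fun i j => Disjoint (A i) (A j)) → iIndepFun (fun i ω => Φ ω (A i)) P

/-- The measure on `(-∞, 0]` with density `γ`. -/
def intensityOnPast (γ : ℝ → ℝ) : Measure ℝ :=
  (volume.restrict (Set.Iic 0)).withDensity fun t => ENNReal.ofReal (γ t)

/-! ### The stationary cluster process and the target `N₀` -/

/-- Indices `±1, ±2, …` of the two-ended process. -/
abbrev Idx : Type := {m : ℤ // m ≠ 0}

/-- The immigrants `τ` of a stationary Hawkes process form a two-ended Poisson process of rate `lam`,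
enumerated increasingly with `τ₋₁ ≤ 0 < τ₁`; the `m`-th cluster is `D m` translated by `τ m`, with
`D` i.i.d. and independent of `τ`. -/
structure IsStationaryModel {Ω : Type*} [MeasurableSpace Ω] (P : Measure Ω)
    (lam h₁ : ℝ) (f : ℝ → ℝ) (τ : Idx → Ω → ℝ) (D : Idx → Ω → Cluster) : Prop where
  measurable_arrival : ∀ m, Measurable (τ m)
  measurable_cluster : ∀ m, Measurable (D m)
  ordered : ∀ᵐ ω ∂P, (Monotone fun m => τ m ω) ∧
    (∀ m : Idx, m.1 < 0 → τ m ω ≤ 0) ∧ (∀ m : Idx, 0 < m.1 → 0 < τ m ω)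
  poisson : IsPoissonProcess P (fun ω => Measure.sum fun m => Measure.dirac (τ m ω))
    (ENNReal.ofReal lam • volume)
  cluster_law : ∀ m, HasLaw (D m) (clusterLaw h₁ f) P
  cluster_indep : iIndepFun D P
  indep : IndepFun (fun ω m => τ m ω) (fun ω m => D m ω) P

open Classical in
/-- `N₀ = {C_m : m ≤ -1, L_m > -τ_m}`, as a point process on the space of clusters. -/
def targetProcess {Ω : Type*} (τ : Idx → Ω → ℝ) (D : Idx → Ω → Cluster) (ω : Ω) :
    Measure Cluster :=
  Measure.sum fun m : Idx =>
    if m.1 ≤ -1 ∧ -τ m ω < ((D m ω).shift (τ m ω)).length then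
      Measure.dirac ((D m ω).shift (τ m ω))
    else 0

/-! ### The algorithm -/

/-- The random draws of the algorithm with tilting parameter `η`: a Poisson process on `(-∞, 0]` with
intensity `lam * exp (ψ_B η + η t)` whose points are listed, in any order, as `τ 0, …, τ (K - 1)`;
and, independently of it and for each iteration `m` independently, a tilted cluster `D m` (still to
be translated by `τ m`) and a uniform variable `X m` independent of each other. -/
structure IsAlgorithmRun {Ω : Type*} [MeasurableSpace Ω] (P : Measure Ω)
    (lam h₁ : ℝ) (f : ℝ → ℝ) (η : ℝ)
    (K : Ω → ℕ) (τ : ℕ → Ω → ℝ) (D : ℕ → Ω → Cluster) (X : ℕ → Ω → ℝ) : Prop where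
  measurable_count : Measurable K
  measurable_arrival : ∀ m, Measurable (τ m)
  measurable_cluster : ∀ m, Measurable (D m)
  measurable_uniform : ∀ m, Measurable (X m)
  poisson : IsPoissonProcess P (fun ω => ∑ m ∈ Finset.range (K ω), Measure.dirac (τ m ω))
    (intensityOnPast fun t => lam * Real.exp (psiB h₁ f η + η * t))
  draw_law : ∀ m, HasLaw (fun ω => (D m ω, X m ω))
    ((clusterLaw (h₁ * Real.exp (psiF f η + psiB h₁ f η)) (tiltedDensity f η)).prod
      (volume.restrict (Set.Icc 0 1))) P
  draw_indep : iIndepFun (fun m ω => (D m ω, X m ω)) P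
  indep : IndepFun (fun ω => (K ω, fun m => τ m ω)) (fun ω m => (D m ω, X m ω)) P

section Algorithm

variable {Ω : Type*} (η : ℝ) (K : Ω → ℕ) (τ : ℕ → Ω → ℝ) (D : ℕ → Ω → Cluster) (X : ℕ → Ω → ℝ)

/-- The cluster proposed in iteration `m`, with its arrival time. -/
def proposal (m : ℕ) (ω : Ω) : Cluster := (D m ω).shift (τ m ω)

/-- Iteration `m` takes place and its cluster is accepted. -/
def Accepted (m : ℕ) (ω : Ω) : Prop :=
  m < K ω ∧ -τ m ω < (proposal τ D m ω).length ∧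
    X m ω ≤ Real.exp (-η * ((proposal τ D m ω).totalBirth + τ m ω))

open Classical in
/-- The returned collection of clusters, as a point process on the space of clusters. -/
def outputProcess (ω : Ω) : Measure Cluster :=
  ∑ m ∈ (Finset.range (K ω)).filter (fun m => Accepted η K τ D X m ω),
    Measure.dirac (proposal τ D m ω)

open Classical in
/-- The arrival times of the returned clusters, as a point process. -/
def outputArrivals (ω : Ω) : Measure ℝ :=
  ∑ m ∈ (Finset.range (K ω)).filter (fun m => Accepted η K τ D X m ω),
    Measure.dirac ((proposal τ D m ω).time 0)

/-- What is conditioned upon: the number of iterations, the arrival times, and which iterations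
accept. -/
def acceptanceData (ω : Ω) : ℕ × (ℕ → ℝ) × (ℕ → Prop) :=
  (K ω, fun m => τ m ω, fun m => Accepted η K τ D X m ω)

/-- Number of random variables generated: for each iteration, one per event of the proposed cluster
(its time, the immigrant included) and the uniform variable of the acceptance step. -/
def numVariables (ω : Ω) : ℝ≥0∞ :=
  ∑ m ∈ Finset.range (K ω), (((proposal τ D m ω).card : ℝ≥0∞) + 1)

end Algorithm

end Hawkes

end

/-! The tilted cluster law has density `exp (η B - ψ_B)` with respect to the original one, where
`ψ_B`, `ψ_f` are taken at `η`. Multiplying the proposal intensity `lam * exp (ψ_B + η t)`, this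
density and the acceptance probability `exp (-η (B + t))`, all exponentials cancel. What remains is
`lam dt` times the original cluster law restricted to `L > -t`, which is the intensity of `N₀`. The
acceptance probability is at most one because `L ≤ B`: on the event `L > -t` one has `B + t > 0`.

Density of the tilted law (`clusterLaw_tilted`). On the event that a cluster has `n` events, it is a
function of `n` offspring counts with sum `n - 1` and of `n - 1` birth times. Passing from `(h, f)`
to `(h', f_η)` therefore costs the explicit factor `exp (-n (h' - h)) (h' / h) ^ (n - 1) exp (η B -
(n - 1) ψ_f)`. For `h' = h exp (ψ_f + ψ_B)` this equals `exp (η B - ψ_B)` for every `n` exactly when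
`h' = h + ψ_B`. Moreover `h' < 1` is needed, so that the tilted procedure stops almost surely.

Both facts are `tilted_parameters`, and they come from the size distribution. Comparing every
offspring mean with the critical mean 1 expresses `E exp (θ B)` through one power series,
`treeSeries`, at `z = h m exp (-h)`, where `m` is the moment generating function of the birth time
at `θ`. Total mass one for each `h < 1` shows that `treeSeries` inverts `k ↦ k exp (-k)` on `(0,
1)`. The series diverges for `e z > 1`, since a critical cluster has infinite mean size. Finiteness
at some `η' > η` thus gives `e z < 1` at `η`, hence `z = k exp (-k)` with `0 < k < 1`, and `ψ_B = k
- h`.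

Laws of point processes are compared through Laplace functionals, with `exp (-x)` defined on `[0,
∞]` so that no integrability is required. Independent marks are integrated out point by point
(`lintegral_expNeg_marked`). The exponents for the output and for `N₀` agree by `lintegral_accept`,
and a Laplace functional determines the law (`map_eq_of_laplace`). The conditional statement is the
same computation made for fixed `(K, τ)`, where the draws are independent. The expected cost is the
mean of `K` times one plus the mean size `1 / (1 - h')` of a tilted cluster. -/

noncomputable section

namespace Hawkes

open Filter Topology

/-! ### The map `x ↦ exp (-x)` on `[0, ∞]` -/

/-- The decreasing map `x ↦ exp (-x)` from `[0, ∞]` onto `[0, 1]`. -/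
def expNeg (x : ℝ≥0∞) : ℝ≥0∞ := EReal.exp (-(x : EReal))

/-- The inverse of `expNeg` on `[0, 1]`. -/
def negLog (u : ℝ≥0∞) : ℝ≥0∞ := (-(ENNReal.log u)).toENNReal

@[simp] lemma expNeg_zero : expNeg 0 = 1 := by simp [expNeg]

lemma continuous_expNeg : Continuous expNeg :=
  ENNReal.continuous_exp.comp (continuous_neg.comp continuous_coe_ennreal_ereal)

lemma measurable_expNeg : Measurable expNeg := continuous_expNeg.measurable

lemma measurable_negLog : Measurable negLog := by
  unfold negLog
  exact (ENNReal.measurable_log.neg).ereal_toENNReal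

lemma expNeg_le_one (x : ℝ≥0∞) : expNeg x ≤ 1 := by
  simpa [expNeg] using EReal.coe_ennreal_nonneg x

lemma expNeg_ne_top (x : ℝ≥0∞) : expNeg x ≠ ∞ := ne_top_of_le_ne_top ENNReal.one_ne_top
  (expNeg_le_one x)

lemma expNeg_injective : Function.Injective expNeg := by
  intro x y h
  simpa using neg_injective (EReal.exp_strictMono.injective h)

lemma expNeg_eq_inv (x : ℝ≥0∞) : expNeg x = (EReal.exp x)⁻¹ := EReal.exp_neg _

lemma expNeg_add (x y : ℝ≥0∞) : expNeg (x + y) = expNeg x * expNeg y := by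
  rw [expNeg_eq_inv, EReal.coe_ennreal_add, EReal.exp_add, ENNReal.mul_inv,
    expNeg_eq_inv, expNeg_eq_inv]
  · left; simp
  · right; simp

lemma expNeg_ofReal {r : ℝ} (hr : 0 ≤ r) :
    expNeg (ENNReal.ofReal r) = ENNReal.ofReal (Real.exp (-r)) := by
  rw [expNeg, EReal.coe_ennreal_ofReal, max_eq_left hr, ← EReal.coe_neg, EReal.exp_coe]

lemma expNeg_sum {ι : Type*} (s : Finset ι) (x : ι → ℝ≥0∞) :
    expNeg (∑ i ∈ s, x i) = ∏ i ∈ s, expNeg (x i) := by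
  classical
  induction s using Finset.induction_on with
  | empty => simp
  | insert a s ha ih => rw [Finset.sum_insert ha, Finset.prod_insert ha, expNeg_add, ih]

lemma expNeg_nsmul (n : ℕ) (x : ℝ≥0∞) : expNeg (n * x) = expNeg x ^ n := by
  have := expNeg_sum (Finset.range n) fun _ => x
  simpa using this

lemma expNeg_negLog {u : ℝ≥0∞} (hu : u ≤ 1) : expNeg (negLog u) = u := by
  have h : ENNReal.log u ≤ 0 := by simpa using hu
  rw [expNeg, negLog, EReal.coe_toENNReal, neg_neg, ENNReal.exp_log]
  simpa using h

/-! ### Laplace functional of a Poisson process -/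

lemma lintegral_poissonMeasure_ofReal_pow (r : NNReal) {u : ℝ} (hu : 0 ≤ u) :
    ∫⁻ n, ENNReal.ofReal u ^ n ∂(poissonMeasure r) = ENNReal.ofReal (Real.exp (r * (u - 1))) := by
  rw [lintegral_countable']
  simp_rw [poissonMeasure_singleton]
  have hs : HasSum (fun n : ℕ => u ^ n * (Real.exp (-r) * r ^ n / (n.factorial)))
      (Real.exp (r * (u - 1))) := by
    have := (NormedSpace.expSeries_div_hasSum_exp ((r : ℝ) * u)).mul_left (Real.exp (-r))
    rw [← Real.exp_eq_exp_ℝ, ← Real.exp_add] at this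
    convert! this using 1
    · ext n; rw [mul_pow]; ring
    · congr 1; ring
  rw [← hs.tsum_eq, ENNReal.ofReal_tsum_of_nonneg (fun n => by positivity) hs.summable]
  refine tsum_congr fun n => ?_
  rw [ENNReal.ofReal_mul (by positivity), ENNReal.ofReal_pow (by positivity)]

lemma lintegral_poissonMeasure_pow (r : NNReal) {u : ℝ≥0∞} (hu : u ≤ 1) :
    ∫⁻ n, u ^ n ∂(poissonMeasure r) = expNeg (r * (1 - u)) := by
  have hu' : u ≠ ∞ := ne_top_of_le_ne_top ENNReal.one_ne_top hu
  lift u to NNReal using hu'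
  have hu1 : (u : ℝ) ≤ 1 := by exact_mod_cast hu
  have e : (r : ℝ≥0∞) * (1 - u) = ENNReal.ofReal (r * (1 - u)) := by
    rw [ENNReal.ofReal_mul r.coe_nonneg, ENNReal.ofReal_sub _ u.coe_nonneg]; simp
  rw [e, expNeg_ofReal (mul_nonneg r.coe_nonneg (by linarith)),
    ← ENNReal.ofReal_coe_nnreal (p := u), lintegral_poissonMeasure_ofReal_pow r u.coe_nonneg]
  congr 2
  ring

section

variable {Ω E : Type*} [MeasurableSpace Ω] [MeasurableSpace E] {P : Measure Ω}
  {Φ : Ω → Measure E} {μ : Measure E}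

lemma IsPoissonProcess.measurable_apply (hΦ : IsPoissonProcess P Φ μ) {A : Set E}
    (hA : MeasurableSet A) : Measurable fun ω => Φ ω A :=
  (Measure.measurable_coe hA).comp hΦ.measurable

lemma IsPoissonProcess.lintegral_expNeg_apply (hΦ : IsPoissonProcess P Φ μ) {A : Set E}
    (hA : MeasurableSet A) (hμ : μ A ≠ ∞) (a : ℝ≥0∞) :
    ∫⁻ ω, expNeg (a * Φ ω A) ∂P = expNeg ((1 - expNeg a) * μ A) := by
  have hm : Measurable fun x => expNeg (a * x) := measurable_expNeg.comp (by fun_prop)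
  rw [(hΦ.hasLaw A hA hμ).lintegral_comp (f := fun x => expNeg (a * x)) hm.aemeasurable,
    lintegral_map hm .of_discrete]
  simp_rw [mul_comm a, expNeg_nsmul]
  rw [lintegral_poissonMeasure_pow _ (expNeg_le_one a), ENNReal.coe_toNNReal hμ, mul_comm]

lemma IsPoissonProcess.lintegral_expNeg_sum (hΦ : IsPoissonProcess P Φ μ) {ι : Type*} [Fintype ι]
    {A : ι → Set E} (hA : ∀ i, MeasurableSet (A i)) (hμ : ∀ i, μ (A i) ≠ ∞)
    (hd : Pairwise fun i j => Disjoint (A i) (A j)) (a : ι → ℝ≥0∞) :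
    ∫⁻ ω, expNeg (∑ i, a i * Φ ω (A i)) ∂P = expNeg (∑ i, (1 - expNeg (a i)) * μ (A i)) := by
  let e := Fintype.equivFin ι
  have hi := hΦ.indep (Fintype.card ι) (fun k => A (e.symm k)) (fun k => hA _)
    (fun i j hij => hd (e.symm.injective.ne hij))
  have hi' := hi.comp (fun k x => expNeg (a (e.symm k) * x))
    (fun k => measurable_expNeg.comp (measurable_const.mul measurable_id))
  have := lintegral_prod_eq_prod_lintegral_of_indepFun Finset.univ _ hi'
    (fun k => (measurable_expNeg.comp (measurable_const.mul measurable_id)).comp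
      (hΦ.measurable_apply (hA _)))
  simp only [expNeg_sum]
  rw [← e.symm.prod_comp]
  simp_rw [← e.symm.prod_comp (fun i => expNeg (a i * Φ _ (A i)))]
  refine this.trans (Finset.prod_congr rfl fun k _ => ?_)
  exact hΦ.lintegral_expNeg_apply (hA _) (hμ _) _

/-- The level sets of `g` are disjoint, so their counts are independent Poisson variables. The level
set of the value `0` is left out: it contributes nothing to either side and may have infinite mass.
-/
lemma IsPoissonProcess.lintegral_expNeg_simpleFunc (hΦ : IsPoissonProcess P Φ μ)
    (g : SimpleFunc E ℝ≥0∞) (hg : ∀ x ≠ 0, μ (g ⁻¹' {x}) ≠ ∞) :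
    ∫⁻ ω, expNeg (∫⁻ x, g x ∂(Φ ω)) ∂P = expNeg (∫⁻ x, 1 - expNeg (g x) ∂μ) := by
  have h := hΦ.lintegral_expNeg_sum (ι := {x // x ∈ g.range.filter (· ≠ 0)})
    (A := fun x => g ⁻¹' {x.1}) (fun x => g.measurableSet_fiber _)
    (fun x => hg _ (Finset.mem_filter.1 x.2).2)
    (fun x y hxy => Disjoint.preimage _ (Set.disjoint_singleton.2 fun h => hxy (Subtype.ext h)))
    (fun x => x.1)
  have h1 : ∀ ν : Measure E, ∀ w : ℝ≥0∞ → ℝ≥0∞, w 0 = 0 →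
      ∫⁻ x, w (g x) ∂ν = ∑ x : {x // x ∈ g.range.filter (· ≠ 0)}, w x.1 * ν (g ⁻¹' {x.1}) := by
    intro ν w hw
    have : ∫⁻ x, (g.map w) x ∂ν = _ := (g.map w).lintegral_eq_lintegral ν
    simp only [SimpleFunc.coe_map, Function.comp_apply] at this
    rw [this, SimpleFunc.map_lintegral, Finset.sum_coe_sort (g.range.filter (· ≠ 0))
      (fun x => w x * ν (g ⁻¹' {x})), Finset.sum_filter]
    refine Finset.sum_congr rfl fun x _ => ?_
    split_ifs with hx
    · rfl
    · rw [not_not.1 hx, hw, zero_mul]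
  simp_rw [h1 _ (fun x => x) rfl, h1 μ (fun x => 1 - expNeg x) (by simp)]
  exact h

/-- The Laplace functional of a Poisson process. -/
theorem IsPoissonProcess.lintegral_expNeg [SigmaFinite μ] [IsFiniteMeasure P]
    (hΦ : IsPoissonProcess P Φ μ) {g : E → ℝ≥0∞} (hg : Measurable g) :
    ∫⁻ ω, expNeg (∫⁻ x, g x ∂(Φ ω)) ∂P = expNeg (∫⁻ x, 1 - expNeg (g x) ∂μ) := by
  -- The cutoff to sets of finite measure gives every nonzero level set of `s n` finite mass, and `s
  -- n` still increases to `g`.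
  let s : ℕ → SimpleFunc E ℝ≥0∞ := fun n => (SimpleFunc.eapprox g n).restrict (spanningSets μ n)
  have hs : ∀ n, ⇑(s n) = (spanningSets μ n).indicator (SimpleFunc.eapprox g n) := fun n =>
    SimpleFunc.coe_restrict _ (measurableSet_spanningSets μ n)
  have hmono : ∀ x, Monotone fun n => s n x := by
    intro x m n hmn
    simp only [hs]
    exact (Set.indicator_le_indicator_of_subset (monotone_spanningSets μ hmn)
      (fun _ => zero_le) x).trans (Set.indicator_le_indicator
        (SimpleFunc.monotone_eapprox g hmn x))
  have hlim : ∀ x, Tendsto (fun n => s n x) atTop (𝓝 (g x)) := by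
    intro x
    refine (SimpleFunc.tendsto_eapprox hg x).congr' ?_
    filter_upwards [eventually_ge_atTop (spanningSetsIndex μ x)] with n hn
    rw [hs, Set.indicator_of_mem (mem_spanningSets_of_index_le μ x hn)]
  have hfin : ∀ n, ∀ y ≠ 0, μ (s n ⁻¹' {y}) ≠ ∞ := by
    intro n y hy
    refine ne_top_of_le_ne_top (measure_spanningSets_lt_top μ n).ne (measure_mono fun x hx => ?_)
    by_contra h
    have : s n x = 0 := by rw [hs, Set.indicator_of_notMem h]
    exact hy (by rw [← this]; exact (Set.mem_singleton_iff.1 hx).symm)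
  have key := fun n => hΦ.lintegral_expNeg_simpleFunc (s n) (hfin n)
  have hA : Tendsto (fun n => ∫⁻ ω, expNeg (∫⁻ x, s n x ∂(Φ ω)) ∂P) atTop
      (𝓝 (∫⁻ ω, expNeg (∫⁻ x, g x ∂(Φ ω)) ∂P)) := by
    refine tendsto_lintegral_of_dominated_convergence (fun _ => 1)
      (fun n => measurable_expNeg.comp ((Measure.measurable_lintegral (s n).measurable).comp
        hΦ.measurable)) (fun n => Eventually.of_forall fun ω => expNeg_le_one _)
      (by simp) (Eventually.of_forall fun ω => ?_)
    exact (continuous_expNeg.tendsto _).comp (lintegral_tendsto_of_tendsto_of_monotone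
      (fun n => (s n).measurable.aemeasurable) (Eventually.of_forall hmono)
      (Eventually.of_forall hlim))
  have hanti : Antitone expNeg := fun x y hxy => by
    simpa [expNeg] using hxy
  have hB : Tendsto (fun n => expNeg (∫⁻ x, 1 - expNeg (s n x) ∂μ)) atTop
      (𝓝 (expNeg (∫⁻ x, 1 - expNeg (g x) ∂μ))) := by
    refine (continuous_expNeg.tendsto _).comp (lintegral_tendsto_of_tendsto_of_monotone
      (fun n => (measurable_const.sub (measurable_expNeg.comp (s n).measurable)).aemeasurable)
      (Eventually.of_forall fun x m n hmn => ?_) (Eventually.of_forall fun x => ?_))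
    · exact tsub_le_tsub_left (hanti (hmono x hmn)) _
    · exact ENNReal.Tendsto.sub tendsto_const_nhds ((continuous_expNeg.tendsto _).comp (hlim x))
        (Or.inl ENNReal.one_ne_top)
  simp_rw [key] at hA
  exact tendsto_nhds_unique hA hB

end

/-! ### Random measures are determined by their Laplace functional -/

/-- The coordinate function `x ↦ exp (-x i)` on a finite power of `[0, ∞]`. -/
def expNegCoord {ι : Type*} [Fintype ι] (i : ι) : BoundedContinuousFunction (ι → ℝ≥0∞) ℝ :=
  BoundedContinuousFunction.mkOfCompact
    ⟨fun x => (expNeg (x i)).toReal, ENNReal.continuousOn_toReal.comp_continuous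
      (continuous_expNeg.comp (continuous_apply i)) fun _ => expNeg_ne_top _⟩

lemma expNegCoord_apply {ι : Type*} [Fintype ι] (i : ι) (x : ι → ℝ≥0∞) :
    expNegCoord i x = (expNeg (x i)).toReal := rfl

lemma exists_prod_pow_of_mem_closure {ι : Type*} [Fintype ι]
    {g : BoundedContinuousFunction (ι → ℝ≥0∞) ℝ}
    (hg : g ∈ Submonoid.closure (Set.range (expNegCoord (ι := ι)))) :
    ∃ k : ι → ℕ, ∀ x, g x = (∏ i, expNeg (x i) ^ k i).toReal := by
  classical
  induction hg using Submonoid.closure_induction with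
  | mem g hg =>
    obtain ⟨i, rfl⟩ := hg
    refine ⟨Pi.single i 1, fun x => ?_⟩
    rw [Finset.prod_eq_single i]
    · simp [expNegCoord_apply]
    · intro j _ hj
      simp [Pi.single_eq_of_ne hj]
    · simp
  | one => exact ⟨0, fun x => by simp⟩
  | mul g₁ g₂ _ _ h₁ h₂ =>
    obtain ⟨k₁, h₁⟩ := h₁
    obtain ⟨k₂, h₂⟩ := h₂
    refine ⟨k₁ + k₂, fun x => ?_⟩
    rw [BoundedContinuousFunction.mul_apply, h₁, h₂, ← ENNReal.toReal_mul,
      ← Finset.prod_mul_distrib]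
    simp [pow_add]

/-- Finite measures on a finite power of `[0, ∞]` are determined by their Laplace transform at
integer points. -/
theorem ext_of_lintegral_prod_expNeg {ι : Type*} [Fintype ι] {μ ν : Measure (ι → ℝ≥0∞)}
    [IsFiniteMeasure μ] [IsFiniteMeasure ν]
    (h : ∀ k : ι → ℕ, ∫⁻ x, ∏ i, expNeg (x i) ^ k i ∂μ = ∫⁻ x, ∏ i, expNeg (x i) ^ k i ∂ν) :
    μ = ν := by
  let S := Algebra.adjoin ℝ (Set.range (expNegCoord (ι := ι)))
  let A : StarSubalgebra ℝ (BoundedContinuousFunction (ι → ℝ≥0∞) ℝ) :=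
    { S with
      star_mem' := by
        intro a ha
        have : star a = a := by ext x; simp
        rw [this]; exact ha }
  refine ext_of_forall_mem_subalgebra_integral_eq_of_polish (𝕜 := ℝ) (A := A) ?_ ?_
  · intro x y hxy
    obtain ⟨i, hi⟩ := Function.ne_iff.1 hxy
    refine ⟨_, ⟨_, ⟨expNegCoord i, Algebra.subset_adjoin ⟨i, rfl⟩, rfl⟩, rfl⟩, ?_⟩
    intro h
    refine hi (expNeg_injective ?_)
    exact (ENNReal.toReal_eq_toReal_iff' (expNeg_ne_top _) (expNeg_ne_top _)).1 h
  · intro g hg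
    -- The algebra is the linear span of the monomials in the functions `exp (-x i)`, and the
    -- integral of a monomial is a Laplace transform at an integer point.
    have hg' : g ∈ Submodule.span ℝ
        (Submonoid.closure (Set.range (expNegCoord (ι := ι))) : Set _) := by
      rw [← Algebra.adjoin_eq_span]; exact hg
    clear hg
    induction hg' using Submodule.span_induction with
    | mem g hg =>
      obtain ⟨k, hk⟩ := exists_prod_pow_of_mem_closure hg
      simp only [hk]
      have hm : Measurable fun x : ι → ℝ≥0∞ => ∏ i, expNeg (x i) ^ k i :=
        Finset.measurable_fun_prod _ fun i _ =>
          (measurable_expNeg.comp (measurable_pi_apply i)).pow_const _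
      have hfin : ∀ x : ι → ℝ≥0∞, ∏ i, expNeg (x i) ^ k i < ∞ := fun x =>
        ENNReal.prod_lt_top fun i _ => ENNReal.pow_lt_top (expNeg_ne_top _).lt_top
      rw [integral_toReal hm.aemeasurable (Eventually.of_forall hfin),
        integral_toReal hm.aemeasurable (Eventually.of_forall hfin), h]
    | zero => simp
    | add a b _ _ ha hb =>
      simp only [BoundedContinuousFunction.coe_add, Pi.add_apply]
      rw [integral_add (a.integrable _) (b.integrable _), integral_add (a.integrable _)
        (b.integrable _), ha, hb]
    | smul c a _ ha =>
      simp only [BoundedContinuousFunction.coe_smul]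
      rw [integral_smul, integral_smul, ha]

lemma ext_of_lintegral_expNeg_pow {μ ν : Measure ℝ≥0∞} [IsFiniteMeasure μ] [IsFiniteMeasure ν]
    (h : ∀ k : ℕ, ∫⁻ x, expNeg x ^ k ∂μ = ∫⁻ x, expNeg x ^ k ∂ν) : μ = ν := by
  have hm : Measurable fun (x : ℝ≥0∞) (_ : Unit) => x := by fun_prop
  have hm' : Measurable fun x : Unit → ℝ≥0∞ => x () := by fun_prop
  have : μ.map (fun x (_ : Unit) => x) = ν.map (fun x (_ : Unit) => x) := by
    refine ext_of_lintegral_prod_expNeg fun k => ?_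
    have hk : Measurable fun x : Unit → ℝ≥0∞ => ∏ i, expNeg (x i) ^ k i :=
      Finset.measurable_fun_prod _ fun i _ =>
        (measurable_expNeg.comp (measurable_pi_apply i)).pow_const _
    rw [lintegral_map hk hm, lintegral_map hk hm]
    simpa using h (k ())
  have := congrArg (Measure.map fun x : Unit → ℝ≥0∞ => x ()) this
  rw [Measure.map_map hm' hm, Measure.map_map hm' hm] at this
  simpa [Function.comp_def] using this

lemma lintegral_sum_indicator {E ι : Type*} [MeasurableSpace E] (s : Finset ι)
    {A : ι → Set E} (hA : ∀ i, MeasurableSet (A i)) (k : ι → ℝ≥0∞) (ν : Measure E) :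
    ∫⁻ x, ∑ i ∈ s, (A i).indicator (fun _ => k i) x ∂ν = ∑ i ∈ s, k i * ν (A i) := by
  rw [lintegral_finsetSum _ fun i _ => measurable_const.indicator (hA i)]
  exact Finset.sum_congr rfl fun i _ => lintegral_indicator_const (hA i) _

section

variable {Ω Ω' E : Type*} [MeasurableSpace Ω] [MeasurableSpace Ω'] [MeasurableSpace E]
  {P : Measure Ω} {P' : Measure Ω'} {Φ : Ω → Measure E} {Ψ : Ω' → Measure E} {μ : Measure E}

/-- Random measures with the same Laplace functional have the same law. -/
theorem map_eq_of_laplace [IsFiniteMeasure P] [IsFiniteMeasure P']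
    (hΦ : Measurable Φ) (hΨ : Measurable Ψ)
    (h : ∀ g : E → ℝ≥0∞, Measurable g →
      ∫⁻ ω, expNeg (∫⁻ x, g x ∂(Φ ω)) ∂P = ∫⁻ ω, expNeg (∫⁻ x, g x ∂(Ψ ω)) ∂P') :
    P.map Φ = P'.map Ψ := by
  -- A measure is encoded by its values on all measurable sets. The σ-algebra on measures is the
  -- pullback of the product one, so the finite-dimensional laws of these values suffice.
  let J : Measure E → ({s : Set E // MeasurableSet s} → ℝ≥0∞) := fun m s => m s.1
  have hJ : Measurable J := measurable_pi_iff.2 fun s => Measure.measurable_coe s.2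
  have hproj : P.map (J ∘ Φ) = P'.map (J ∘ Ψ) := by
    refine IsProjectiveLimit.unique (P := fun I => (P'.map (J ∘ Ψ)).map I.restrict)
      (fun I => ?_) (fun I => rfl)
    have hr : Measurable (I.restrict (π := fun _ : {s : Set E // MeasurableSet s} => ℝ≥0∞)) :=
      Finset.measurable_restrict I
    change (P.map (J ∘ Φ)).map I.restrict = (P'.map (J ∘ Ψ)).map I.restrict
    rw [Measure.map_map hr (hJ.comp hΦ), Measure.map_map hr (hJ.comp hΨ)]
    refine ext_of_lintegral_prod_expNeg fun k => ?_
    have hk : Measurable fun x : I → ℝ≥0∞ => ∏ i, expNeg (x i) ^ k i :=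
      Finset.measurable_fun_prod _ fun i _ =>
        (measurable_expNeg.comp (measurable_pi_apply i)).pow_const _
    rw [lintegral_map hk (hr.comp (hJ.comp hΦ)), lintegral_map hk (hr.comp (hJ.comp hΨ))]
    -- A monomial in the values of `m` is the Laplace functional at a step function. The sets in `I`
    -- may overlap.
    have h1 : ∀ m : Measure E, ∏ i : I, expNeg (I.restrict (J m) i) ^ k i =
        expNeg (∫⁻ x, ∑ i : I, (i.1.1).indicator (fun _ => (k i : ℝ≥0∞)) x ∂m) := by
      intro m
      rw [lintegral_sum_indicator _ (fun i : I => i.1.2), expNeg_sum]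
      exact Finset.prod_congr rfl fun i _ => (expNeg_nsmul _ _).symm
    simp only [Function.comp_apply, h1]
    exact h _ (Finset.measurable_fun_sum _ fun i _ => measurable_const.indicator i.1.2)
  have hcomap : (inferInstance : MeasurableSpace (Measure E)) = MeasurableSpace.comap J
      MeasurableSpace.pi := by
    refine le_antisymm ?_ hJ.comap_le
    refine iSup₂_le fun s hs => ?_
    have : (fun m : Measure E => m s) = (fun x : {s : Set E // MeasurableSet s} → ℝ≥0∞ =>
        x ⟨s, hs⟩) ∘ J := rfl
    rw [this, ← MeasurableSpace.comap_comp]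
    refine MeasurableSpace.comap_mono ?_
    have := (measurable_pi_apply (X := fun _ : {s : Set E // MeasurableSet s} => ℝ≥0∞)
      ⟨s, hs⟩).comap_le
    rwa [BorelSpace.measurable_eq (α := ℝ≥0∞)] at this
  ext S hS
  rw [Measure.map_apply hΦ hS, Measure.map_apply hΨ hS]
  have hS₂ : MeasurableSet[MeasurableSpace.comap J MeasurableSpace.pi] S := by
    rw [← hcomap]; exact hS
  obtain ⟨S', hS', rfl⟩ := hS₂
  have := congrArg (fun m => m S') hproj
  rwa [Measure.map_apply (hJ.comp hΦ) hS', Measure.map_apply (hJ.comp hΨ) hS'] at this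

/-- A random measure whose Laplace functional is that of a Poisson process is a Poisson process. -/
theorem IsPoissonProcess.of_laplace [IsProbabilityMeasure P] (hΦ : Measurable Φ)
    (h : ∀ g : E → ℝ≥0∞, Measurable g →
      ∫⁻ ω, expNeg (∫⁻ x, g x ∂(Φ ω)) ∂P = expNeg (∫⁻ x, 1 - expNeg (g x) ∂μ)) :
    IsPoissonProcess P Φ μ := by
  have hmA : ∀ {A : Set E}, MeasurableSet A → Measurable fun ω => Φ ω A := fun hA =>
    (Measure.measurable_coe hA).comp hΦ
  have h1 : ∀ {A : Set E}, MeasurableSet A → ∀ k : ℕ,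
      ∫⁻ ω, expNeg (Φ ω A) ^ k ∂P = expNeg ((1 - expNeg 1 ^ k) * μ A) := by
    intro A hA k
    have := h (A.indicator fun _ => (k : ℝ≥0∞)) (measurable_const.indicator hA)
    simp_rw [lintegral_indicator_const hA, expNeg_nsmul] at this
    rw [this]
    congr 1
    rw [← lintegral_indicator_const hA]
    refine lintegral_congr fun x => ?_
    by_cases hx : x ∈ A
    · simp [hx, ← expNeg_nsmul]
    · simp [hx]
  refine ⟨hΦ, fun A hA hμ => ⟨(hmA hA).aemeasurable, ?_⟩, fun n A hA hd => ?_⟩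
  · have := Measure.isProbabilityMeasure_map (μ := P) (hmA hA).aemeasurable
    refine ext_of_lintegral_expNeg_pow fun k => ?_
    rw [lintegral_map (measurable_expNeg.pow_const k) (hmA hA), h1 hA,
      lintegral_map (measurable_expNeg.pow_const k) .of_discrete]
    have : ∀ n : ℕ, expNeg n ^ k = (expNeg 1 ^ k) ^ n := fun n => by
      rw [← pow_mul, mul_comm, pow_mul, ← expNeg_nsmul n, mul_one]
    simp_rw [this]
    rw [lintegral_poissonMeasure_pow _ (pow_le_one₀ zero_le (expNeg_le_one 1)),
      ENNReal.coe_toNNReal hμ, mul_comm]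
  · rw [iIndepFun_iff_map_fun_eq_pi_map fun i => (hmA (hA i)).aemeasurable]
    have hp := fun i => Measure.isProbabilityMeasure_map (μ := P) (hmA (hA i)).aemeasurable
    have hmall : Measurable fun ω i => Φ ω (A i) := measurable_pi_iff.2 fun i => hmA (hA i)
    refine ext_of_lintegral_prod_expNeg fun k => ?_
    have hk : Measurable fun x : Fin n → ℝ≥0∞ => ∏ i, expNeg (x i) ^ k i :=
      Finset.measurable_fun_prod _ fun i _ =>
        (measurable_expNeg.comp (measurable_pi_apply i)).pow_const _
    have hi : iIndepFun (fun i (x : Fin n → ℝ≥0∞) => expNeg (x i) ^ k i)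
        (Measure.pi fun i => P.map fun ω => Φ ω (A i)) :=
      iIndepFun_pi (X := fun i x => expNeg x ^ k i)
        fun i => (measurable_expNeg.pow_const (k i)).aemeasurable
    rw [lintegral_prod_eq_prod_lintegral_of_indepFun _ _ hi fun i =>
      (measurable_expNeg.comp (measurable_pi_apply i)).pow_const _, lintegral_map hk hmall]
    have h2 : ∀ i, ∫⁻ x : Fin n → ℝ≥0∞, expNeg (x i) ^ k i
        ∂(Measure.pi fun i => P.map fun ω => Φ ω (A i)) =
        expNeg ((1 - expNeg 1 ^ k i) * μ (A i)) := by
      intro i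
      rw [← h1 (hA i), ← lintegral_map (measurable_expNeg.pow_const (k i)) (hmA (hA i)),
        ← (measurePreserving_eval (fun i => P.map fun ω => Φ ω (A i)) i).map_eq,
        lintegral_map (measurable_expNeg.pow_const (k i)) (measurable_pi_apply i)]
    simp_rw [h2, ← expNeg_sum, ← lintegral_sum_indicator Finset.univ hA]
    have h3 : ∀ ω, ∏ i, expNeg (Φ ω (A i)) ^ k i =
        expNeg (∫⁻ x, ∑ i, (A i).indicator (fun _ => (k i : ℝ≥0∞)) x ∂(Φ ω)) := by
      intro ω
      rw [lintegral_sum_indicator _ hA, expNeg_sum]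
      exact Finset.prod_congr rfl fun i _ => (expNeg_nsmul _ _).symm
    simp_rw [h3]
    rw [h _ (Finset.measurable_fun_sum _ fun i _ => measurable_const.indicator (hA i))]
    congr 1
    refine lintegral_congr fun x => ?_
    -- By disjointness at most one indicator is nonzero at `x`, so `1 - exp (-∑)` is the sum of the
    -- individual terms. This is what factorises the joint Laplace transform.
    by_cases hx : ∃ i, x ∈ A i
    · obtain ⟨i, hi⟩ := hx
      have hne : ∀ j, j ≠ i → x ∉ A j := fun j hj hxj => (hd hj).le_bot ⟨hxj, hi⟩
      rw [Finset.sum_eq_single i, Finset.sum_eq_single i]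
      · simp [hi, ← expNeg_nsmul]
      · intro j _ hj; simp [hne j hj]
      · simp
      · intro j _ hj; simp [hne j hj]
      · simp
    · push Not at hx
      simp [hx]

end

/-! ### Marked Poisson processes -/

lemma tendsto_prod_expNeg {ι : Type*} (x : ι → ℝ≥0∞) :
    Tendsto (fun s : Finset ι => ∏ i ∈ s, expNeg (x i)) atTop (𝓝 (expNeg (∑' i, x i))) := by
  simp_rw [← expNeg_sum]
  exact (continuous_expNeg.tendsto _).comp ENNReal.summable.hasSum

section

variable {ι Z : Type*} [Countable ι] [MeasurableSpace Z] {ν : Measure Z} [IsProbabilityMeasure ν]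

lemma lintegral_expNeg_le_one (g : Z → ℝ≥0∞) : ∫⁻ z, expNeg (g z) ∂ν ≤ 1 := by
  calc _ ≤ ∫⁻ _, 1 ∂ν := lintegral_mono fun _ => expNeg_le_one _
    _ = 1 := by simp

/-- Independence factorises finite products, and dominated convergence along finite subsets gives
the infinite one. Writing the factors as `expNeg (negLog _)` turns the infinite product into a sum
in the exponent. -/
lemma lintegral_expNeg_tsum_infinitePi {g : ι → Z → ℝ≥0∞} (hg : ∀ i, Measurable (g i)) :
    ∫⁻ z, expNeg (∑' i, g i (z i)) ∂(Measure.infinitePi fun _ : ι => ν) =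
      expNeg (∑' i, negLog (∫⁻ z, expNeg (g i z) ∂ν)) := by
  have hm : ∀ i, Measurable fun z : ι → Z => expNeg (g i (z i)) := fun i =>
    measurable_expNeg.comp ((hg i).comp (measurable_pi_apply i))
  have h1 : ∀ s : Finset ι, ∫⁻ z, ∏ i ∈ s, expNeg (g i (z i))
      ∂(Measure.infinitePi fun _ : ι => ν) =
        ∏ i ∈ s, expNeg (negLog (∫⁻ z, expNeg (g i z) ∂ν)) := by
    intro s
    have hi := iIndepFun_infinitePi (P := fun _ : ι => ν) (X := fun i z => expNeg (g i z))
      fun i => measurable_expNeg.comp (hg i)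
    rw [lintegral_prod_eq_prod_lintegral_of_indepFun s _ hi hm]
    refine Finset.prod_congr rfl fun i _ => ?_
    rw [expNeg_negLog (lintegral_expNeg_le_one _)]
    conv_rhs => rw [← Measure.infinitePi_map_eval (fun _ : ι => ν) i]
    have hgi : Measurable fun z => expNeg (g i z) := measurable_expNeg.comp (hg i)
    rw [lintegral_map hgi (measurable_pi_apply i)]
  refine tendsto_nhds_unique ?_ (tendsto_prod_expNeg _)
  simp_rw [← h1]
  refine tendsto_lintegral_filter_of_dominated_convergence (fun _ => 1)
    (Eventually.of_forall fun s => Finset.measurable_fun_prod _ fun i _ => hm i)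
    (Eventually.of_forall fun s => Eventually.of_forall fun z =>
      Finset.prod_le_one' fun i _ => expNeg_le_one _) (by simp)
    (Eventually.of_forall fun z => tendsto_prod_expNeg _)

variable {Ω S : Type*} [MeasurableSpace Ω] [MeasurableSpace S] {P : Measure Ω}
  [IsProbabilityMeasure P]

/-- Fubini: for frozen points the marks are integrated out, leaving a functional of the points
alone. -/
lemma lintegral_expNeg_tsum_of_indepFun {T : Ω → ι → S} {W : Ω → ι → Z} (hT : Measurable T)
    (hW : HasLaw W (Measure.infinitePi fun _ => ν) P) (hTW : IndepFun T W P)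
    {G : S → Z → ℝ≥0∞} (hG : Measurable fun p : S × Z => G p.1 p.2) :
    ∫⁻ ω, expNeg (∑' i, G (T ω i) (W ω i)) ∂P =
      ∫⁻ ω, expNeg (∑' i, negLog (∫⁻ z, expNeg (G (T ω i) z) ∂ν)) ∂P := by
  have hlaw : P.map (fun ω => (T ω, W ω)) = (P.map T).prod (Measure.infinitePi fun _ => ν) := by
    rw [(indepFun_iff_map_prod_eq_prod_map_map hT.aemeasurable hW.aemeasurable).1 hTW, hW.map_eq]
  have hm : Measurable fun p : (ι → S) × (ι → Z) => expNeg (∑' i, G (p.1 i) (p.2 i)) := by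
    refine measurable_expNeg.comp (Measurable.tsum fun i => ?_)
    have hi : Measurable fun p : (ι → S) × (ι → Z) => (p.1 i, p.2 i) := by fun_prop
    exact hG.comp hi
  rw [← lintegral_map' (f := fun p : (ι → S) × (ι → Z) => expNeg (∑' i, G (p.1 i) (p.2 i)))
    hm.aemeasurable (hT.aemeasurable.prodMk hW.aemeasurable), hlaw,
    lintegral_prod _ hm.aemeasurable, lintegral_map hm.lintegral_prod_right hT]
  refine lintegral_congr fun ω => ?_
  exact lintegral_expNeg_tsum_infinitePi (g := fun i z => G (T ω i) z)
    fun i => hG.of_uncurry_left (x := T ω i)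

open Classical in
/-- Attaching i.i.d. marks to (the active part of) an enumeration of the points of a Poisson
process: Laplace functional of the marked process. -/
theorem IsPoissonProcess.lintegral_expNeg_marked {μ : Measure S} [SigmaFinite μ]
    {Φ : Ω → Measure S} (hΦ : IsPoissonProcess P Φ μ) {T : Ω → ι → Prop × S} (hT : Measurable T)
    (hsum : ∀ ω (g : S → ℝ≥0∞), Measurable g →
      ∫⁻ x, g x ∂(Φ ω) = ∑' i, if (T ω i).1 then g (T ω i).2 else 0)
    {W : Ω → ι → Z} (hW : HasLaw W (Measure.infinitePi fun _ => ν) P) (hTW : IndepFun T W P)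
    {G : S → Z → ℝ≥0∞} (hG : Measurable fun p : S × Z => G p.1 p.2) :
    ∫⁻ ω, expNeg (∑' i, if (T ω i).1 then G (T ω i).2 (W ω i) else 0) ∂P =
      expNeg (∫⁻ s, ∫⁻ z, 1 - expNeg (G s z) ∂ν ∂μ) := by
  have hG' : Measurable fun p : (Prop × S) × Z => if p.1.1 then G p.1.2 p.2 else 0 :=
    Measurable.ite (measurable_fst.comp measurable_fst).setOf
      (hG.comp ((measurable_snd.comp measurable_fst).prodMk measurable_snd)) measurable_const
  have hm : Measurable fun s => ∫⁻ z, expNeg (G s z) ∂ν :=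
    (measurable_expNeg.comp hG).lintegral_prod_right'
  have hm' : Measurable fun s => negLog (∫⁻ z, expNeg (G s z) ∂ν) := measurable_negLog.comp hm
  rw [lintegral_expNeg_tsum_of_indepFun (G := fun p z => if p.1 then G p.2 z else 0)
    hT hW hTW hG']
  -- Inactive indices contribute `negLog 1 = 0`, so the sum is the integral of one function against
  -- `Φ`, and the Laplace functional of the unmarked process applies. There `expNeg` undoes
  -- `negLog`.
  have h1 : ∀ ω, ∑' i, negLog (∫⁻ z, expNeg (if (T ω i).1 then G (T ω i).2 z else 0) ∂ν) =
      ∫⁻ s, negLog (∫⁻ z, expNeg (G s z) ∂ν) ∂(Φ ω) := by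
    intro ω
    rw [hsum ω _ hm']
    refine tsum_congr fun i => ?_
    split_ifs with hi
    · rfl
    · simp [negLog]
  simp_rw [h1]
  rw [hΦ.lintegral_expNeg hm']
  congr 1
  refine lintegral_congr fun s => ?_
  have hs : Measurable fun z => expNeg (G s z) := measurable_expNeg.comp hG.of_uncurry_left
  rw [expNeg_negLog (lintegral_expNeg_le_one _), lintegral_sub hs
    (ne_top_of_le_ne_top ENNReal.one_ne_top (lintegral_expNeg_le_one _))
    (Eventually.of_forall fun z => expNeg_le_one _)]
  simp

end

/-! ### The generating procedure -/

/-- The generating procedure stops with exactly `n` events. -/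
def StopsAt (L : ℕ → ℕ) (n : ℕ) : Prop :=
  1 + ∑ i ∈ Finset.range n, L i = n ∧ ∀ m < n, 1 + ∑ i ∈ Finset.range m, L i ≠ m

lemma StopsAt.pos {L : ℕ → ℕ} {n : ℕ} (h : StopsAt L n) : 0 < n := by
  rcases Nat.eq_zero_or_pos n with rfl | hn
  · simpa using h.1
  · exact hn

lemma StopsAt.unique {L : ℕ → ℕ} {m n : ℕ} (hm : StopsAt L m) (hn : StopsAt L n) : m = n := by
  rcases lt_trichotomy m n with h | h | h
  · exact absurd hm.1 (hn.2 m h)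
  · exact h
  · exact absurd hn.1 (hm.2 n h)

lemma StopsAt.congr {L L' : ℕ → ℕ} {n : ℕ} (h : StopsAt L n) (hL : ∀ i < n, L i = L' i) :
    StopsAt L' n := by
  have hs : ∀ m ≤ n, ∑ i ∈ Finset.range m, L' i = ∑ i ∈ Finset.range m, L i := fun m hm =>
    Finset.sum_congr rfl fun i hi => (hL i (by simp at hi; omega)).symm
  exact ⟨by rw [hs n le_rfl]; exact h.1, fun m hm => by rw [hs m hm.le]; exact h.2 m hm⟩

lemma exists_stopsAt {L : ℕ → ℕ} (h : ∃ n, 1 + ∑ i ∈ Finset.range n, L i = n) :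
    ∃ n, StopsAt L n := by
  classical
  exact ⟨Nat.find h, Nat.find_spec h, fun m hm => Nat.find_min h hm⟩

/-- The walk `1 + ∑ L i - m` starts at `1` and decreases by at most one per step, so it stays
positive until it hits `0`. -/
lemma le_sum_of_forall_ne {L : ℕ → ℕ} {n : ℕ}
    (h : ∀ m < n, 1 + ∑ i ∈ Finset.range m, L i ≠ m) :
    ∀ m < n, m ≤ ∑ i ∈ Finset.range m, L i := by
  intro m
  induction m with
  | zero => simp
  | succ m ih =>
    intro hm
    have h1 := ih (by omega)
    have h2 := h (m + 1) hm
    rw [Finset.sum_range_succ] at h2 ⊢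
    omega

lemma generate_of_stopsAt {L : ℕ → ℕ} {n : ℕ} (h : StopsAt L n) (b : ℕ → ℝ) :
    generate L b = ⟨n, fun k => (eventTime L b k, parentIndex L k)⟩ := by
  classical
  have hex : ∃ n, 1 + ∑ i ∈ Finset.range n, L i = n := ⟨n, h.1⟩
  have hn : Nat.find hex = n :=
    StopsAt.unique ⟨Nat.find_spec hex, fun m hm => Nat.find_min hex hm⟩ h
  subst hn
  rw [generate, dif_pos hex]

lemma generate_of_not_stopsAt {L : ℕ → ℕ} (h : ¬ ∃ n, StopsAt L n) (b : ℕ → ℝ) :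
    generate L b = ⟨0, Fin.elim0⟩ := by
  rw [generate, dif_neg]
  exact fun h' => h (exists_stopsAt h')

/-- Size `0` must be excluded because it encodes a procedure that never stops. -/
lemma generate_fst_eq_iff {L : ℕ → ℕ} {b : ℕ → ℝ} {n : ℕ} (hn : n ≠ 0) :
    (generate L b).1 = n ↔ StopsAt L n := by
  by_cases h : ∃ m, StopsAt L m
  · obtain ⟨m, hm⟩ := h
    rw [generate_of_stopsAt hm]
    constructor
    · rintro rfl; exact hm
    · exact hm.unique
  · rw [generate_of_not_stopsAt h]
    constructor
    · intro h0; exact absurd h0.symm hn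
    · intro h0; exact absurd ⟨n, h0⟩ h

/-- With one-based parent indices this puts the parent of an event `j ≥ 1` at a position `≤ j - 1`.
The minimum in `eventTime` is then inactive. -/
lemma StopsAt.parentIndex_le {L : ℕ → ℕ} {n : ℕ} (h : StopsAt L n) {j : ℕ} (hj : j < n) :
    parentIndex L j ≤ j :=
  Nat.sInf_le (le_sum_of_forall_ne h.2 j hj)

lemma StopsAt.le_sum_parentIndex {L : ℕ → ℕ} {n : ℕ} (h : StopsAt L n) {j : ℕ} (hj : j < n) :
    j ≤ ∑ i ∈ Finset.range (parentIndex L j), L i :=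
  Nat.sInf_mem (s := {k | j ≤ ∑ i ∈ Finset.range k, L i}) ⟨j, le_sum_of_forall_ne h.2 j hj⟩

lemma StopsAt.parentIndex_congr {L L' : ℕ → ℕ} {n : ℕ} (h : StopsAt L n)
    (hL : ∀ i < n, L i = L' i) {j : ℕ} (hj : j < n) : parentIndex L j = parentIndex L' j := by
  have h' := h.congr hL
  have hs : ∀ m ≤ n, ∑ i ∈ Finset.range m, L' i = ∑ i ∈ Finset.range m, L i := fun m hm =>
    Finset.sum_congr rfl fun i hi => (hL i (by simp at hi; omega)).symm
  have h1 := h.parentIndex_le hj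
  have h2 := h'.parentIndex_le hj
  refine le_antisymm (Nat.sInf_le ?_) (Nat.sInf_le ?_)
  · rw [Set.mem_ofPred_eq, ← hs _ (by omega)]; exact h'.le_sum_parentIndex hj
  · rw [Set.mem_ofPred_eq, hs _ (by omega)]; exact h.le_sum_parentIndex hj

lemma eventTime_zero (L : ℕ → ℕ) (b : ℕ → ℝ) : eventTime L b 0 = 0 := by
  rw [eventTime]

lemma eventTime_succ (L : ℕ → ℕ) (b : ℕ → ℝ) (j : ℕ) :
    eventTime L b (j + 1) = eventTime L b (min (parentIndex L (j + 1) - 1) j) + b (j + 1) := by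
  rw [eventTime]

lemma StopsAt.eventTime_congr {L L' : ℕ → ℕ} {b b' : ℕ → ℝ} {n : ℕ} (h : StopsAt L n)
    (hL : ∀ i < n, L i = L' i) (hb : ∀ i ∈ Finset.Ico 1 n, b i = b' i) (j : ℕ) (hj : j < n) :
    eventTime L b j = eventTime L' b' j := by
  induction j using Nat.strong_induction_on with
  | _ j ih =>
    cases j with
    | zero => rw [eventTime_zero, eventTime_zero]
    | succ j =>
      rw [eventTime_succ, eventTime_succ, ← h.parentIndex_congr hL hj,
        ih _ (by omega) (by omega), hb (j + 1) (by simp; omega)]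

/-- Locality: a cluster with `n` events depends on `n` offspring counts and on the birth times at
positions `1, …, n - 1` only. This makes finite-dimensional changes of measure applicable to it. -/
lemma generate_congr {L L' : ℕ → ℕ} {b b' : ℕ → ℝ} {n : ℕ} (h : StopsAt L n)
    (hL : ∀ i < n, L i = L' i) (hb : ∀ i ∈ Finset.Ico 1 n, b i = b' i) :
    generate L b = generate L' b' := by
  rw [generate_of_stopsAt h, generate_of_stopsAt (h.congr hL)]
  congr 1
  funext k
  rw [h.eventTime_congr hL hb k k.2, h.parentIndex_congr hL k.2]

lemma StopsAt.time_generate {L : ℕ → ℕ} {n : ℕ} (h : StopsAt L n) (b : ℕ → ℝ) {k : ℕ}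
    (hk : k < n) : (generate L b).time k = eventTime L b k := by
  rw [generate_of_stopsAt h, Cluster.time, dif_pos hk]

lemma StopsAt.parent_generate {L : ℕ → ℕ} {n : ℕ} (h : StopsAt L n) (b : ℕ → ℝ) {k : ℕ}
    (hk : k < n) : (generate L b).parent k = parentIndex L k := by
  rw [generate_of_stopsAt h, Cluster.parent, dif_pos hk]

lemma StopsAt.totalBirth_generate {L : ℕ → ℕ} {n : ℕ} (h : StopsAt L n) (b : ℕ → ℝ) :
    (generate L b).totalBirth = ∑ k ∈ Finset.Ico 1 n, b k := by
  have hn : (generate L b).1 = n := (generate_fst_eq_iff h.pos.ne').2 h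
  rw [Cluster.totalBirth, hn]
  refine Finset.sum_congr rfl fun k hk => ?_
  obtain ⟨hk1, hkn⟩ := Finset.mem_Ico.1 hk
  have h1 := h.parentIndex_le hkn
  rw [h.time_generate b hkn, h.parent_generate b hkn, h.time_generate b (by omega)]
  obtain ⟨j, rfl⟩ : ∃ j, k = j + 1 := ⟨k - 1, by omega⟩
  rw [eventTime_succ, min_eq_left (by omega)]
  ring

/-- The time of an event adds up the birth times along its ancestral line, whose positions are
distinct and at most `j`. -/
lemma eventTime_le_sum {L : ℕ → ℕ} {b : ℕ → ℝ} (hb : ∀ j, 0 ≤ b j) (j : ℕ) :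
    eventTime L b j ≤ ∑ k ∈ Finset.Ico 1 (j + 1), b k := by
  induction j using Nat.strong_induction_on with
  | _ j ih =>
    cases j with
    | zero => simp [eventTime_zero]
    | succ j =>
      rw [eventTime_succ, Finset.sum_Ico_succ_top (by omega)]
      gcongr
      refine (ih _ (by omega)).trans ?_
      exact Finset.sum_le_sum_of_subset_of_nonneg (Finset.Ico_subset_Ico le_rfl (by omega))
        fun k _ _ => hb k

/-- This inequality is what keeps the acceptance threshold below one for clusters that last past
`0`. -/
lemma StopsAt.length_le_totalBirth {L : ℕ → ℕ} {b : ℕ → ℝ} {n : ℕ} (h : StopsAt L n)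
    (hb : ∀ j, 0 ≤ b j) : (generate L b).length ≤ (generate L b).totalBirth := by
  have hn : (generate L b).1 = n := (generate_fst_eq_iff h.pos.ne').2 h
  rw [h.totalBirth_generate, Cluster.length]
  have : Nonempty (Fin (generate L b).1) := ⟨⟨0, hn ▸ h.pos⟩⟩
  refine ciSup_le fun k => ?_
  have hk : (k : ℕ) < n := hn ▸ k.2
  rw [h.time_generate b hk, h.time_generate b h.pos, eventTime_zero, sub_zero]
  refine (eventTime_le_sum hb k).trans ?_
  exact Finset.sum_le_sum_of_subset_of_nonneg (Finset.Ico_subset_Ico le_rfl (by omega))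
    fun k _ _ => hb k

/-! ### Translations of clusters -/

namespace Cluster

lemma shift_fst (s : ℝ) (c : Cluster) : (c.shift s).1 = c.1 := rfl

lemma time_shift {c : Cluster} {k : ℕ} (s : ℝ) (hk : k < c.1) :
    (c.shift s).time k = c.time k + s := by
  have hk' : k < (c.shift s).1 := hk
  rw [time, time, dif_pos hk, dif_pos hk']
  rfl

lemma parent_shift (c : Cluster) (k : ℕ) (s : ℝ) : (c.shift s).parent k = c.parent k := by
  by_cases hk : k < c.1
  · have hk' : k < (c.shift s).1 := hk
    rw [parent, parent, dif_pos hk, dif_pos hk']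
    rfl
  · have hk' : ¬ k < (c.shift s).1 := hk
    rw [parent, parent, dif_neg hk, dif_neg hk']

lemma length_shift (c : Cluster) (s : ℝ) : (c.shift s).length = c.length := by
  change ⨆ k : Fin c.1, ((c.shift s).time k - (c.shift s).time 0) =
    ⨆ k : Fin c.1, (c.time k - c.time 0)
  refine iSup_congr fun k => ?_
  rw [time_shift s k.2, time_shift s (k.pos : 0 < c.1)]
  ring

end Cluster

/-- Invariance can fail for an arbitrary list: a parent index outside the list gets the default time
`0`, which is not translated. Generated clusters have their parents inside the list. -/
lemma totalBirth_shift_generate (L : ℕ → ℕ) (b : ℕ → ℝ) (s : ℝ) :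
    ((generate L b).shift s).totalBirth = (generate L b).totalBirth := by
  by_cases h : ∃ n, StopsAt L n
  · obtain ⟨n, h⟩ := h
    have hn : (generate L b).1 = n := (generate_fst_eq_iff h.pos.ne').2 h
    rw [Cluster.totalBirth, Cluster.totalBirth, Cluster.shift_fst, hn]
    refine Finset.sum_congr rfl fun k hk => ?_
    obtain ⟨hk1, hkn⟩ := Finset.mem_Ico.1 hk
    have h1 := h.parentIndex_le hkn
    rw [Cluster.parent_shift, h.parent_generate b hkn, Cluster.time_shift s (by omega),
      Cluster.time_shift s (by omega)]
    ring
  · rw [generate_of_not_stopsAt h, Cluster.totalBirth, Cluster.totalBirth]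
    rfl

lemma time_zero_shift_generate {L : ℕ → ℕ} {n : ℕ} (h : StopsAt L n) (b : ℕ → ℝ) (s : ℝ) :
    ((generate L b).shift s).time 0 = s := by
  have hn : (generate L b).1 = n := (generate_fst_eq_iff h.pos.ne').2 h
  rw [Cluster.time_shift s (hn ▸ h.pos), h.time_generate b h.pos, eventTime_zero, zero_add]

/-! ### Measurability -/

lemma measurable_sigma_of_forall {α β : Type*} {X : α → Type*} [∀ a, MeasurableSpace (X a)]
    [MeasurableSpace β] {f : Sigma X → β} (hf : ∀ a, Measurable fun x => f ⟨a, x⟩) :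
    Measurable f := by
  intro S hS
  rw [Sigma.instMeasurableSpace, MeasurableSpace.measurableSet_iInf]
  exact fun a => hf a hS

lemma measurable_sigmaMk {α : Type*} {X : α → Type*} [∀ a, MeasurableSpace (X a)] (a : α) :
    Measurable (Sigma.mk a : X a → Sigma X) := by
  intro S hS
  rw [Sigma.instMeasurableSpace, MeasurableSpace.measurableSet_iInf] at hS
  exact hS a

lemma measurable_sigma_fst {α : Type*} {X : α → Type*} [∀ a, MeasurableSpace (X a)]
    [MeasurableSpace α] : Measurable (Sigma.fst : Sigma X → α) :=
  measurable_sigma_of_forall fun _ => measurable_const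

lemma measurableEmbedding_sigmaMk {α : Type*} {X : α → Type*} [∀ a, MeasurableSpace (X a)] (a : α) :
    MeasurableEmbedding (Sigma.mk a : X a → Sigma X) where
  injective := sigma_mk_injective
  measurable := measurable_sigmaMk a
  measurableSet_image' := by
    intro S hS
    rw [Sigma.instMeasurableSpace, MeasurableSpace.measurableSet_iInf]
    intro a'
    change MeasurableSet (Sigma.mk a' ⁻¹' (Sigma.mk a '' S))
    by_cases h : a' = a
    · subst h
      rwa [Set.preimage_image_eq _ sigma_mk_injective]
    · rw [Set.preimage_image_sigmaMk_of_ne h]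
      exact .empty

/-- Countability of `α` matters here: the preimage is cut into countably many pieces, each the image
of a measurable set under a measurable embedding. -/
lemma measurable_prod_sigma_of_forall {α β γ : Type*} {X : α → Type*} [Countable α]
    [∀ a, MeasurableSpace (X a)] [MeasurableSpace β] [MeasurableSpace γ]
    {f : γ × Sigma X → β} (hf : ∀ a, Measurable fun p : γ × X a => f (p.1, ⟨a, p.2⟩)) :
    Measurable f := by
  intro S hS
  have : f ⁻¹' S = ⋃ a,
      (Prod.map id (Sigma.mk a)) '' ((fun p : γ × X a => f (p.1, ⟨a, p.2⟩)) ⁻¹' S) := by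
    ext ⟨c, a, x⟩
    simp only [Set.mem_preimage, Set.mem_iUnion, Set.mem_image, Prod.exists, Prod.map, id,
      Prod.mk.injEq]
    constructor
    · intro h; exact ⟨a, c, x, h, rfl, rfl⟩
    · rintro ⟨a', c', x', h, rfl, h'⟩
      rw [← h']; exact h
  rw [this]
  exact MeasurableSet.iUnion fun a =>
    (MeasurableEmbedding.id.prodMap (measurableEmbedding_sigmaMk a)).measurableSet_image'
      (hf a hS)

namespace Cluster

lemma measurable_time (k : ℕ) : Measurable fun c : Cluster => c.time k := by
  refine measurable_sigma_of_forall fun n => ?_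
  by_cases hk : k < n
  · simp only [time, hk, dite_true]
    change Measurable fun x : Fin n → ℝ × ℕ => (x ⟨k, hk⟩).1
    fun_prop
  · simp only [time, hk, dite_false]
    fun_prop

lemma measurable_parent (k : ℕ) : Measurable fun c : Cluster => c.parent k := by
  refine measurable_sigma_of_forall fun n => ?_
  by_cases hk : k < n
  · simp only [parent, hk, dite_true]
    change Measurable fun x : Fin n → ℝ × ℕ => (x ⟨k, hk⟩).2
    fun_prop
  · simp only [parent, hk, dite_false]
    fun_prop

lemma measurable_length : Measurable length := by
  refine measurable_sigma_of_forall fun n => ?_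
  simp only [length]
  exact Measurable.iSup fun k =>
    ((measurable_time k).comp (measurable_sigmaMk n)).sub
      ((measurable_time 0).comp (measurable_sigmaMk n))

lemma measurable_totalBirth : Measurable totalBirth := by
  have h : Measurable fun p : Cluster × ℕ => p.1.time p.2 :=
    measurable_from_prod_countable_left fun k => measurable_time k
  refine measurable_sigma_of_forall fun n => ?_
  simp only [totalBirth]
  refine Finset.measurable_fun_sum _ fun k _ => ?_
  refine Measurable.sub ((measurable_time k).comp (measurable_sigmaMk n)) ?_
  have hp : Measurable fun x : Fin n → ℝ × ℕ =>
      ((⟨n, x⟩ : Cluster), Cluster.parent ⟨n, x⟩ k - 1) :=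
    (measurable_sigmaMk n).prodMk
      ((Measurable.of_discrete (f := fun m : ℕ => m - 1)).comp
        ((measurable_parent k).comp (measurable_sigmaMk n)))
  exact h.comp hp

lemma measurable_shift : Measurable fun p : ℝ × Cluster => p.2.shift p.1 := by
  refine measurable_prod_sigma_of_forall fun n => ?_
  have : Measurable fun p : ℝ × (Fin n → ℝ × ℕ) => fun k => ((p.2 k).1 + p.1, (p.2 k).2) := by
    fun_prop
  exact (measurable_sigmaMk n).comp this

lemma measurable_card : Measurable card :=
  (Measurable.of_discrete (f := fun n : ℕ => if n = 0 then (⊤ : ℕ∞) else n)).comp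
    measurable_sigma_fst

end Cluster

lemma measurableSet_stopsAt (n : ℕ) : MeasurableSet {L : ℕ → ℕ | StopsAt L n} := by
  have hs : ∀ m, Measurable fun L : ℕ → ℕ => 1 + ∑ i ∈ Finset.range m, L i := fun m => by fun_prop
  have h : ∀ m, MeasurableSet {L : ℕ → ℕ | 1 + ∑ i ∈ Finset.range m, L i = m} := fun m =>
    measurableSet_eq_fun (hs m) measurable_const
  have : {L : ℕ → ℕ | StopsAt L n} = {L : ℕ → ℕ | 1 + ∑ i ∈ Finset.range n, L i = n} ∩
      ⋂ m ∈ Finset.range n, {L : ℕ → ℕ | 1 + ∑ i ∈ Finset.range m, L i = m}ᶜ := by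
    ext L
    simp [StopsAt]
  rw [this]
  exact (h n).inter (Finset.measurableSet_biInter _ fun m _ => (h m).compl)

lemma measurable_parentIndex (j : ℕ) : Measurable fun L : ℕ → ℕ => parentIndex L j := by
  have hs : ∀ m, Measurable fun L : ℕ → ℕ => ∑ i ∈ Finset.range m, L i := fun m => by fun_prop
  have h : ∀ m, MeasurableSet {L : ℕ → ℕ | j ≤ ∑ i ∈ Finset.range m, L i} := fun m =>
    measurableSet_le measurable_const (hs m)
  refine measurable_of_Iic fun k => ?_
  -- The second piece is where the infimum runs over the empty set and takes the default value `0`.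
  have : (fun L : ℕ → ℕ => parentIndex L j) ⁻¹' Set.Iic k =
      (⋃ m ∈ Finset.range (k + 1), {L : ℕ → ℕ | j ≤ ∑ i ∈ Finset.range m, L i}) ∪
        ⋂ m, {L : ℕ → ℕ | j ≤ ∑ i ∈ Finset.range m, L i}ᶜ := by
    ext L
    simp only [Set.mem_preimage, Set.mem_Iic, Set.mem_union, Set.mem_iUnion, Set.mem_iInter,
      Set.mem_ofPred_eq, Set.mem_compl_iff, Finset.mem_range, exists_prop]
    constructor
    · intro hk
      by_cases hne : ∃ m, j ≤ ∑ i ∈ Finset.range m, L i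
      · exact Or.inl ⟨_, Nat.lt_succ_of_le hk, Nat.sInf_mem hne⟩
      · exact Or.inr (not_exists.1 hne)
    · rintro (⟨m, hm, h⟩ | h)
      · exact (Nat.sInf_le h : parentIndex L j ≤ m).trans (by omega)
      · have : {m | j ≤ ∑ i ∈ Finset.range m, L i} = ∅ := Set.eq_empty_of_forall_notMem h
        simp [parentIndex, this]
  rw [this]
  exact (Finset.measurableSet_biUnion _ fun m _ => h m).union
    (MeasurableSet.iInter fun m => (h m).compl)

lemma measurable_eventTime (j : ℕ) :
    Measurable fun p : (ℕ → ℕ) × (ℕ → ℝ) => eventTime p.1 p.2 j := by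
  induction j using Nat.strong_induction_on with
  | _ j ih =>
    cases j with
    | zero => simp only [eventTime_zero]; exact measurable_const
    | succ j =>
      simp only [eventTime_succ]
      refine Measurable.add ?_ (by fun_prop)
      -- The parent's position is random but takes finitely many values, so evaluating the event
      -- time there remains measurable.
      have h1 : Measurable fun q : ((ℕ → ℕ) × (ℕ → ℝ)) × Fin (j + 1) =>
          eventTime q.1.1 q.1.2 q.2 :=
        measurable_from_prod_countable_left fun k => ih k k.2
      have h2 : Measurable fun p : (ℕ → ℕ) × (ℕ → ℝ) =>
          (p, (⟨min (parentIndex p.1 (j + 1) - 1) j, by omega⟩ : Fin (j + 1))) :=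
        measurable_id.prodMk ((Measurable.of_discrete
          (f := fun m : ℕ => (⟨min (m - 1) j, by omega⟩ : Fin (j + 1)))).comp
          ((measurable_parentIndex (j + 1)).comp measurable_fst))
      exact h1.comp h2

lemma measurable_generate : Measurable fun p : (ℕ → ℕ) × (ℕ → ℝ) => generate p.1 p.2 := by
  intro S hS
  let F : (n : ℕ) → (ℕ → ℕ) × (ℕ → ℝ) → Cluster := fun n p =>
    ⟨n, fun k => (eventTime p.1 p.2 k, parentIndex p.1 k)⟩
  have hF : ∀ n, Measurable (F n) := fun n => (measurable_sigmaMk n).comp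
    (measurable_pi_iff.2 fun k => (measurable_eventTime k).prodMk
      ((measurable_parentIndex k).comp measurable_fst))
  have hst : ∀ n, MeasurableSet {p : (ℕ → ℕ) × (ℕ → ℝ) | StopsAt p.1 n} := fun n =>
    measurable_fst (measurableSet_stopsAt n)
  have : (fun p : (ℕ → ℕ) × (ℕ → ℝ) => generate p.1 p.2) ⁻¹' S =
      (⋃ n, {p | StopsAt p.1 n} ∩ F n ⁻¹' S) ∪
        ((⋂ n, {p | StopsAt p.1 n}ᶜ) ∩ {_p | (⟨0, Fin.elim0⟩ : Cluster) ∈ S}) := by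
    ext p
    simp only [Set.mem_preimage, Set.mem_union, Set.mem_iUnion, Set.mem_inter_iff,
      Set.mem_ofPred_eq, Set.mem_iInter, Set.mem_compl_iff]
    by_cases h : ∃ n, StopsAt p.1 n
    · obtain ⟨n, hn⟩ := h
      rw [generate_of_stopsAt hn]
      constructor
      · intro h; exact Or.inl ⟨n, hn, h⟩
      · rintro (⟨m, hm, h⟩ | ⟨h, _⟩)
        · obtain rfl := hm.unique hn
          exact h
        · exact absurd hn (h n)
    · rw [generate_of_not_stopsAt h]
      push Not at h
      simp [h]
  rw [this]
  exact (MeasurableSet.iUnion fun n => (hst n).inter (hF n hS)).union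
    ((MeasurableSet.iInter fun n => (hst n).compl).inter (MeasurableSet.const _))

/-! ### Change of measure -/

lemma pi_withDensity {ι X : Type*} [Fintype ι] [MeasurableSpace X] {ν : Measure X}
    [IsProbabilityMeasure ν] {r : X → ℝ≥0∞} (hr : Measurable r)
    [IsProbabilityMeasure (ν.withDensity r)] :
    (Measure.pi fun _ : ι => ν.withDensity r) =
      (Measure.pi fun _ : ι => ν).withDensity fun x => ∏ i, r (x i) := by
  refine Measure.pi_eq fun S hS => ?_
  rw [withDensity_apply _ (MeasurableSet.univ_pi hS),
    ← lintegral_indicator (MeasurableSet.univ_pi hS)]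
  have h1 : ∀ x : ι → X, (Set.univ.pi S).indicator (fun x => ∏ i, r (x i)) x =
      ∏ i, (S i).indicator r (x i) := by
    intro x
    by_cases hx : ∀ i, x i ∈ S i
    · rw [Set.indicator_of_mem (by simpa using hx)]
      exact Finset.prod_congr rfl fun i _ => (Set.indicator_of_mem (hx i) _).symm
    · rw [Set.indicator_of_notMem (by simpa using hx)]
      push Not at hx
      obtain ⟨i, hi⟩ := hx
      exact (Finset.prod_eq_zero (Finset.mem_univ i) (Set.indicator_of_notMem hi _)).symm
  simp_rw [h1]
  have hm : ∀ i, Measurable ((S i).indicator r) := fun i => hr.indicator (hS i)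
  have hi : iIndepFun (fun i (x : ι → X) => (S i).indicator r (x i)) (Measure.pi fun _ : ι => ν) :=
    iIndepFun_pi (X := fun i x => (S i).indicator r x) fun i => (hm i).aemeasurable
  rw [lintegral_prod_eq_prod_lintegral_of_indepFun _ _ hi fun i =>
    (hm i).comp (measurable_pi_apply i)]
  refine Finset.prod_congr rfl fun i _ => ?_
  rw [withDensity_apply _ (hS i), ← lintegral_indicator (hS i),
    ← (measurePreserving_eval (fun _ : ι => ν) i).map_eq,
    lintegral_map (hm i) (measurable_pi_apply i)]
  rw [(measurePreserving_eval (fun _ : ι => ν) i).map_eq]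

lemma exists_restrict_of_dependsOn {X β : Type*} [MeasurableSpace X] [MeasurableSpace β]
    [Nonempty X] {F : (ℕ → X) → β} (hF : Measurable F) {s : Finset ℕ}
    (hs : ∀ x y : ℕ → X, (∀ i ∈ s, x i = y i) → F x = F y) :
    ∃ F' : (s → X) → β, Measurable F' ∧ ∀ x, F x = F' (s.restrict x) := by
  classical
  let x₀ : ℕ → X := fun _ => Classical.arbitrary X
  refine ⟨fun y => F (Function.updateFinset x₀ s y), hF.comp measurable_updateFinset, fun x => ?_⟩
  refine hs _ _ fun i hi => ?_
  simp [Function.updateFinset, hi]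

/-- Change of measure for a function of finitely many coordinates of an i.i.d. sequence. -/
theorem lintegral_infinitePi_withDensity {X : Type*} [MeasurableSpace X] {ν ν' : Measure X}
    [IsProbabilityMeasure ν] [IsProbabilityMeasure ν'] {r : X → ℝ≥0∞} (hr : Measurable r)
    (hν : ν' = ν.withDensity r) {F : (ℕ → X) → ℝ≥0∞} (hF : Measurable F) {s : Finset ℕ}
    (hs : ∀ x y : ℕ → X, (∀ i ∈ s, x i = y i) → F x = F y) :
    ∫⁻ x, F x ∂(Measure.infinitePi fun _ => ν') =
      ∫⁻ x, F x * ∏ i ∈ s, r (x i) ∂(Measure.infinitePi fun _ => ν) := by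
  subst hν
  have : Nonempty X := nonempty_of_isProbabilityMeasure ν
  obtain ⟨F', hF', h⟩ := exists_restrict_of_dependsOn hF hs
  have hR : Measurable fun y : s → X => ∏ i, r (y i) :=
    Finset.measurable_fun_prod _ fun i _ => hr.comp (measurable_pi_apply i)
  have h2 : ∀ x : ℕ → X, F x * ∏ i ∈ s, r (x i) =
      (fun y : s → X => F' y * ∏ i, r (y i)) (s.restrict x) := by
    intro x
    simp only [h x, Finset.restrict]
    rw [Finset.prod_coe_sort s (fun i => r (x i))]
  have hFR : Measurable fun y : s → X => F' y * ∏ i, r (y i) := hF'.mul hR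
  rw [lintegral_congr h2, lintegral_congr h,
    lintegral_restrict_infinitePi (μ := fun _ : ℕ => ν) (X := fun _ => X) hFR,
    lintegral_restrict_infinitePi (μ := fun _ : ℕ => ν.withDensity r) (X := fun _ => X) hF',
    pi_withDensity hr, lintegral_withDensity_eq_lintegral_mul _ hR hF']
  exact lintegral_congr fun y => mul_comm _ _

lemma poissonMeasure_eq_withDensity {r r' : NNReal} (hr : 0 < r) :
    poissonMeasure r' = (poissonMeasure r).withDensity
      fun l => ENNReal.ofReal (Real.exp (-((r' : ℝ) - r)) * ((r' : ℝ) / r) ^ l) := by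
  refine Measure.ext_of_singleton fun l => ?_
  rw [withDensity_apply _ (measurableSet_singleton l), lintegral_singleton,
    poissonMeasure_singleton, poissonMeasure_singleton, ← ENNReal.ofReal_mul (by positivity)]
  congr 1
  have hr' : (r : ℝ) ≠ 0 := by exact_mod_cast hr.ne'
  rw [div_pow, neg_sub, Real.exp_sub, Real.exp_neg, Real.exp_neg]
  field_simp

lemma IsDensity.isProbabilityMeasure {f : ℝ → ℝ} (hf : IsDensity f) :
    IsProbabilityMeasure (birthLaw f) := by
  refine ⟨?_⟩
  rw [birthLaw, withDensity_apply _ .univ, Measure.restrict_univ, hf.lintegral_eq_one]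

lemma birthLaw_tiltedDensity {f : ℝ → ℝ} (hf : IsDensity f) (η : ℝ) :
    birthLaw (tiltedDensity f η) = (birthLaw f).withDensity
      fun t => ENNReal.ofReal (Real.exp (η * t - psiF f η)) := by
  rw [birthLaw, birthLaw, ← withDensity_mul _ (by have := hf.measurable; fun_prop) (by fun_prop)]
  congr 1
  funext t
  rw [Pi.mul_apply, tiltedDensity, ENNReal.ofReal_mul' (Real.exp_nonneg _)]

/-- Law of the sequence of numbers of children. -/
abbrev offspringLaw (h : ℝ) : Measure (ℕ → ℕ) :=
  Measure.infinitePi fun _ : ℕ => poissonMeasure h.toNNReal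

lemma measurable_comp_generate {β : Type*} [MeasurableSpace β] {φ : Cluster → β}
    (hφ : Measurable φ) : Measurable fun p : (ℕ → ℕ) × (ℕ → ℝ) => φ (generate p.1 p.2) :=
  hφ.comp measurable_generate

lemma measurable_comp_generate_right {β : Type*} [MeasurableSpace β] {φ : Cluster → β}
    (hφ : Measurable φ) (L : ℕ → ℕ) : Measurable fun b : ℕ → ℝ => φ (generate L b) :=
  (measurable_comp_generate hφ).comp measurable_prodMk_left

lemma lintegral_clusterLaw {h : ℝ} {f : ℝ → ℝ} (hf : IsDensity f) {φ : Cluster → ℝ≥0∞}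
    (hφ : Measurable φ) :
    ∫⁻ c, φ c ∂(clusterLaw h f) =
      ∫⁻ L, ∫⁻ b, φ (generate L b) ∂(Measure.infinitePi fun _ : ℕ => birthLaw f)
        ∂(offspringLaw h) := by
  have := hf.isProbabilityMeasure
  rw [clusterLaw, lintegral_map hφ measurable_generate,
    lintegral_prod _ (measurable_comp_generate hφ).aemeasurable]

lemma isProbabilityMeasure_clusterLaw {h : ℝ} {f : ℝ → ℝ} (hf : IsDensity f) :
    IsProbabilityMeasure (clusterLaw h f) := by
  have := hf.isProbabilityMeasure
  exact Measure.isProbabilityMeasure_map measurable_generate.aemeasurable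

lemma measurableSet_size (n : ℕ) : MeasurableSet {c : Cluster | c.1 = n} :=
  measurable_sigma_fst (measurableSet_singleton n)

lemma setLIntegral_clusterLaw_size {h : ℝ} {f : ℝ → ℝ} (hf : IsDensity f) {φ : Cluster → ℝ≥0∞}
    (hφ : Measurable φ) {n : ℕ} (hn : n ≠ 0) :
    ∫⁻ c in {c | c.1 = n}, φ c ∂(clusterLaw h f) =
      ∫⁻ L, {L | StopsAt L n}.indicator (fun L =>
        ∫⁻ b, φ (generate L b) ∂(Measure.infinitePi fun _ : ℕ => birthLaw f)) L
        ∂(offspringLaw h) := by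
  rw [← lintegral_indicator (measurableSet_size n),
    lintegral_clusterLaw hf (hφ.indicator (measurableSet_size n))]
  refine lintegral_congr fun L => ?_
  by_cases hL : StopsAt L n
  · rw [Set.indicator_of_mem (by exact hL)]
    refine lintegral_congr fun b => ?_
    rw [Set.indicator_of_mem]
    exact (generate_fst_eq_iff hn).2 hL
  · rw [Set.indicator_of_notMem (by exact hL)]
    rw [← lintegral_zero (μ := Measure.infinitePi fun _ : ℕ => birthLaw f)]
    refine lintegral_congr fun b => ?_
    rw [Set.indicator_of_notMem]
    exact fun h' => hL ((generate_fst_eq_iff hn).1 h')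

/-- When the procedure stops at `n`, the counts sum to `n - 1`, so their likelihood ratio depends on
`n` alone. -/
lemma StopsAt.prod_density {L : ℕ → ℕ} {n : ℕ} (hL : StopsAt L n) {h h' : ℝ} (hh : 0 < h)
    (hh' : 0 < h') :
    ∏ i ∈ Finset.range n, ENNReal.ofReal (Real.exp (-((h'.toNNReal : ℝ) - h.toNNReal)) *
      ((h'.toNNReal : ℝ) / h.toNNReal) ^ L i) =
      ENNReal.ofReal (Real.exp (-(h' - h)) ^ n * (h' / h) ^ (n - 1)) := by
  rw [Real.coe_toNNReal _ hh.le, Real.coe_toNNReal _ hh'.le,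
    ← ENNReal.ofReal_prod_of_nonneg fun i _ => by positivity, Finset.prod_mul_distrib,
    Finset.prod_pow_eq_pow_sum, Finset.prod_const, Finset.card_range]
  have := hL.1
  congr 3
  omega

lemma StopsAt.congr_iff {L L' : ℕ → ℕ} {n : ℕ} (hL : ∀ i ∈ Finset.range n, L i = L' i) :
    StopsAt L n ↔ StopsAt L' n :=
  ⟨fun h => h.congr fun i hi => hL i (Finset.mem_range.2 hi),
    fun h => h.congr fun i hi => (hL i (Finset.mem_range.2 hi)).symm⟩

/-- Change of parameter on the event that the cluster has `n` events. -/
theorem setLIntegral_clusterLaw_tilted {f : ℝ → ℝ} (hf : IsDensity f) {η : ℝ}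
    (hfη : IsDensity (tiltedDensity f η)) {h h' : ℝ} (hh : 0 < h) (hh' : 0 < h')
    {φ : Cluster → ℝ≥0∞} (hφ : Measurable φ) {n : ℕ} (hn : n ≠ 0) :
    ∫⁻ c in {c | c.1 = n}, φ c ∂(clusterLaw h' (tiltedDensity f η)) =
      ∫⁻ c in {c | c.1 = n}, φ c * (ENNReal.ofReal
        (Real.exp (-(h' - h)) ^ n * (h' / h) ^ (n - 1)) *
          ENNReal.ofReal (Real.exp (η * c.totalBirth - (n - 1 : ℕ) * psiF f η)))
          ∂(clusterLaw h f) := by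
  have := hf.isProbabilityMeasure
  have := hfη.isProbabilityMeasure
  have hmw : Measurable fun c : Cluster =>
      ENNReal.ofReal (Real.exp (η * c.totalBirth - (n - 1 : ℕ) * psiF f η)) := by
    have := Cluster.measurable_totalBirth
    fun_prop
  have hmφ : Measurable fun c : Cluster => φ c *
      ENNReal.ofReal (Real.exp (η * c.totalBirth - (n - 1 : ℕ) * psiF f η)) := hφ.mul hmw
  rw [setLIntegral_clusterLaw_size hfη hφ hn, setLIntegral_clusterLaw_size hf (by fun_prop) hn]
  have h1 : ∀ L, {L | StopsAt L n}.indicator (fun L => ∫⁻ b, φ (generate L b)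
      ∂(Measure.infinitePi fun _ : ℕ => birthLaw (tiltedDensity f η))) L =
      {L | StopsAt L n}.indicator (fun L => ∫⁻ b, φ (generate L b) *
        ENNReal.ofReal (Real.exp (η * (generate L b).totalBirth - (n - 1 : ℕ) * psiF f η))
          ∂(Measure.infinitePi fun _ : ℕ => birthLaw f)) L := by
    intro L
    by_cases hL : StopsAt L n
    · rw [Set.indicator_of_mem (by exact hL), Set.indicator_of_mem (by exact hL)]
      -- For fixed offspring counts only the birth law changes. The range starts at `1` because the
      -- immigrant has no birth time.
      rw [lintegral_infinitePi_withDensity (s := Finset.Ico 1 n)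
        (r := fun t => ENNReal.ofReal (Real.exp (η * t - psiF f η))) (by fun_prop)
        (birthLaw_tiltedDensity hf η)
        (measurable_comp_generate_right hφ L)
        (fun x y hxy => by rw [generate_congr hL (fun _ _ => rfl) hxy])]
      refine lintegral_congr fun b => ?_
      rw [← ENNReal.ofReal_prod_of_nonneg fun i _ => Real.exp_nonneg _, ← Real.exp_sum,
        Finset.sum_sub_distrib, ← Finset.mul_sum, hL.totalBirth_generate]
      simp
    · rw [Set.indicator_of_notMem (by exact hL), Set.indicator_of_notMem (by exact hL)]
  simp_rw [h1]
  have hmg : Measurable fun L => ∫⁻ b, φ (generate L b) *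
        ENNReal.ofReal (Real.exp (η * (generate L b).totalBirth - (n - 1 : ℕ) * psiF f η))
          ∂(Measure.infinitePi fun _ : ℕ => birthLaw f) :=
    (hmφ.comp measurable_generate).lintegral_prod_right'
  -- Now the offspring law changes, in the first `n` counts.
  rw [lintegral_infinitePi_withDensity (s := Finset.range n) .of_discrete
    (poissonMeasure_eq_withDensity (r := h.toNNReal) (by simpa using hh))
    (hmg.indicator (measurableSet_stopsAt n))]
  · refine lintegral_congr fun L => ?_
    by_cases hL : StopsAt L n
    · rw [Set.indicator_of_mem (by exact hL), Set.indicator_of_mem (by exact hL),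
        hL.prod_density hh hh', mul_comm, ← lintegral_const_mul _
          (measurable_comp_generate_right hmφ L)]
      refine lintegral_congr fun b => ?_
      ring
    · rw [Set.indicator_of_notMem (by exact hL), Set.indicator_of_notMem (by exact hL), zero_mul]
  · intro x y hxy
    by_cases hx : StopsAt x n
    · rw [Set.indicator_of_mem (by exact hx),
        Set.indicator_of_mem (by exact (StopsAt.congr_iff hxy).1 hx)]
      refine lintegral_congr fun b => ?_
      rw [generate_congr hx (fun i hi => hxy i (Finset.mem_range.2 hi)) fun _ _ => rfl]
    · rw [Set.indicator_of_notMem (by exact hx),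
        Set.indicator_of_notMem (by exact fun h => hx ((StopsAt.congr_iff hxy).2 h))]

/-! ### The number of events of a cluster -/

/-- The probability that the procedure with mean number of children `h` stops with `n` events. -/
def sizeProb (h : ℝ) (n : ℕ) : ℝ≥0∞ := offspringLaw h {L | StopsAt L n}

lemma sizeProb_eq_mul {h h' : ℝ} (hh : 0 < h) (hh' : 0 < h') (n : ℕ) :
    sizeProb h' n =
      ENNReal.ofReal (Real.exp (-(h' - h)) ^ n * (h' / h) ^ (n - 1)) * sizeProb h n := by
  rw [sizeProb, sizeProb, ← lintegral_indicator_one (measurableSet_stopsAt n),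
    ← lintegral_indicator_const (measurableSet_stopsAt n)]
  rw [lintegral_infinitePi_withDensity (s := Finset.range n) .of_discrete
    (poissonMeasure_eq_withDensity (r := h.toNNReal) (by simpa using hh))
    (measurable_one.indicator (measurableSet_stopsAt n))]
  · refine lintegral_congr fun L => ?_
    by_cases hL : StopsAt L n
    · rw [Set.indicator_of_mem (by exact hL), Set.indicator_of_mem (by exact hL),
        hL.prod_density hh hh', Pi.one_apply, one_mul]
    · rw [Set.indicator_of_notMem (by exact hL), Set.indicator_of_notMem (by exact hL), zero_mul]
  · intro x y hxy
    by_cases hx : StopsAt x n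
    · rw [Set.indicator_of_mem (by exact hx),
        Set.indicator_of_mem (by exact (StopsAt.congr_iff hxy).1 hx)]
      rfl
    · rw [Set.indicator_of_notMem (by exact hx),
        Set.indicator_of_notMem (by exact fun h => hx ((StopsAt.congr_iff hxy).2 h))]

lemma sizeProb_zero (h : ℝ) : sizeProb h 0 = 0 := by
  have : {L : ℕ → ℕ | StopsAt L 0} = ∅ := Set.eq_empty_of_forall_notMem fun L hL => hL.pos.ne' rfl
  rw [sizeProb, this, measure_empty]

/-- The procedure has not stopped after processing `n` events. -/
def notStopped (n : ℕ) : Set (ℕ → ℕ) := {L | ∀ m < n + 1, 1 + ∑ i ∈ Finset.range m, L i ≠ m}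

lemma measurableSet_notStopped (n : ℕ) : MeasurableSet (notStopped n) := by
  have hs : ∀ m, Measurable fun L : ℕ → ℕ => 1 + ∑ i ∈ Finset.range m, L i := fun m => by fun_prop
  have : notStopped n =
      ⋂ m ∈ Finset.range (n + 1), {L : ℕ → ℕ | 1 + ∑ i ∈ Finset.range m, L i = m}ᶜ := by
    ext L
    simp [notStopped]
  rw [this]
  exact Finset.measurableSet_biInter _ fun m _ =>
    (measurableSet_eq_fun (hs m) measurable_const).compl

lemma StopsAt.mem_notStopped_iff {L : ℕ → ℕ} {N : ℕ} (h : StopsAt L N) (i : ℕ) :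
    L ∈ notStopped i ↔ i < N := by
  constructor
  · intro hi
    by_contra hN
    exact hi N (by omega) h.1
  · intro hi m hm
    exact h.2 m (by omega)

lemma lintegral_prod_offspringLaw (h : ℝ) (s : Finset ℕ) (w : ℕ → ℝ≥0∞) :
    ∫⁻ L, ∏ i ∈ s, w (L i) ∂(offspringLaw h) =
      (∫⁻ l, w l ∂(poissonMeasure h.toNNReal)) ^ s.card := by
  have hi := iIndepFun_infinitePi (P := fun _ : ℕ => poissonMeasure h.toNNReal)
    (X := fun _ l => w l) fun i => .of_discrete
  have hw : Measurable w := .of_discrete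
  rw [lintegral_prod_eq_prod_lintegral_of_indepFun s _ hi fun i => hw.comp (measurable_pi_apply i)]
  refine Finset.prod_eq_pow_card fun i _ => ?_
  rw [← lintegral_map hw (measurable_pi_apply i), Measure.infinitePi_map_eval]

/-- Chernoff bound: not having stopped forces the first `n` counts to sum to at least `n`. The base
`1 / h` is the optimal one, and `exp (h (1 / h - 1)) = exp (1 - h)`. -/
lemma measure_notStopped_le {h : ℝ} (hh : 0 < h) (hh' : h < 1) (n : ℕ) :
    offspringLaw h (notStopped n) ≤ ENNReal.ofReal (h * Real.exp (1 - h)) ^ n := by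
  have h1 : ∀ L, (notStopped n).indicator 1 L ≤
      ENNReal.ofReal h ^ n * ∏ i ∈ Finset.range n, ENNReal.ofReal (1 / h) ^ L i := by
    intro L
    by_cases hL : L ∈ notStopped n
    · rw [Set.indicator_of_mem hL, Pi.one_apply, Finset.prod_pow_eq_pow_sum]
      have hle := le_sum_of_forall_ne hL n (by omega)
      calc (1 : ℝ≥0∞) = ENNReal.ofReal h ^ n * ENNReal.ofReal (1 / h) ^ n := by
            rw [← mul_pow, ← ENNReal.ofReal_mul hh.le, mul_one_div_cancel hh.ne']
            simp
        _ ≤ _ := by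
            gcongr
            rw [← ENNReal.ofReal_one]
            exact ENNReal.ofReal_le_ofReal ((one_le_div hh).2 hh'.le)
    · rw [Set.indicator_of_notMem hL]
      exact zero_le
  calc offspringLaw h (notStopped n) = ∫⁻ L, (notStopped n).indicator 1 L ∂(offspringLaw h) :=
        (lintegral_indicator_one (measurableSet_notStopped n)).symm
    _ ≤ ∫⁻ L, ENNReal.ofReal h ^ n * ∏ i ∈ Finset.range n, ENNReal.ofReal (1 / h) ^ L i
          ∂(offspringLaw h) := lintegral_mono h1
    _ = ENNReal.ofReal (h * Real.exp (1 - h)) ^ n := by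
        rw [lintegral_const_mul _ (by fun_prop),
          lintegral_prod_offspringLaw h _ fun l => ENNReal.ofReal (1 / h) ^ l,
          lintegral_poissonMeasure_ofReal_pow _ (by positivity), Finset.card_range, ← mul_pow,
          ← ENNReal.ofReal_mul hh.le, Real.coe_toNNReal _ hh.le]
        congr 4
        field_simp

lemma mul_exp_lt_one {h : ℝ} (hh' : h ≠ 1) : h * Real.exp (1 - h) < 1 := by
  have h1 : h < Real.exp (h - 1) := by
    have := Real.add_one_lt_exp (sub_ne_zero.2 hh')
    linarith
  calc h * Real.exp (1 - h) < Real.exp (h - 1) * Real.exp (1 - h) := by gcongr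
    _ = 1 := by rw [← Real.exp_add]; simp

lemma ae_exists_stopsAt {h : ℝ} (hh : 0 < h) (hh' : h < 1) :
    ∀ᵐ L ∂(offspringLaw h), ∃ n, StopsAt L n := by
  rw [ae_iff]
  refine le_antisymm ?_ zero_le
  have hlim : Tendsto (fun n : ℕ => ENNReal.ofReal (h * Real.exp (1 - h)) ^ n) atTop (𝓝 0) := by
    refine ENNReal.tendsto_pow_atTop_nhds_zero_of_lt_one ?_
    rw [← ENNReal.ofReal_one]
    exact (ENNReal.ofReal_lt_ofReal_iff one_pos).2 (mul_exp_lt_one hh'.ne)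
  refine ge_of_tendsto' hlim fun n => ?_
  refine (measure_mono fun L hL => ?_).trans (measure_notStopped_le hh hh' n)
  intro m _ hm
  exact hL (exists_stopsAt ⟨m, hm⟩)

lemma tsum_sizeProb {h : ℝ} (hh : 0 < h) (hh' : h < 1) : ∑' n, sizeProb h n = 1 := by
  simp only [sizeProb]
  rw [← measure_iUnion (fun m n hmn => Set.disjoint_left.2 fun L hm hn => hmn (hm.unique hn))
    measurableSet_stopsAt]
  refine (prob_compl_eq_zero_iff (MeasurableSet.iUnion measurableSet_stopsAt)).1 ?_
  have := ae_exists_stopsAt hh hh'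
  rw [ae_iff] at this
  convert! this using 2
  ext L
  simp

lemma lintegral_id_poissonMeasure (r : NNReal) : ∫⁻ n : ℕ, (n : ℝ≥0∞) ∂(poissonMeasure r) = r := by
  rw [lintegral_countable']
  simp_rw [poissonMeasure_singleton]
  rw [tsum_eq_zero_add' ENNReal.summable]
  have h1 : ∀ n : ℕ, ((n + 1 : ℕ) : ℝ≥0∞) *
      ENNReal.ofReal (Real.exp (-r) * r ^ (n + 1) / ((n + 1).factorial)) =
      r * poissonMeasure r {n} := by
    intro n
    rw [poissonMeasure_singleton, ← ENNReal.ofReal_natCast, ← ENNReal.ofReal_coe_nnreal,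
      ← ENNReal.ofReal_mul (by positivity), ← ENNReal.ofReal_mul (by positivity)]
    congr 1
    rw [Nat.factorial_succ]
    push_cast
    field_simp
    ring
  have h2 : ∑' n, poissonMeasure r {n} = 1 := by
    have := lintegral_countable' (μ := poissonMeasure r) fun _ => 1
    simpa using this.symm
  simp_rw [h1]
  rw [ENNReal.tsum_mul_left, h2]
  simp

/-- Whether the procedure is still running after `i` processed events depends on the counts at
positions below `i`, and these are independent of `L i`. -/
lemma lintegral_mul_notStopped (h : ℝ) (i : ℕ) :
    ∫⁻ L, (L i : ℝ≥0∞) * (notStopped i).indicator 1 L ∂(offspringLaw h) =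
      ENNReal.ofReal h * offspringLaw h (notStopped i) := by
  have hm : Measurable ((notStopped i).indicator (1 : (ℕ → ℕ) → ℝ≥0∞)) :=
    measurable_one.indicator (measurableSet_notStopped i)
  have hdep : ∀ x y : ℕ → ℕ, (∀ j ∈ Finset.range i, x j = y j) →
      (notStopped i).indicator (1 : (ℕ → ℕ) → ℝ≥0∞) x = (notStopped i).indicator 1 y := by
    intro x y hxy
    have hs : ∀ m < i + 1, ∑ j ∈ Finset.range m, x j = ∑ j ∈ Finset.range m, y j := fun m hm =>
      Finset.sum_congr rfl fun j hj => hxy j (by simp at hj ⊢; omega)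
    have : x ∈ notStopped i ↔ y ∈ notStopped i := by
      refine forall₂_congr fun m hm => ?_
      rw [hs m hm]
    by_cases hx : x ∈ notStopped i
    · rw [Set.indicator_of_mem hx, Set.indicator_of_mem (this.1 hx)]
      rfl
    · rw [Set.indicator_of_notMem hx, Set.indicator_of_notMem fun h => hx (this.2 h)]
  obtain ⟨F, hF, hFeq⟩ := exists_restrict_of_dependsOn hm hdep
  have hi := iIndepFun_infinitePi (P := fun _ : ℕ => poissonMeasure h.toNNReal)
    (X := fun _ l => l) fun i => measurable_id
  have hind := hi.indepFun_finset {i} (Finset.range i) (by simp) fun i => measurable_pi_apply i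
  have hφ : Measurable fun y : ({i} : Finset ℕ) → ℕ =>
      ((y ⟨i, Finset.mem_singleton_self i⟩ : ℕ) : ℝ≥0∞) := by fun_prop
  have hr : Measurable fun (L : ℕ → ℕ) (j : Finset.range i) => L j := by fun_prop
  have hr' : Measurable fun (L : ℕ → ℕ) (j : ({i} : Finset ℕ)) => L j := by fun_prop
  have h1 := lintegral_mul_eq_lintegral_mul_lintegral_of_indepFun (hφ.comp hr') (hF.comp hr)
    (hind.comp hφ hF)
  have h2 : ∫⁻ L, (L i : ℝ≥0∞) ∂(offspringLaw h) = ENNReal.ofReal h := by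
    have hmap := lintegral_map (μ := offspringLaw h) (f := fun n : ℕ => (n : ℝ≥0∞)) .of_discrete
      (measurable_pi_apply i)
    rw [← hmap, Measure.infinitePi_map_eval, lintegral_id_poissonMeasure]
    rfl
  rw [← h2, ← lintegral_indicator_one (measurableSet_notStopped i)]
  simp_rw [hFeq]
  exact h1

/-- The sum is the mean `x` of the size `N`. Taking expectations in `N = 1 + ∑_{i < N} L i` gives
Wald's identity `x = 1 + h x`. It can be solved for `x` because the geometric bound makes `x`
finite. -/
lemma tsum_measure_notStopped {h : ℝ} (hh : 0 < h) (hh' : h < 1) :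
    ∑' i, offspringLaw h (notStopped i) = ENNReal.ofReal (1 / (1 - h)) := by
  have hfin : ∑' i, offspringLaw h (notStopped i) ≠ ∞ := by
    refine ne_top_of_le_ne_top ?_ (ENNReal.tsum_le_tsum (measure_notStopped_le hh hh'))
    rw [ENNReal.tsum_geometric]
    refine ENNReal.inv_ne_top.2 (tsub_pos_of_lt ?_).ne'
    rw [← ENNReal.ofReal_one]
    exact (ENNReal.ofReal_lt_ofReal_iff one_pos).2 (mul_exp_lt_one hh'.ne)
  have hm : ∀ i, Measurable ((notStopped i).indicator (1 : (ℕ → ℕ) → ℝ≥0∞)) := fun i =>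
    measurable_one.indicator (measurableSet_notStopped i)
  have hm' : ∀ i, Measurable fun L : ℕ → ℕ => (L i : ℝ≥0∞) * (notStopped i).indicator 1 L :=
    fun i => (by fun_prop : Measurable fun L : ℕ → ℕ => (L i : ℝ≥0∞)).mul (hm i)
  have key : ∀ᵐ L ∂(offspringLaw h), ∑' i, (notStopped i).indicator (1 : (ℕ → ℕ) → ℝ≥0∞) L =
      1 + ∑' i, (L i : ℝ≥0∞) * (notStopped i).indicator 1 L := by
    filter_upwards [ae_exists_stopsAt hh hh'] with L hL
    obtain ⟨N, hN⟩ := hL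
    rw [tsum_eq_sum (s := Finset.range N), tsum_eq_sum (s := Finset.range N)]
    · have h1 : ∀ i ∈ Finset.range N, (notStopped i).indicator (1 : (ℕ → ℕ) → ℝ≥0∞) L = 1 :=
        fun i hi => Set.indicator_of_mem ((hN.mem_notStopped_iff i).2 (Finset.mem_range.1 hi)) _
      have h2 : ∀ i ∈ Finset.range N,
          (L i : ℝ≥0∞) * (notStopped i).indicator (1 : (ℕ → ℕ) → ℝ≥0∞) L = L i := fun i hi => by
        rw [h1 i hi, mul_one]
      rw [Finset.sum_congr rfl h1, Finset.sum_congr rfl h2, Finset.sum_const,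
        Finset.card_range, nsmul_one]
      exact_mod_cast hN.1.symm
    · intro i hi
      rw [Set.indicator_of_notMem, mul_zero]
      rw [hN.mem_notStopped_iff]; simpa using hi
    · intro i hi
      rw [Set.indicator_of_notMem]
      rw [hN.mem_notStopped_iff]; simpa using hi
  have h2 := lintegral_congr_ae key
  rw [lintegral_tsum fun i => (hm i).aemeasurable, lintegral_add_left measurable_const,
    lintegral_tsum fun i => (hm' i).aemeasurable] at h2
  simp_rw [lintegral_mul_notStopped, lintegral_indicator_one (measurableSet_notStopped _)] at h2
  rw [ENNReal.tsum_mul_left, lintegral_const, measure_univ, mul_one] at h2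
  set x := ∑' i, offspringLaw h (notStopped i)
  have h3 : x.toReal = 1 + h * x.toReal := by
    have := congrArg ENNReal.toReal h2
    rwa [ENNReal.toReal_add ENNReal.one_ne_top (ENNReal.mul_ne_top ENNReal.ofReal_ne_top hfin),
      ENNReal.toReal_mul, ENNReal.toReal_ofReal hh.le, ENNReal.toReal_one] at this
  rw [← ENNReal.ofReal_toReal hfin]
  congr 1
  rw [eq_div_iff (by linarith)]
  linarith

/-- Mean number of events of a subcritical cluster. -/
theorem lintegral_card_clusterLaw {h : ℝ} {f : ℝ → ℝ} (hf : IsDensity f) (hh : 0 < h)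
    (hh' : h < 1) :
    ∫⁻ c, (c.card : ℝ≥0∞) ∂(clusterLaw h f) = ENNReal.ofReal (1 / (1 - h)) := by
  have := hf.isProbabilityMeasure
  have hm : ∀ i, Measurable ((notStopped i).indicator (1 : (ℕ → ℕ) → ℝ≥0∞)) := fun i =>
    measurable_one.indicator (measurableSet_notStopped i)
  have hc : Measurable fun c : Cluster => (c.card : ℝ≥0∞) :=
    (Measurable.of_discrete (f := fun n : ℕ∞ => (n : ℝ≥0∞))).comp Cluster.measurable_card
  rw [lintegral_clusterLaw hf hc, ← tsum_measure_notStopped hh hh']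
  simp_rw [← lintegral_indicator_one (measurableSet_notStopped _)]
  rw [← lintegral_tsum fun i => (hm i).aemeasurable]
  refine lintegral_congr_ae ?_
  filter_upwards [ae_exists_stopsAt hh hh'] with L hL
  obtain ⟨N, hN⟩ := hL
  have h1 : ∀ b, ((generate L b).card : ℝ≥0∞) = N := by
    intro b
    rw [Cluster.card, (generate_fst_eq_iff hN.pos.ne').2 hN, if_neg hN.pos.ne']
    simp
  simp_rw [h1]
  rw [lintegral_const, measure_univ, mul_one, tsum_eq_sum (s := Finset.range N)]
  · rw [Finset.sum_congr rfl fun i hi =>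
      Set.indicator_of_mem ((hN.mem_notStopped_iff i).2 (Finset.mem_range.1 hi)) _]
    simp
  · intro i hi
    rw [Set.indicator_of_notMem]
    rw [hN.mem_notStopped_iff]; simpa using hi

lemma tsum_mul_sizeProb {h : ℝ} (hh : 0 < h) (hh' : h < 1) :
    ∑' n : ℕ, (n : ℝ≥0∞) * sizeProb h n = ENNReal.ofReal (1 / (1 - h)) := by
  rw [← tsum_measure_notStopped hh hh']
  simp_rw [← lintegral_indicator_one (measurableSet_notStopped _)]
  rw [← lintegral_tsum fun i =>
    (measurable_one.indicator (measurableSet_notStopped i)).aemeasurable]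
  simp_rw [sizeProb, ← lintegral_indicator_const (measurableSet_stopsAt _)]
  rw [← lintegral_tsum fun i =>
    (measurable_const.indicator (measurableSet_stopsAt i)).aemeasurable]
  refine lintegral_congr_ae ?_
  filter_upwards [ae_exists_stopsAt hh hh'] with L hL
  obtain ⟨N, hN⟩ := hL
  rw [tsum_eq_single N, tsum_eq_sum (s := Finset.range N), Set.indicator_of_mem (by exact hN)]
  · rw [Finset.sum_congr rfl fun i hi =>
      Set.indicator_of_mem ((hN.mem_notStopped_iff i).2 (Finset.mem_range.1 hi)) _]
    simp
  · intro i hi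
    rw [Set.indicator_of_notMem]
    rw [hN.mem_notStopped_iff]; simpa using hi
  · intro n hn
    rw [Set.indicator_of_notMem]
    exact fun h => hn (h.unique hN)

/-! ### The total birth time and the tilted parameters -/

/-- Moment generating function of the birth time, with values in `[0, ∞]`. -/
def birthMGF (f : ℝ → ℝ) (θ : ℝ) : ℝ≥0∞ := ∫⁻ t, ENNReal.ofReal (Real.exp (θ * t)) ∂(birthLaw f)

lemma birthMGF_eq {f : ℝ → ℝ} (hf : IsDensity f) (θ : ℝ) :
    birthMGF f θ = ∫⁻ t in Set.Ioi 0, ENNReal.ofReal (Real.exp (θ * t) * f t) := by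
  have hm := hf.measurable
  rw [birthMGF, birthLaw, lintegral_withDensity_eq_lintegral_mul _ (by fun_prop) (by fun_prop)]
  refine lintegral_congr fun t => ?_
  rw [Pi.mul_apply, ENNReal.ofReal_mul (Real.exp_nonneg _), mul_comm]

lemma ae_birthLaw_pos (f : ℝ → ℝ) : ∀ᵐ t ∂(birthLaw f), 0 < t :=
  (withDensity_absolutelyContinuous _ _).ae_le (ae_restrict_mem measurableSet_Ioi)

lemma psiF_eq {f : ℝ → ℝ} (hf : IsDensity f) (θ : ℝ) :
    psiF f θ = Real.log (birthMGF f θ).toReal := by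
  have hm := hf.measurable
  rw [psiF, birthMGF_eq hf, integral_eq_lintegral_of_nonneg_ae]
  · filter_upwards [ae_restrict_mem measurableSet_Ioi] with t ht
    exact mul_nonneg (Real.exp_nonneg _) (hf.nonneg t (le_of_lt ht))
  · exact Measurable.aestronglyMeasurable (by fun_prop)

lemma birthMGF_ne_top_of_integrableOn {f : ℝ → ℝ} (hf : IsDensity f) {θ : ℝ}
    (h : IntegrableOn (fun t => Real.exp (θ * t) * f t) (Set.Ioi 0)) : birthMGF f θ ≠ ∞ := by
  rw [birthMGF_eq hf]
  refine ((hasFiniteIntegral_iff_ofReal ?_).1 h.2).ne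
  filter_upwards [ae_restrict_mem measurableSet_Ioi] with t ht
  exact mul_nonneg (Real.exp_nonneg _) (hf.nonneg t (le_of_lt ht))

lemma one_le_birthMGF {f : ℝ → ℝ} (hf : IsDensity f) {θ : ℝ} (hθ : 0 ≤ θ) :
    1 ≤ birthMGF f θ := by
  have := hf.isProbabilityMeasure
  calc (1 : ℝ≥0∞) = ∫⁻ _, 1 ∂(birthLaw f) := by simp
    _ ≤ birthMGF f θ := by
      refine lintegral_mono_ae ?_
      filter_upwards [ae_birthLaw_pos f] with t ht
      rw [← ENNReal.ofReal_one]
      exact ENNReal.ofReal_le_ofReal (Real.one_le_exp (by positivity))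

lemma birthMGF_lt_birthMGF {f : ℝ → ℝ} (hf : IsDensity f) {θ θ' : ℝ} (hθ : θ < θ')
    (h' : birthMGF f θ' ≠ ∞) : birthMGF f θ < birthMGF f θ' := by
  have := hf.isProbabilityMeasure
  have hlt : ∀ᵐ t ∂(birthLaw f),
      ENNReal.ofReal (Real.exp (θ * t)) < ENNReal.ofReal (Real.exp (θ' * t)) := by
    filter_upwards [ae_birthLaw_pos f] with t ht
    exact (ENNReal.ofReal_lt_ofReal_iff (Real.exp_pos _)).2 (Real.exp_lt_exp.2 (by nlinarith))
  refine lintegral_strict_mono (IsProbabilityMeasure.ne_zero _) (by fun_prop) ?_ hlt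
  exact ne_top_of_le_ne_top h' (lintegral_mono_ae (hlt.mono fun _ h => h.le))

/-- Convexity of `exp` between `0` and `θ₀ * t`. The bound tends to `1` as `θ → 0`, which yields
small admissible parameters. -/
lemma birthMGF_le_one_add {f : ℝ → ℝ} (hf : IsDensity f) {θ θ₀ : ℝ} (hθ : 0 ≤ θ) (hθ₀ : θ < θ₀) :
    birthMGF f θ ≤ 1 + ENNReal.ofReal (θ / θ₀) * birthMGF f θ₀ := by
  have := hf.isProbabilityMeasure
  have hpos : 0 < θ₀ := hθ.trans_lt hθ₀
  have hle : θ / θ₀ ≤ 1 := (div_le_one hpos).2 hθ₀.le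
  have h0 : 0 ≤ θ / θ₀ := by positivity
  calc birthMGF f θ ≤ ∫⁻ t, 1 + ENNReal.ofReal (θ / θ₀) * ENNReal.ofReal (Real.exp (θ₀ * t))
        ∂(birthLaw f) := by
        refine lintegral_mono fun t => ?_
        rw [← ENNReal.ofReal_one, ← ENNReal.ofReal_mul h0,
          ← ENNReal.ofReal_add zero_le_one (by positivity)]
        refine ENNReal.ofReal_le_ofReal ?_
        have := convexOn_exp.2 (Set.mem_univ 0) (Set.mem_univ (θ₀ * t))
          (sub_nonneg.2 hle) h0 (by ring)
        simp only [smul_eq_mul, mul_zero, zero_add, Real.exp_zero, mul_one] at this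
        have e : θ / θ₀ * (θ₀ * t) = θ * t := by field_simp
        rw [e] at this
        linarith
    _ = 1 + ENNReal.ofReal (θ / θ₀) * birthMGF f θ₀ := by
        rw [lintegral_add_left measurable_const, lintegral_const_mul _ (by fun_prop)]
        simp [birthMGF]

lemma lintegral_exp_sum_birth {f : ℝ → ℝ} (hf : IsDensity f) (θ : ℝ) (s : Finset ℕ) :
    ∫⁻ b, ENNReal.ofReal (Real.exp (θ * ∑ k ∈ s, b k))
      ∂(Measure.infinitePi fun _ : ℕ => birthLaw f) = birthMGF f θ ^ s.card := by
  have := hf.isProbabilityMeasure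
  have hw : Measurable fun t : ℝ => ENNReal.ofReal (Real.exp (θ * t)) := by fun_prop
  have hi := iIndepFun_infinitePi (P := fun _ : ℕ => birthLaw f)
    (X := fun _ t => ENNReal.ofReal (Real.exp (θ * t))) fun i => hw
  simp_rw [Finset.mul_sum, Real.exp_sum, ENNReal.ofReal_prod_of_nonneg fun i _ => Real.exp_nonneg _]
  rw [lintegral_prod_eq_prod_lintegral_of_indepFun s _ hi fun i => hw.comp (measurable_pi_apply i)]
  refine Finset.prod_eq_pow_card fun i _ => ?_
  rw [← lintegral_map hw (measurable_pi_apply i), Measure.infinitePi_map_eval, birthMGF]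

/-- Given offspring counts that stop at `n`, the total birth time is a sum of `n - 1` independent
birth times. -/
lemma lintegral_exp_totalBirth {h : ℝ} {f : ℝ → ℝ} (hf : IsDensity f) (hh : 0 < h) (hh' : h < 1)
    (θ : ℝ) :
    ∫⁻ c, ENNReal.ofReal (Real.exp (θ * c.totalBirth)) ∂(clusterLaw h f) =
      ∑' n, sizeProb h n * birthMGF f θ ^ (n - 1) := by
  have hm : Measurable fun c : Cluster => ENNReal.ofReal (Real.exp (θ * c.totalBirth)) := by
    have := Cluster.measurable_totalBirth
    fun_prop
  rw [lintegral_clusterLaw hf hm]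
  simp_rw [sizeProb, mul_comm _ (birthMGF f θ ^ _),
    ← lintegral_indicator_const (measurableSet_stopsAt _)]
  rw [← lintegral_tsum fun i =>
    (measurable_const.indicator (measurableSet_stopsAt i)).aemeasurable]
  refine lintegral_congr_ae ?_
  filter_upwards [ae_exists_stopsAt hh hh'] with L hL
  obtain ⟨N, hN⟩ := hL
  simp_rw [hN.totalBirth_generate]
  rw [lintegral_exp_sum_birth hf, tsum_eq_single N, Set.indicator_of_mem (by exact hN)]
  · simp
  · intro n hn
    rw [Set.indicator_of_notMem]
    exact fun h => hn (h.unique hN)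

/-- The generating function of the numbers of events of a critical cluster, in the variable
`Real.exp 1 * z`. -/
def treeSeries (z : ℝ) : ℝ≥0∞ := ∑' n, sizeProb 1 n * ENNReal.ofReal (Real.exp 1 * z) ^ n

/-- Comparison with the critical offspring mean. The prefactor `h * m` supplies the power missing
from `h ^ (n - 1) * m ^ (n - 1)`, so that `h` and `m` enter only through `h m exp (-h)`. -/
lemma sizeProb_mul_pow {h m : ℝ} (hh : 0 < h) (hm : 0 ≤ m) (n : ℕ) :
    ENNReal.ofReal (h * m) * (sizeProb h n * ENNReal.ofReal m ^ (n - 1)) =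
      sizeProb 1 n * ENNReal.ofReal (Real.exp 1 * (h * m * Real.exp (-h))) ^ n := by
  rcases Nat.eq_zero_or_pos n with rfl | hn
  · simp [sizeProb_zero]
  · obtain ⟨k, rfl⟩ : ∃ k, n = k + 1 := ⟨n - 1, by omega⟩
    rw [sizeProb_eq_mul one_pos hh]
    have e : ENNReal.ofReal (h * m) * (ENNReal.ofReal (Real.exp (-(h - 1)) ^ (k + 1) *
        (h / 1) ^ (k + 1 - 1)) * ENNReal.ofReal m ^ (k + 1 - 1)) =
        ENNReal.ofReal (Real.exp 1 * (h * m * Real.exp (-h))) ^ (k + 1) := by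
      rw [← ENNReal.ofReal_pow hm, ← ENNReal.ofReal_pow (by positivity),
        ← ENNReal.ofReal_mul (by positivity), ← ENNReal.ofReal_mul (by positivity)]
      congr 1
      have : Real.exp (-(h - 1)) = Real.exp 1 * Real.exp (-h) := by
        rw [← Real.exp_add]; congr 1; ring
      rw [this]
      simp only [div_one, Nat.add_sub_cancel]
      ring
    rw [← e]
    ring

lemma mul_tsum_sizeProb {h m : ℝ} (hh : 0 < h) (hm : 0 ≤ m) :
    ENNReal.ofReal (h * m) * ∑' n, sizeProb h n * ENNReal.ofReal m ^ (n - 1) =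
      treeSeries (h * m * Real.exp (-h)) := by
  rw [← ENNReal.tsum_mul_left, treeSeries]
  exact tsum_congr fun n => sizeProb_mul_pow hh hm n

/-- The case `m = 1`, where the size probabilities of a subcritical cluster sum to one. -/
lemma treeSeries_eq {h : ℝ} (hh : 0 < h) (hh' : h < 1) :
    treeSeries (h * Real.exp (-h)) = ENNReal.ofReal h := by
  have := mul_tsum_sizeProb hh zero_le_one
  simp only [mul_one, ENNReal.ofReal_one, one_pow] at this
  rw [← this, tsum_sizeProb hh hh', mul_one]

/-- If the series converged with `w = e z > 1`, then `n ≤ w ^ n / (w - 1)` (Bernoulli) would make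
the critical mean size finite. But that mean dominates `h / (1 - h)` for every `h < 1`, which is
unbounded. -/
lemma exp_one_mul_le_of_treeSeries_ne_top {z : ℝ} (hz : treeSeries z ≠ ∞) :
    Real.exp 1 * z ≤ 1 := by
  by_contra hw
  push Not at hw
  set w := Real.exp 1 * z with hwdef
  have hw1 : 0 < w - 1 := by linarith
  have hq : ∑' n : ℕ, (n : ℝ≥0∞) * sizeProb 1 n ≤
      ENNReal.ofReal (1 / (w - 1)) * treeSeries z := by
    rw [treeSeries, ← ENNReal.tsum_mul_left]
    refine ENNReal.tsum_le_tsum fun n => ?_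
    rw [mul_left_comm, mul_comm]
    gcongr
    rw [← ENNReal.ofReal_natCast, ← ENNReal.ofReal_pow (by linarith),
      ← ENNReal.ofReal_mul (by positivity)]
    refine ENNReal.ofReal_le_ofReal ?_
    have := one_add_mul_le_pow (a := w - 1) (by linarith) n
    rw [add_sub_cancel] at this
    rw [one_div, inv_mul_eq_div, le_div_iff₀ hw1]
    linarith
  have hfin : ENNReal.ofReal (1 / (w - 1)) * treeSeries z ≠ ∞ :=
    ENNReal.mul_ne_top ENNReal.ofReal_ne_top hz
  set C := (ENNReal.ofReal (1 / (w - 1)) * treeSeries z).toReal with hC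
  have hb : ∀ h : ℝ, 0 < h → h < 1 → h * (1 / (1 - h)) ≤ C := by
    intro h hh hh'
    have hpos : (0 : ℝ) ≤ 1 / (1 - h) := by
      have : 0 < 1 - h := by linarith
      positivity
    have h1 : ENNReal.ofReal (h * (1 / (1 - h))) ≤ ∑' n : ℕ, (n : ℝ≥0∞) * sizeProb 1 n := by
      rw [ENNReal.ofReal_mul hh.le, ← tsum_mul_sizeProb hh hh', ← ENNReal.tsum_mul_left]
      refine ENNReal.tsum_le_tsum fun n => ?_
      have := sizeProb_mul_pow hh zero_le_one n
      simp only [mul_one, ENNReal.ofReal_one, one_pow] at this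
      rw [mul_left_comm, this]
      gcongr
      refine mul_le_of_le_one_right' (pow_le_one₀ zero_le ?_)
      rw [← ENNReal.ofReal_one]
      refine ENNReal.ofReal_le_ofReal ?_
      have h2 := mul_exp_lt_one hh'.ne
      rw [show Real.exp 1 * (h * Real.exp (-h)) = h * Real.exp (1 - h) by
        rw [sub_eq_add_neg, Real.exp_add]; ring]
      exact h2.le
    exact (ENNReal.ofReal_le_iff_le_toReal hfin).1 (h1.trans hq)
  have hC0 : 0 ≤ C := ENNReal.toReal_nonneg
  -- This `h` is chosen so that `h / (1 - h) = C + 1`, which exceeds the bound `C`.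
  have h1 := hb ((C + 1) / (C + 2)) (by positivity) (by rw [div_lt_one (by positivity)]; linarith)
  have h2 : (C + 1) / (C + 2) * (1 / (1 - (C + 1) / (C + 2))) = C + 1 := by
    have : C + 2 ≠ 0 := by positivity
    have h3 : 1 - (C + 1) / (C + 2) = 1 / (C + 2) := by field_simp; ring
    rw [h3]
    field_simp
  linarith

lemma exists_mul_exp_neg_eq {z : ℝ} (hz : 0 < z) (hz' : Real.exp 1 * z < 1) :
    ∃ h, 0 < h ∧ h < 1 ∧ h * Real.exp (-h) = z := by
  have hc : ContinuousOn (fun h : ℝ => h * Real.exp (-h)) (Set.Icc 0 1) := by fun_prop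
  have := intermediate_value_Ioo zero_le_one hc
  have hmem : z ∈ Set.Ioo ((0 : ℝ) * Real.exp (-0)) (1 * Real.exp (-1)) := by
    constructor
    · simpa using hz
    · rw [one_mul, Real.exp_neg, ← one_div, lt_div_iff₀ (Real.exp_pos 1)]
      linarith
  obtain ⟨h, hh, e⟩ := this hmem
  exact ⟨h, hh.1, hh.2, e⟩

/-- The term `n = 2` of the series for `E exp (θ B)` contains the birth moment generating function
to the first power. Its positive coefficient lets finiteness pass from the total birth time to a
single birth time. -/
lemma sizeProb_two_ne_zero {h : ℝ} (hh : 0 < h) : sizeProb h 2 ≠ 0 := by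
  have hsub : Set.pi ((Finset.range 2 : Finset ℕ) : Set ℕ) (fun i => {(1 - i : ℕ)}) ⊆
      {L : ℕ → ℕ | StopsAt L 2} := by
    intro L hL
    have h0 : L 0 = 1 := hL 0 (by simp)
    have h1 : L 1 = 0 := hL 1 (by simp)
    refine ⟨by simp [Finset.sum_range_succ, h0, h1], fun m hm => ?_⟩
    interval_cases m <;> simp [h0]
  refine fun h0 => ?_
  have := measure_mono_null hsub h0
  rw [offspringLaw, Measure.infinitePi_pi _ (fun i _ => measurableSet_singleton _)] at this
  rw [Finset.prod_eq_zero_iff] at this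
  obtain ⟨i, _, hi⟩ := this
  rw [poissonMeasure_singleton, ENNReal.ofReal_eq_zero, Real.coe_toNNReal _ hh.le] at hi
  have : 0 < Real.exp (-h) * h ^ (1 - i) / ((1 - i).factorial) := by positivity
  linarith

lemma integrable_exp_totalBirth_iff {h : ℝ} {f : ℝ → ℝ} (hf : IsDensity f) (hh : 0 < h)
    (hh' : h < 1) (θ : ℝ) :
    Integrable (fun c : Cluster => Real.exp (θ * c.totalBirth)) (clusterLaw h f) ↔
      ∑' n, sizeProb h n * birthMGF f θ ^ (n - 1) ≠ ∞ := by
  have hm : Measurable fun c : Cluster => Real.exp (θ * c.totalBirth) := by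
    have := Cluster.measurable_totalBirth
    fun_prop
  rw [← lintegral_exp_totalBirth hf hh hh' θ, ← lt_top_iff_ne_top, ← hasFiniteIntegral_iff_ofReal
    (Eventually.of_forall fun c => Real.exp_nonneg _)]
  exact ⟨fun h => h.2, fun h => ⟨hm.aestronglyMeasurable, h⟩⟩

/-- Admissible tilting parameters exist. -/
theorem exists_integrable_exp_totalBirth {h : ℝ} {f : ℝ → ℝ} (hf : IsDensity f) (hh : 0 < h)
    (hh' : h < 1)
    (hlight : ∃ θ₀ > 0, IntegrableOn (fun t => Real.exp (θ₀ * t) * f t) (Set.Ioi 0)) :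
    ∃ θ₁ > 0, ∀ θ ∈ Set.Ioo 0 θ₁,
      Integrable (fun c : Cluster => Real.exp (θ * c.totalBirth)) (clusterLaw h f) := by
  obtain ⟨θ₀, hθ₀, hint⟩ := hlight
  have hM₀ := birthMGF_ne_top_of_integrableOn hf hint
  set M₀ := (birthMGF f θ₀).toReal with hM₀def
  have hM₀1 : 1 ≤ M₀ := by
    have := ENNReal.toReal_mono hM₀ (one_le_birthMGF hf hθ₀.le)
    simpa using this
  set ρ := h * Real.exp (1 - h) with hρ
  have hρ1 : ρ < 1 := mul_exp_lt_one hh'.ne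
  have hρ0 : 0 < ρ := by positivity
  -- The second bound keeps the convexity estimate `m = 1 + θ / θ₀ * M₀` below `1 / ρ`. This says `e
  -- z < 1` at `z = h m exp (-h)`, where `treeSeries` is finite.
  refine ⟨min θ₀ (θ₀ * (1 / ρ - 1) / M₀), lt_min hθ₀ ?_, fun θ hθ => ?_⟩
  · have : 0 < 1 / ρ - 1 := by rw [sub_pos, lt_div_iff₀ hρ0]; linarith
    positivity
  obtain ⟨hθpos, hθlt⟩ := hθ
  have hθ0 : θ < θ₀ := hθlt.trans_le (min_le_left _ _)
  have hθ1 : θ < θ₀ * (1 / ρ - 1) / M₀ := hθlt.trans_le (min_le_right _ _)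
  have hle := birthMGF_le_one_add hf hθpos.le hθ0
  rw [← ENNReal.ofReal_toReal hM₀, ← hM₀def, ← ENNReal.ofReal_mul (by positivity),
    ← ENNReal.ofReal_one, ← ENNReal.ofReal_add zero_le_one (by positivity)] at hle
  set m := 1 + θ / θ₀ * M₀ with hm
  have hm1 : m < 1 / ρ := by
    have : θ / θ₀ * M₀ < 1 / ρ - 1 := by
      rw [div_mul_eq_mul_div, div_lt_iff₀ hθ₀]
      rw [lt_div_iff₀ (by linarith)] at hθ1
      linarith
    linarith
  have hm0 : 0 < m := by positivity
  have hz : Real.exp 1 * (h * m * Real.exp (-h)) < 1 := by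
    rw [show Real.exp 1 * (h * m * Real.exp (-h)) = m * ρ by
      rw [hρ, sub_eq_add_neg, Real.exp_add]; ring]
    rwa [lt_div_iff₀ hρ0] at hm1
  obtain ⟨h', hh0, hh1, he⟩ := exists_mul_exp_neg_eq (by positivity) hz
  rw [integrable_exp_totalBirth_iff hf hh hh']
  have hfin : ∑' n, sizeProb h n * ENNReal.ofReal m ^ (n - 1) ≠ ∞ := by
    have h1 := mul_tsum_sizeProb hh hm0.le
    rw [← he, treeSeries_eq hh0 hh1] at h1
    intro htop
    rw [htop, ENNReal.mul_top
      (by simp only [ne_eq, ENNReal.ofReal_eq_zero, not_le]; positivity)] at h1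
    exact ENNReal.ofReal_ne_top h1.symm
  refine ne_top_of_le_ne_top hfin (ENNReal.tsum_le_tsum fun n => ?_)
  gcongr

lemma isDensity_tiltedDensity {f : ℝ → ℝ} (hf : IsDensity f) {η : ℝ} (hη : 0 ≤ η)
    (hM : birthMGF f η ≠ ∞) : IsDensity (tiltedDensity f η) := by
  have hm := hf.measurable
  have h1 : 1 ≤ (birthMGF f η).toReal := by
    simpa using ENNReal.toReal_mono hM (one_le_birthMGF hf hη)
  refine ⟨?_, fun t ht => mul_nonneg (hf.nonneg t ht) (Real.exp_nonneg _), ?_⟩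
  · unfold tiltedDensity
    fun_prop
  · have e : ∀ t, ENNReal.ofReal (tiltedDensity f η t) =
        (birthMGF f η)⁻¹ * ENNReal.ofReal (Real.exp (η * t) * f t) := by
      intro t
      rw [tiltedDensity, Real.exp_sub, psiF_eq hf, Real.exp_log (by linarith),
        ← ENNReal.ofReal_toReal hM, ← ENNReal.ofReal_inv_of_pos (by linarith),
        ← ENNReal.ofReal_mul (by positivity), ENNReal.toReal_ofReal (by linarith)]
      congr 1
      field_simp
    simp_rw [e]
    rw [lintegral_const_mul _ (by fun_prop), ← birthMGF_eq hf, ENNReal.inv_mul_cancel _ hM]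
    exact (zero_lt_one.trans_le (one_le_birthMGF hf hη)).ne'

/-- The tilted parameters are those of a subcritical cluster. -/
theorem tilted_parameters {h : ℝ} {f : ℝ → ℝ} (hf : IsDensity f) (hh : 0 < h) (hh' : h < 1)
    {η η' : ℝ} (hη : 0 < η) (hηη' : η < η')
    (hint : Integrable (fun c : Cluster => Real.exp (η' * c.totalBirth)) (clusterLaw h f)) :
    IsDensity (tiltedDensity f η) ∧ h * Real.exp (psiF f η + psiB h f η) = h + psiB h f η ∧
      0 < h + psiB h f η ∧ h + psiB h f η < 1 ∧
      ∫⁻ c, ENNReal.ofReal (Real.exp (η * c.totalBirth)) ∂(clusterLaw h f) =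
        ENNReal.ofReal (Real.exp (psiB h f η)) := by
  rw [integrable_exp_totalBirth_iff hf hh hh'] at hint
  have hM' : birthMGF f η' ≠ ∞ := by
    have h2 := ne_top_of_le_ne_top hint (ENNReal.le_tsum 2)
    intro htop
    rw [htop] at h2
    exact h2 (by simpa using ENNReal.mul_top (sizeProb_two_ne_zero hh))
  have hlt := birthMGF_lt_birthMGF hf hηη' hM'
  have hM : birthMGF f η ≠ ∞ := hlt.ne_top
  set m := (birthMGF f η).toReal with hmdef
  set m' := (birthMGF f η').toReal with hmdef'
  have hm1 : 1 ≤ m := by simpa using ENNReal.toReal_mono hM (one_le_birthMGF hf hη.le)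
  have hmm' : m < m' := (ENNReal.toReal_lt_toReal hM hM').2 hlt
  -- Finiteness at `η'` only gives the closed inequality. Strict monotonicity of the birth moment
  -- generating function makes it strict at `η`, hence the parameter `k` below is subcritical.
  have hz' : Real.exp 1 * (h * m' * Real.exp (-h)) ≤ 1 := by
    refine exp_one_mul_le_of_treeSeries_ne_top ?_
    rw [← mul_tsum_sizeProb hh (by linarith), hmdef', ENNReal.ofReal_toReal hM']
    exact ENNReal.mul_ne_top ENNReal.ofReal_ne_top hint
  have hz : Real.exp 1 * (h * m * Real.exp (-h)) < 1 := by
    refine lt_of_lt_of_le ?_ hz'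
    gcongr
  have hmpos : 0 < m := by linarith
  obtain ⟨k, hk0, hk1, hk⟩ := exists_mul_exp_neg_eq (by positivity) hz
  have hmgf : ∫⁻ c, ENNReal.ofReal (Real.exp (η * c.totalBirth)) ∂(clusterLaw h f) =
      ENNReal.ofReal (Real.exp (k - h)) := by
    rw [lintegral_exp_totalBirth hf hh hh', ← ENNReal.ofReal_toReal hM, ← hmdef]
    have h1 := mul_tsum_sizeProb hh hmpos.le
    rw [← hk, treeSeries_eq hk0 hk1] at h1
    -- From `k exp (-k) = h m exp (-h)` one gets `k / (h m) = exp (k - h)`, so the moment generating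
    -- function of `B` at `η` is `exp (k - h)`.
    have h2 : ENNReal.ofReal k = ENNReal.ofReal (h * m) * ENNReal.ofReal (Real.exp (k - h)) := by
      rw [← ENNReal.ofReal_mul (by positivity)]
      congr 1
      have : h * m = k * Real.exp (-k) * Real.exp h := by
        rw [hk, mul_assoc, ← Real.exp_add]; simp
      rw [this, mul_assoc, mul_assoc, ← Real.exp_add, ← Real.exp_add]
      simp
    rw [h2] at h1
    refine (ENNReal.mul_right_inj ?_ ENNReal.ofReal_ne_top).1 h1
    simp only [ne_eq, ENNReal.ofReal_eq_zero, not_le]; positivity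
  have hpsi : psiB h f η = k - h := by
    have hm : Measurable fun c : Cluster => Real.exp (η * c.totalBirth) := by
      have := Cluster.measurable_totalBirth
      fun_prop
    rw [psiB, cgf, mgf, integral_eq_lintegral_of_nonneg_ae
      (Eventually.of_forall fun c => Real.exp_nonneg _) hm.aestronglyMeasurable, hmgf,
      ENNReal.toReal_ofReal (Real.exp_nonneg _), Real.log_exp]
  refine ⟨isDensity_tiltedDensity hf hη.le hM, ?_, by rw [hpsi]; linarith, by rw [hpsi]; linarith,
    by rw [hmgf, hpsi]⟩
  rw [Real.exp_add, psiF_eq hf, Real.exp_log hmpos, hpsi, ← mul_assoc]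
  have : h * m = k * Real.exp (-k) * Real.exp h := by
    rw [hk, mul_assoc, ← Real.exp_add]; simp
  rw [this, mul_assoc, mul_assoc, ← Real.exp_add, ← Real.exp_add]
  simp

/-! ### Almost sure properties of subcritical clusters, and the density of the tilted law -/

lemma ae_clusterLaw_of_generate {h : ℝ} {f : ℝ → ℝ} (hf : IsDensity f) (hh : 0 < h) (hh' : h < 1)
    {p : Cluster → Prop} (hp : MeasurableSet {c | p c})
    (hgen : ∀ L b n, StopsAt L n → (∀ j, 0 ≤ b j) → p (generate L b)) :
    ∀ᵐ c ∂(clusterLaw h f), p c := by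
  have := hf.isProbabilityMeasure
  rw [clusterLaw, ae_map_iff measurable_generate.aemeasurable hp]
  have h1 : ∀ᵐ s ∂((offspringLaw h).prod (Measure.infinitePi fun _ : ℕ => birthLaw f)),
      ∃ n, StopsAt s.1 n := Measure.quasiMeasurePreserving_fst.ae (ae_exists_stopsAt hh hh')
  have h2 : ∀ᵐ b ∂(Measure.infinitePi fun _ : ℕ => birthLaw f), ∀ j, 0 ≤ b j :=
    ae_all_iff.2 fun j => (measurePreserving_eval_infinitePi (fun _ : ℕ => birthLaw f)
      j).quasiMeasurePreserving.ae ((ae_birthLaw_pos f).mono fun _ ht => ht.le)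
  have h3 : ∀ᵐ s ∂((offspringLaw h).prod (Measure.infinitePi fun _ : ℕ => birthLaw f)),
      ∀ j, 0 ≤ s.2 j := Measure.quasiMeasurePreserving_snd.ae h2
  filter_upwards [h1, h3] with s hs1 hs2
  obtain ⟨n, hn⟩ := hs1
  exact hgen _ _ n hn hs2

lemma ae_size_ne_zero {h : ℝ} {f : ℝ → ℝ} (hf : IsDensity f) (hh : 0 < h) (hh' : h < 1) :
    ∀ᵐ c ∂(clusterLaw h f), c.1 ≠ 0 :=
  ae_clusterLaw_of_generate hf hh hh' (measurableSet_size 0).compl fun L b n hn _ => by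
    rw [(generate_fst_eq_iff hn.pos.ne').2 hn]
    exact hn.pos.ne'

lemma ae_length_le_totalBirth {h : ℝ} {f : ℝ → ℝ} (hf : IsDensity f) (hh : 0 < h) (hh' : h < 1) :
    ∀ᵐ c ∂(clusterLaw h f), c.length ≤ c.totalBirth :=
  ae_clusterLaw_of_generate hf hh hh'
    (measurableSet_le Cluster.measurable_length Cluster.measurable_totalBirth)
    fun _ _ _ hn hb => hn.length_le_totalBirth hb

lemma measurable_shift_right (s : ℝ) : Measurable (Cluster.shift s) :=
  Cluster.measurable_shift.comp measurable_prodMk_left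

lemma ae_totalBirth_shift {h : ℝ} {f : ℝ → ℝ} (hf : IsDensity f) (hh : 0 < h) (hh' : h < 1)
    (s : ℝ) : ∀ᵐ c ∂(clusterLaw h f), (c.shift s).totalBirth = c.totalBirth :=
  ae_clusterLaw_of_generate hf hh hh'
    (measurableSet_eq_fun (Cluster.measurable_totalBirth.comp (measurable_shift_right s))
      Cluster.measurable_totalBirth)
    fun L b _ _ _ => totalBirth_shift_generate L b s

lemma ae_time_zero_shift {h : ℝ} {f : ℝ → ℝ} (hf : IsDensity f) (hh : 0 < h) (hh' : h < 1)
    (s : ℝ) : ∀ᵐ c ∂(clusterLaw h f), (c.shift s).time 0 = s :=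
  ae_clusterLaw_of_generate hf hh hh'
    (measurableSet_eq_fun ((Cluster.measurable_time 0).comp (measurable_shift_right s))
      measurable_const)
    fun _ b _ hn _ => time_zero_shift_generate hn b s

/-- The tilted cluster law has density `exp (η B - ψ_B η)`. -/
theorem clusterLaw_tilted {h : ℝ} {f : ℝ → ℝ} (hf : IsDensity f) (hh : 0 < h) (hh' : h < 1)
    {η η' : ℝ} (hη : 0 < η) (hηη' : η < η')
    (hint : Integrable (fun c : Cluster => Real.exp (η' * c.totalBirth)) (clusterLaw h f)) :
    clusterLaw (h * Real.exp (psiF f η + psiB h f η)) (tiltedDensity f η) =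
      (clusterLaw h f).withDensity
        fun c => ENNReal.ofReal (Real.exp (η * c.totalBirth - psiB h f η)) := by
  obtain ⟨hfη, hk, hk0, hk1, -⟩ := tilted_parameters hf hh hh' hη hηη' hint
  have hmB := Cluster.measurable_totalBirth
  refine Measure.ext_of_lintegral _ fun φ hφ => ?_
  rw [lintegral_withDensity_eq_lintegral_mul _ (by fun_prop) hφ]
  have hU : (⋃ n, {c : Cluster | c.1 = n}) = Set.univ := by ext c; simp
  have hdis : Pairwise (Function.onFun Disjoint fun n => {c : Cluster | c.1 = n}) :=
    fun m n hmn => Set.disjoint_left.2 fun c hm hn => hmn (hm.symm.trans hn)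
  rw [← setLIntegral_univ, ← setLIntegral_univ (μ := clusterLaw h f), ← hU,
    lintegral_iUnion measurableSet_size hdis, lintegral_iUnion measurableSet_size hdis]
  refine tsum_congr fun n => ?_
  rcases Nat.eq_zero_or_pos n with rfl | hn
  -- Size `0` is null under both laws, as both are subcritical. On this event no change of measure
  -- is available.
  · have h0 : ∀ {k : ℝ} {g : ℝ → ℝ}, IsDensity g → 0 < k → k < 1 →
        clusterLaw k g {c | c.1 = 0} = 0 := fun hg h1 h2 => by
      have := ae_size_ne_zero hg h1 h2
      rw [ae_iff] at this
      simpa using this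
    rw [setLIntegral_measure_zero _ _ (h0 hfη (hk ▸ hk0) (hk ▸ hk1)),
      setLIntegral_measure_zero _ _ (h0 hf hh hh')]
  · rw [setLIntegral_clusterLaw_tilted hf hfη hh (hk ▸ hk0) hφ hn.ne']
    refine setLIntegral_congr_fun (measurableSet_size n) fun c _ => ?_
    rw [Pi.mul_apply, mul_comm (ENNReal.ofReal _) (φ c), ← ENNReal.ofReal_mul (by
      have := hk ▸ hk0; positivity)]
    congr 2
    obtain ⟨j, rfl⟩ : ∃ j, n = j + 1 := ⟨n - 1, by omega⟩
    -- With `h' - h = ψ_B` the exponent besides `η B` is `-n ψ_B + (n - 1) (ψ_f + ψ_B) - (n - 1) ψ_f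
    -- = -ψ_B`, independent of `n`.
    have e1 : h * Real.exp (psiF f η + psiB h f η) - h = psiB h f η := by rw [hk]; ring
    have e2 : h * Real.exp (psiF f η + psiB h f η) / h = Real.exp (psiF f η + psiB h f η) := by
      field_simp
    rw [e1, e2, ← Real.exp_nat_mul, ← Real.exp_nat_mul, ← Real.exp_add, ← Real.exp_add]
    congr 1
    push_cast
    ring

/-! ### Laplace functionals of the output and of the target -/

/-- The acceptance region: pairs of an arrival time and a draw (cluster, uniform variable). -/
def acceptSet (η : ℝ) : Set (ℝ × Cluster × ℝ) :=
  {p | -p.1 < (p.2.1.shift p.1).length ∧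
    p.2.2 ≤ Real.exp (-η * ((p.2.1.shift p.1).totalBirth + p.1))}

lemma measurable_shift_draw : Measurable fun p : ℝ × Cluster × ℝ => p.2.1.shift p.1 := by
  have : Measurable fun p : ℝ × Cluster × ℝ => (p.1, p.2.1) := by fun_prop
  exact Cluster.measurable_shift.comp this

lemma measurableSet_acceptSet (η : ℝ) : MeasurableSet (acceptSet η) := by
  have h1 := Cluster.measurable_length.comp measurable_shift_draw
  have h2 := Cluster.measurable_totalBirth.comp measurable_shift_draw
  refine (measurableSet_lt measurable_fst.neg h1).inter
    (measurableSet_le (measurable_snd.comp measurable_snd) ?_)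
  exact Real.measurable_exp.comp ((h2.add measurable_fst).const_mul (-η))

/-- The cluster law of the algorithm. -/
abbrev proposalLaw (h : ℝ) (f : ℝ → ℝ) (η : ℝ) : Measure Cluster :=
  clusterLaw (h * Real.exp (psiF f η + psiB h f η)) (tiltedDensity f η)

/-- The law of one draw (cluster, uniform variable) of the algorithm. -/
abbrev drawLaw (h : ℝ) (f : ℝ → ℝ) (η : ℝ) : Measure (Cluster × ℝ) :=
  (proposalLaw h f η).prod (volume.restrict (Set.Icc 0 1))

instance isProbabilityMeasure_uniform :
    IsProbabilityMeasure ((volume : Measure ℝ).restrict (Set.Icc 0 1)) := ⟨by simp⟩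

lemma uniform_Iic {a : ℝ} (ha : a ≤ 1) :
    (volume : Measure ℝ).restrict (Set.Icc 0 1) (Set.Iic a) = ENNReal.ofReal a := by
  rw [Measure.restrict_apply measurableSet_Iic]
  have : Set.Iic a ∩ Set.Icc 0 1 = Set.Icc 0 a := by
    ext x
    simp only [Set.mem_inter_iff, Set.mem_Iic, Set.mem_Icc]
    exact ⟨fun h => ⟨h.2.1, h.1⟩, fun h => ⟨h.2, h.1, h.2.trans ha⟩⟩
  rw [this, Real.volume_Icc, sub_zero]

lemma isProbabilityMeasure_proposalLaw
    {h : ℝ} {f : ℝ → ℝ} (hf : IsDensity f) (hh : 0 < h) (hh' : h < 1)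
    {η η' : ℝ} (hη : 0 < η) (hηη' : η < η')
    (hint : Integrable (fun c : Cluster => Real.exp (η' * c.totalBirth)) (clusterLaw h f)) :
    IsProbabilityMeasure (proposalLaw h f η) :=
  isProbabilityMeasure_clusterLaw (tilted_parameters hf hh hh' hη hηη' hint).1

/-- An accepted cluster arriving at `t` is, up to a constant factor, distributed as a cluster
that lasts past `0`. -/
theorem lintegral_accept
    {h : ℝ} {f : ℝ → ℝ} (hf : IsDensity f) (hh : 0 < h) (hh' : h < 1)
    {η η' : ℝ} (hη : 0 < η) (hηη' : η < η')
    (hint : Integrable (fun c : Cluster => Real.exp (η' * c.totalBirth)) (clusterLaw h f))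
    (t : ℝ) {φ : Cluster → ℝ≥0∞} (hφ : Measurable φ) :
    ∫⁻ z, (acceptSet η).indicator (fun p => φ (p.2.1.shift p.1)) (t, z) ∂(drawLaw h f η) =
      ENNReal.ofReal (Real.exp (-(psiB h f η + η * t))) *
        ∫⁻ c, {c | -t < c.length}.indicator (fun c => φ (c.shift t)) c ∂(clusterLaw h f) := by
  have hmB := Cluster.measurable_totalBirth
  have hm : Measurable fun z : Cluster × ℝ =>
      (acceptSet η).indicator (fun p => φ (p.2.1.shift p.1)) (t, z) :=
    ((hφ.comp measurable_shift_draw).indicator (measurableSet_acceptSet η)).comp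
      measurable_prodMk_left
  have hmL : Measurable ({c : Cluster | -t < c.length}.indicator fun c => φ (c.shift t)) :=
    (hφ.comp (measurable_shift_right t)).indicator
      (measurableSet_lt measurable_const Cluster.measurable_length)
  rw [drawLaw, lintegral_prod _ hm.aemeasurable, proposalLaw,
    clusterLaw_tilted hf hh hh' hη hηη' hint,
    lintegral_withDensity_eq_lintegral_mul _ (by fun_prop) hm.lintegral_prod_right',
    ← lintegral_const_mul _ hmL]
  refine lintegral_congr_ae ?_
  filter_upwards [ae_length_le_totalBirth hf hh hh', ae_totalBirth_shift hf hh hh' t] with c hc hs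
  rw [Pi.mul_apply]
  by_cases hL : -t < c.length
  · rw [Set.indicator_of_mem (by exact hL)]
    have h1 : ∀ x : ℝ, (acceptSet η).indicator (fun p => φ (p.2.1.shift p.1)) (t, c, x) =
        (Set.Iic (Real.exp (-η * (c.totalBirth + t)))).indicator
          (fun _ => φ (c.shift t)) x := by
      intro x
      have hiff : (t, c, x) ∈ acceptSet η ↔ x ≤ Real.exp (-η * (c.totalBirth + t)) := by
        simp only [acceptSet, Set.mem_ofPred_eq, Cluster.length_shift, hs]
        exact and_iff_right hL
      by_cases hx : x ≤ Real.exp (-η * (c.totalBirth + t))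
      · rw [Set.indicator_of_mem (hiff.2 hx), Set.indicator_of_mem (by exact hx)]
      · rw [Set.indicator_of_notMem fun h => hx (hiff.1 h),
          Set.indicator_of_notMem (by exact hx)]
    simp_rw [h1]
    rw [lintegral_indicator_const measurableSet_Iic, uniform_Iic,
      mul_comm (φ _), ← mul_assoc, ← ENNReal.ofReal_mul (Real.exp_nonneg _), ← Real.exp_add]
    · congr 3
      ring
    -- The threshold is a genuine probability, because `-t < L ≤ B`.
    · rw [Real.exp_le_one_iff]
      nlinarith
  · rw [Set.indicator_of_notMem (by exact hL), mul_zero]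
    have h1 : ∀ x : ℝ, (acceptSet η).indicator (fun p => φ (p.2.1.shift p.1)) (t, c, x) = 0 := by
      intro x
      refine Set.indicator_of_notMem (fun hx => hL ?_) _
      have := hx.1
      rwa [Cluster.length_shift] at this
    simp [h1]

/-- The exponent of the Laplace functional of `N₀`. -/
def targetExponent (lam h : ℝ) (f : ℝ → ℝ) (g : Cluster → ℝ≥0∞) : ℝ≥0∞ :=
  ∫⁻ t in Set.Iic 0, ENNReal.ofReal lam *
    ∫⁻ c, {c | -t < c.length}.indicator (fun c => 1 - expNeg (g (c.shift t))) c ∂(clusterLaw h f)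

/-- The exponential in the proposal intensity cancels the constant factor left by the acceptance
step. The map `1 - expNeg` vanishes at `0`, so it commutes with the indicator of the acceptance
region. -/
lemma lintegral_intensity_accept
    {h : ℝ} {f : ℝ → ℝ} (hf : IsDensity f) (hh : 0 < h) (hh' : h < 1)
    {η η' : ℝ} (hη : 0 < η) (hηη' : η < η')
    (hint : Integrable (fun c : Cluster => Real.exp (η' * c.totalBirth)) (clusterLaw h f))
    {lam : ℝ} (hlam : 0 ≤ lam) {g : Cluster → ℝ≥0∞}
    (hg : Measurable g) :
    ∫⁻ t, ∫⁻ z, 1 - expNeg ((acceptSet η).indicator (fun p => g (p.2.1.shift p.1)) (t, z))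
      ∂(drawLaw h f η) ∂(intensityOnPast fun t => lam * Real.exp (psiB h f η + η * t)) =
      targetExponent lam h f g := by
  have := isProbabilityMeasure_proposalLaw hf hh hh' hη hηη' hint
  have hmφ : Measurable fun c => 1 - expNeg (g c) :=
    measurable_const.sub (measurable_expNeg.comp hg)
  have h1 : ∀ p : ℝ × Cluster × ℝ,
      1 - expNeg ((acceptSet η).indicator (fun p => g (p.2.1.shift p.1)) p) =
        (acceptSet η).indicator (fun p => (fun c => 1 - expNeg (g c)) (p.2.1.shift p.1)) p := by
    intro p
    by_cases hp : p ∈ acceptSet η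
    · rw [Set.indicator_of_mem hp, Set.indicator_of_mem hp]
    · rw [Set.indicator_of_notMem hp, Set.indicator_of_notMem hp]; simp
  simp_rw [h1]
  have hm : Measurable fun t => ∫⁻ z, (acceptSet η).indicator
      (fun p => (fun c => 1 - expNeg (g c)) (p.2.1.shift p.1)) (t, z) ∂(drawLaw h f η) :=
    ((hmφ.comp measurable_shift_draw).indicator (measurableSet_acceptSet η)).lintegral_prod_right'
  rw [intensityOnPast, lintegral_withDensity_eq_lintegral_mul _ (by fun_prop) hm, targetExponent]
  refine lintegral_congr fun t => ?_
  rw [Pi.mul_apply, lintegral_accept hf hh hh' hη hηη' hint t hmφ, ← mul_assoc,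
    ← ENNReal.ofReal_mul (by positivity), mul_assoc, ← Real.exp_add, add_neg_cancel,
    Real.exp_zero, mul_one]

instance sigmaFinite_intensityOnPast (γ : ℝ → ℝ) : SigmaFinite (intensityOnPast γ) := by
  unfold intensityOnPast
  infer_instance

/-! ### Laplace functional of the output -/

section Algorithm

variable {Ω : Type*} {η : ℝ}
  {K : Ω → ℕ} {τ : ℕ → Ω → ℝ} {D : ℕ → Ω → Cluster} {X : ℕ → Ω → ℝ}

open Classical in
lemma lintegral_outputProcess {g : Cluster → ℝ≥0∞} (hg : Measurable g) (ω : Ω) :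
    ∫⁻ c, g c ∂(outputProcess η K τ D X ω) = ∑' m, if m < K ω then
      (acceptSet η).indicator (fun p => g (p.2.1.shift p.1)) (τ m ω, D m ω, X m ω) else 0 := by
  rw [outputProcess, lintegral_finsetSum_measure, Finset.sum_filter,
    tsum_eq_sum (s := Finset.range (K ω))]
  · refine Finset.sum_congr rfl fun m hm => ?_
    rw [if_pos (Finset.mem_range.1 hm), lintegral_dirac' _ hg]
    by_cases hacc : (τ m ω, D m ω, X m ω) ∈ acceptSet η
    · rw [if_pos ⟨Finset.mem_range.1 hm, hacc⟩, Set.indicator_of_mem hacc]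
      rfl
    · rw [if_neg fun h => hacc h.2, Set.indicator_of_notMem hacc]
  · intro m hm
    rw [if_neg (by simpa using hm)]

lemma outputProcess_apply {A : Set Cluster} (hA : MeasurableSet A) (ω : Ω) :
    outputProcess η K τ D X ω A = ∫⁻ c, A.indicator 1 c ∂(outputProcess η K τ D X ω) :=
  (lintegral_indicator_one hA).symm

variable [MeasurableSpace Ω] {P : Measure Ω} {lam h₁ : ℝ} {f : ℝ → ℝ}

lemma IsAlgorithmRun.measurable_draw
    (run : IsAlgorithmRun P lam h₁ f η K τ D X) :
    Measurable fun ω m => (D m ω, X m ω) :=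
  measurable_pi_iff.2 fun m => (run.measurable_cluster m).prodMk (run.measurable_uniform m)

lemma IsAlgorithmRun.measurable_arrivals
    (run : IsAlgorithmRun P lam h₁ f η K τ D X) :
    Measurable fun ω => (K ω, fun m => τ m ω) :=
  run.measurable_count.prodMk (measurable_pi_iff.2 run.measurable_arrival)

lemma IsAlgorithmRun.measurable_arrival_draw
    (run : IsAlgorithmRun P lam h₁ f η K τ D X)
    (m : ℕ) :
    Measurable fun ω => (τ m ω, D m ω, X m ω) :=
  (run.measurable_arrival m).prodMk
    ((run.measurable_cluster m).prodMk (run.measurable_uniform m))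

lemma IsAlgorithmRun.measurableSet_lt_count
    (run : IsAlgorithmRun P lam h₁ f η K τ D X)
    (m : ℕ) : MeasurableSet {ω | m < K ω} :=
  measurableSet_lt measurable_const run.measurable_count

lemma IsAlgorithmRun.measurable_outputProcess
    (run : IsAlgorithmRun P lam h₁ f η K τ D X) :
    Measurable (outputProcess η K τ D X) := by
  classical
  refine Measure.measurable_of_measurable_coe _ fun A hA => ?_
  simp_rw [outputProcess_apply hA, lintegral_outputProcess (measurable_one.indicator hA)]
  refine Measurable.tsum fun m => Measurable.ite (run.measurableSet_lt_count m) ?_ measurable_const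
  exact (((measurable_one.indicator hA).comp measurable_shift_draw).indicator
    (measurableSet_acceptSet η)).comp (run.measurable_arrival_draw m)

lemma IsAlgorithmRun.hasLaw_draw
    (run : IsAlgorithmRun P lam h₁ f η K τ D X) :
    HasLaw (fun ω m => (D m ω, X m ω))
    (Measure.infinitePi fun _ : ℕ => drawLaw h₁ f η) P :=
  run.draw_indep.hasLaw_infinitePi run.draw_law run.measurable_draw.aemeasurable

/-- Laplace functional of the output of the algorithm. -/
theorem IsAlgorithmRun.laplace_output
    (run : IsAlgorithmRun P lam h₁ f η K τ D X)
    [IsProbabilityMeasure P] (hlam : 0 ≤ lam) (hf : IsDensity f) (hh : 0 < h₁)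
    (hh' : h₁ < 1) {η' : ℝ} (hη : 0 < η) (hηη' : η < η')
    (hint : Integrable (fun c : Cluster => Real.exp (η' * c.totalBirth)) (clusterLaw h₁ f))
    {g : Cluster → ℝ≥0∞} (hg : Measurable g) :
    ∫⁻ ω, expNeg (∫⁻ c, g c ∂(outputProcess η K τ D X ω)) ∂P =
      expNeg (targetExponent lam h₁ f g) := by
  classical
  have := isProbabilityMeasure_proposalLaw hf hh hh' hη hηη' hint
  have hψ : Measurable fun (q : ℕ × (ℕ → ℝ)) (m : ℕ) => ((m < q.1 : Prop), q.2 m) := by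
    refine measurable_pi_iff.2 fun m => Measurable.prodMk ?_ (by fun_prop)
    exact (Measurable.of_discrete (f := fun k : ℕ => (m < k : Prop))).comp measurable_fst
  have hG : Measurable fun p : ℝ × Cluster × ℝ =>
      (acceptSet η).indicator (fun p => g (p.2.1.shift p.1)) (p.1, p.2) :=
    (hg.comp measurable_shift_draw).indicator (measurableSet_acceptSet η)
  have key := run.poisson.lintegral_expNeg_marked (ν := drawLaw h₁ f η)
    (T := fun ω m => ((m < K ω : Prop), τ m ω)) (hψ.comp run.measurable_arrivals)
    (fun ω g hg => by
      rw [lintegral_finsetSum_measure, tsum_eq_sum (s := Finset.range (K ω))]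
      · refine Finset.sum_congr rfl fun m hm => ?_
        rw [if_pos (Finset.mem_range.1 hm), lintegral_dirac' _ hg]
      · intro m hm
        rw [if_neg (by simpa using hm)])
    run.hasLaw_draw (run.indep.comp hψ measurable_id)
    (G := fun t z => (acceptSet η).indicator (fun p => g (p.2.1.shift p.1)) (t, z)) hG
  rw [lintegral_intensity_accept hf hh hh' hη hηη' hint hlam hg] at key
  rw [← key]
  refine lintegral_congr fun ω => ?_
  rw [lintegral_outputProcess hg]
  congr 1
  refine tsum_congr fun m => ?_
  by_cases hm : m < K ω
  · rw [if_pos hm, if_pos hm]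
  · rw [if_neg hm, if_neg hm]

end Algorithm

/-! ### Laplace functional of the target process -/

section Stationary

variable {Ω : Type*} {τ : Idx → Ω → ℝ} {D : Idx → Ω → Cluster}

open Classical in
lemma lintegral_targetProcess {g : Cluster → ℝ≥0∞} (hg : Measurable g) (ω : Ω) :
    ∫⁻ c, g c ∂(targetProcess τ D ω) = ∑' m : Idx,
      if m.1 ≤ -1 ∧ -τ m ω < ((D m ω).shift (τ m ω)).length then g ((D m ω).shift (τ m ω))
      else 0 := by
  rw [targetProcess, lintegral_sum_measure]
  refine tsum_congr fun m => ?_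
  split_ifs
  · rw [lintegral_dirac' _ hg]
  · simp

lemma targetProcess_apply {A : Set Cluster} (hA : MeasurableSet A) (ω : Ω) :
    targetProcess τ D ω A = ∫⁻ c, A.indicator 1 c ∂(targetProcess τ D ω) :=
  (lintegral_indicator_one hA).symm

variable [MeasurableSpace Ω] {P : Measure Ω} {lam h₁ : ℝ} {f : ℝ → ℝ}

lemma IsStationaryModel.measurable_shifted
    (model : IsStationaryModel P lam h₁ f τ D)
    (m : Idx) :
    Measurable fun ω => (D m ω).shift (τ m ω) :=
  Cluster.measurable_shift.comp
    ((model.measurable_arrival m).prodMk (model.measurable_cluster m))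

lemma IsStationaryModel.measurable_targetProcess
    (model : IsStationaryModel P lam h₁ f τ D) :
    Measurable (targetProcess τ D) := by
  classical
  refine Measure.measurable_of_measurable_coe _ fun A hA => ?_
  simp_rw [targetProcess_apply hA, lintegral_targetProcess (measurable_one.indicator hA)]
  refine Measurable.tsum fun m => Measurable.ite ?_ ?_ measurable_const
  · exact (MeasurableSet.const _).inter (measurableSet_lt (model.measurable_arrival m).neg
      (Cluster.measurable_length.comp (model.measurable_shifted m)))
  · exact (measurable_one.indicator hA).comp (model.measurable_shifted m)

/-- Laplace functional of `N₀`. -/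
theorem IsStationaryModel.laplace_target
    (model : IsStationaryModel P lam h₁ f τ D)
    [IsProbabilityMeasure P] (hf : IsDensity f) {g : Cluster → ℝ≥0∞}
    (hg : Measurable g) :
    ∫⁻ ω, expNeg (∫⁻ c, g c ∂(targetProcess τ D ω)) ∂P = expNeg (targetExponent lam h₁ f g) := by
  classical
  have := isProbabilityMeasure_clusterLaw (h := h₁) hf
  let S : Set (ℝ × Cluster) := {p | p.1 ≤ 0 ∧ -p.1 < p.2.length}
  have hS : MeasurableSet S := (measurableSet_le measurable_fst measurable_const).inter
    (measurableSet_lt measurable_fst.neg (Cluster.measurable_length.comp measurable_snd))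
  have hG : Measurable fun p : ℝ × Cluster => S.indicator (fun p => g (p.2.shift p.1)) (p.1, p.2) :=
    (hg.comp Cluster.measurable_shift).indicator hS
  have hψ : Measurable fun (q : Idx → ℝ) (m : Idx) => (True, q m) := by fun_prop
  have hτ : Measurable fun ω m => τ m ω := measurable_pi_iff.2 model.measurable_arrival
  have hD : HasLaw (fun ω m => D m ω) (Measure.infinitePi fun _ : Idx => clusterLaw h₁ f) P :=
    model.cluster_indep.hasLaw_infinitePi model.cluster_law
      (measurable_pi_iff.2 model.measurable_cluster).aemeasurable
  have hσ : SigmaFinite (ENNReal.ofReal lam • (volume : Measure ℝ)) := by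
    change SigmaFinite (lam.toNNReal • (volume : Measure ℝ))
    infer_instance
  -- Every point of the two-ended process is active; the restriction to the past is carried by the
  -- set `S` inside the function instead.
  have key := model.poisson.lintegral_expNeg_marked (ν := clusterLaw h₁ f)
    (T := fun ω m => (True, τ m ω)) (hψ.comp hτ)
    (fun ω g hg => by
      rw [lintegral_sum_measure]
      refine tsum_congr fun m => ?_
      rw [if_pos trivial, lintegral_dirac' _ hg])
    hD (model.indep.comp hψ measurable_id)
    (G := fun t c => S.indicator (fun p => g (p.2.shift p.1)) (t, c)) hG
  have hexp : ∫⁻ t, ∫⁻ c, 1 - expNeg (S.indicator (fun p => g (p.2.shift p.1)) (t, c))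
      ∂(clusterLaw h₁ f) ∂(ENNReal.ofReal lam • volume) = targetExponent lam h₁ f g := by
    rw [lintegral_smul_measure, targetExponent, smul_eq_mul]
    have h1 : ∀ t, ∫⁻ c, 1 - expNeg (S.indicator (fun p => g (p.2.shift p.1)) (t, c))
        ∂(clusterLaw h₁ f) = (Set.Iic (0 : ℝ)).indicator (fun t => ∫⁻ c,
          {c | -t < c.length}.indicator (fun c => 1 - expNeg (g (c.shift t))) c
            ∂(clusterLaw h₁ f)) t := by
      intro t
      by_cases ht : t ≤ 0
      · rw [Set.indicator_of_mem (by exact ht)]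
        refine lintegral_congr fun c => ?_
        by_cases hc : -t < c.length
        · rw [Set.indicator_of_mem (by exact ⟨ht, hc⟩), Set.indicator_of_mem (by exact hc)]
        · rw [Set.indicator_of_notMem (by exact fun h => hc h.2),
            Set.indicator_of_notMem (by exact hc)]
          simp
      · rw [Set.indicator_of_notMem (by exact ht)]
        have : ∀ c : Cluster, S.indicator (fun p => g (p.2.shift p.1)) (t, c) = 0 := fun c =>
          Set.indicator_of_notMem (by exact fun h => ht h.1) _
        simp [this]
    simp_rw [h1]
    rw [lintegral_indicator measurableSet_Iic, lintegral_const_mul']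
    exact ENNReal.ofReal_ne_top
  rw [hexp] at key
  rw [← key]
  refine lintegral_congr_ae ?_
  filter_upwards [model.ordered] with ω hω
  rw [lintegral_targetProcess hg]
  congr 1
  refine tsum_congr fun m => ?_
  rw [if_pos trivial]
  -- The enumeration convention turns the condition on the index into one on the arrival time, as
  -- used in `S`.
  have hiff : m.1 ≤ -1 ↔ τ m ω ≤ 0 := by
    constructor
    · intro hm; exact hω.2.1 m (by omega)
    · intro hm
      by_contra hcon
      have hm0 := m.2
      exact absurd (hω.2.2 m (by omega)) (not_lt.2 hm)
  by_cases hacc : m.1 ≤ -1 ∧ -τ m ω < ((D m ω).shift (τ m ω)).length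
  · rw [if_pos hacc, Set.indicator_of_mem]
    refine ⟨hiff.1 hacc.1, ?_⟩
    have := hacc.2
    rwa [Cluster.length_shift] at this
  · rw [if_neg hacc, Set.indicator_of_notMem]
    intro hmem
    refine hacc ⟨hiff.2 hmem.1, ?_⟩
    rw [Cluster.length_shift]
    exact hmem.2

end Stationary

/-! ### Arrival times of the returned clusters -/

section Arrivals

variable {Ω : Type*} {η : ℝ}
  {K : Ω → ℕ} {τ : ℕ → Ω → ℝ} {D : ℕ → Ω → Cluster} {X : ℕ → Ω → ℝ}

lemma outputArrivals_eq_map (ω : Ω) :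
    outputArrivals η K τ D X ω = (outputProcess η K τ D X ω).map fun c => c.time 0 := by
  classical
  have hm := Cluster.measurable_time 0
  ext A hA
  rw [outputArrivals, outputProcess, Measure.map_apply hm hA, Measure.finsetSum_apply,
    Measure.finsetSum_apply]
  refine Finset.sum_congr rfl fun m _ => ?_
  rw [Measure.dirac_apply' _ hA, Measure.dirac_apply' _ (hm hA)]
  rfl

/-- Almost surely a cluster translated by `t` has its immigrant at `t`, so the integrand is constant
on the event `L > -t`, whose mass is `p (-t)`. -/
lemma targetExponent_comp_time_zero {lam h₁ : ℝ} {f : ℝ → ℝ} (hlam : 0 ≤ lam) (hf : IsDensity f)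
    (hh : 0 < h₁) (hh' : h₁ < 1) {g : ℝ → ℝ≥0∞} (hg : Measurable g) :
    targetExponent lam h₁ f (fun c => g (c.time 0)) =
      ∫⁻ t, 1 - expNeg (g t) ∂(intensityOnPast fun t => lam * tailProb h₁ f (-t)) := by
  have := isProbabilityMeasure_clusterLaw (h := h₁) hf
  have hL : ∀ t : ℝ, MeasurableSet {c : Cluster | -t < c.length} := fun t =>
    measurableSet_lt measurable_const Cluster.measurable_length
  have hmt : Measurable fun t => tailProb h₁ f (-t) := by
    have hS : MeasurableSet {p : ℝ × Cluster | -p.1 < p.2.length} :=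
      measurableSet_lt measurable_fst.neg (Cluster.measurable_length.comp measurable_snd)
    exact (measurable_measure_prodMk_left (ν := clusterLaw h₁ f) hS).ennreal_toReal
  have hmg : Measurable fun t => 1 - expNeg (g t) :=
    measurable_const.sub (measurable_expNeg.comp hg)
  rw [intensityOnPast, lintegral_withDensity_eq_lintegral_mul _ (by fun_prop) hmg, targetExponent]
  refine lintegral_congr fun t => ?_
  rw [Pi.mul_apply, ENNReal.ofReal_mul hlam, mul_assoc]
  congr 1
  rw [tailProb, ofReal_measureReal, mul_comm, ← lintegral_indicator_const (hL t)]
  refine lintegral_congr_ae ?_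
  filter_upwards [ae_time_zero_shift hf hh hh' t] with c hc
  by_cases hcL : -t < c.length
  · rw [Set.indicator_of_mem (by exact hcL), Set.indicator_of_mem (by exact hcL), hc]
  · rw [Set.indicator_of_notMem (by exact hcL), Set.indicator_of_notMem (by exact hcL)]

/-- The arrival times of the returned clusters form a Poisson process. -/
theorem IsAlgorithmRun.isPoissonProcess_outputArrivals [MeasurableSpace Ω] {P : Measure Ω}
    [IsProbabilityMeasure P] {lam h₁ : ℝ} {f : ℝ → ℝ} (run : IsAlgorithmRun P lam h₁ f η K τ D X)
    (hlam : 0 ≤ lam) (hf : IsDensity f) (hh : 0 < h₁)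
    (hh' : h₁ < 1) {η' : ℝ} (hη : 0 < η) (hηη' : η < η')
    (hint : Integrable (fun c : Cluster => Real.exp (η' * c.totalBirth)) (clusterLaw h₁ f)) :
    IsPoissonProcess P (outputArrivals η K τ D X)
      (intensityOnPast fun t => lam * tailProb h₁ f (-t)) := by
  have hm := Cluster.measurable_time 0
  refine IsPoissonProcess.of_laplace ?_ fun g hg => ?_
  · simp_rw [funext (outputArrivals_eq_map (η := η) (K := K) (τ := τ) (D := D) (X := X))]
    exact (Measure.measurable_map _ hm).comp run.measurable_outputProcess
  · simp_rw [outputArrivals_eq_map, lintegral_map hg hm]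
    have hgm : Measurable fun c : Cluster => g (c.time 0) := hg.comp hm
    rw [run.laplace_output hlam hf hh hh' hη hηη' hint hgm,
      ← targetExponent_comp_time_zero hlam hf hh hh' hg]

end Arrivals

/-! ### Conditional law of the accepted clusters -/

lemma infinitePi_forall_mem {Z : Type*} [MeasurableSpace Z] {ν : Measure Z}
    [IsProbabilityMeasure ν] {s : Finset ℕ} {V : ℕ → Set Z} (hV : ∀ i, MeasurableSet (V i)) :
    Measure.infinitePi (fun _ : ℕ => ν) {z | ∀ i ∈ s, z i ∈ V i} = ∏ i ∈ s, ν (V i) :=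
  Measure.infinitePi_pi (fun _ : ℕ => ν) (s := s) fun i _ => hV i

/-- Independent draws, conditioned on which of them fall into given regions. -/
theorem infinitePi_conditional {Z : Type*} [MeasurableSpace Z] {ν : Measure Z}
    [IsProbabilityMeasure ν] {B C : ℕ → Set Z} (hB : ∀ m, MeasurableSet (B m))
    (hC : ∀ m, MeasurableSet (C m)) {κ : ℕ → ℝ≥0∞} (S : Finset ℕ)
    (hκ : ∀ m, ν (B m ∩ C m) = κ m * ν (B m)) {H : Set (ℕ → Prop)} (hH : MeasurableSet H) :
    Measure.infinitePi (fun _ : ℕ => ν)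
        {z | (fun m => z m ∈ B m) ∈ H ∧ ∀ m ∈ S, z m ∈ B m ∧ z m ∈ C m} =
      (∏ m ∈ S, κ m) * Measure.infinitePi (fun _ : ℕ => ν)
        {z | (fun m => z m ∈ B m) ∈ H ∧ ∀ m ∈ S, z m ∈ B m} := by
  classical
  set Q := Measure.infinitePi fun _ : ℕ => ν with hQ
  let a : (ℕ → Z) → ℕ → Prop := fun z m => z m ∈ B m
  have ha : Measurable a := measurable_pi_iff.2 fun m =>
    (hB m).mem.comp (measurable_pi_apply m)
  let E₁ : Set (ℕ → Z) := {z | ∀ m ∈ S, z m ∈ B m ∩ C m}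
  let E₂ : Set (ℕ → Z) := {z | ∀ m ∈ S, z m ∈ B m}
  -- For a cylinder condition on the membership pattern, both sides are finite products over
  -- coordinates. At `i ∈ S` membership in `B i` is imposed, so the pattern condition is either void
  -- or impossible, according to whether `True ∈ U i`.
  have hcyl : ∀ (s : Finset ℕ) (U : ℕ → Set Prop),
      Q (a ⁻¹' (s : Set ℕ).pi U ∩ E₁) = (∏ m ∈ S, κ m) * Q (a ⁻¹' (s : Set ℕ).pi U ∩ E₂) := by
    intro s U
    let V : (ℕ → Set Z) → ℕ → Set Z := fun W i =>
      (if i ∈ s then {z | (z ∈ B i) ∈ U i} else Set.univ) ∩ (if i ∈ S then W i else Set.univ)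
    have hmU : ∀ i, MeasurableSet {z | (z ∈ B i) ∈ U i} := fun i =>
      (hB i).mem (MeasurableSet.of_discrete (s := U i))
    have hmV : ∀ W : ℕ → Set Z, (∀ i, MeasurableSet (W i)) → ∀ i, MeasurableSet (V W i) := by
      intro W hW i
      refine MeasurableSet.inter ?_ ?_
      · split_ifs
        · exact hmU i
        · exact .univ
      · split_ifs
        · exact hW i
        · exact .univ
    have hE : ∀ W : ℕ → Set Z, a ⁻¹' (s : Set ℕ).pi U ∩ {z | ∀ m ∈ S, z m ∈ W m} =
        {z | ∀ i ∈ s ∪ S, z i ∈ V W i} := by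
      intro W
      ext z
      simp only [Set.mem_inter_iff, Set.mem_preimage, Set.mem_pi, Set.mem_ofPred_eq,
        Finset.mem_union, V, Finset.mem_coe]
      constructor
      · rintro ⟨h1, h2⟩ i _
        constructor
        · split_ifs with hi
          · exact h1 i hi
          · trivial
        · split_ifs with hi
          · exact h2 i hi
          · trivial
      · intro h
        constructor
        · intro i hi
          have := (h i (Or.inl hi)).1
          rw [if_pos hi] at this
          exact this
        · intro i hi
          have := (h i (Or.inr hi)).2
          rwa [if_pos hi] at this
    have h1 := hE fun m => B m ∩ C m
    have h2 := hE B
    change Q (a ⁻¹' (s : Set ℕ).pi U ∩ {z | ∀ m ∈ S, z m ∈ B m ∩ C m}) =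
      (∏ m ∈ S, κ m) * Q (a ⁻¹' (s : Set ℕ).pi U ∩ {z | ∀ m ∈ S, z m ∈ B m})
    rw [h1, h2, hQ, infinitePi_forall_mem (hmV _ fun m => (hB m).inter (hC m)),
      infinitePi_forall_mem (hmV _ hB)]
    have hprod : ∏ m ∈ S, κ m = ∏ i ∈ s ∪ S, if i ∈ S then κ i else 1 := by
      rw [Finset.prod_ite_mem, Finset.union_inter_cancel_right]
    rw [hprod, ← Finset.prod_mul_distrib]
    refine Finset.prod_congr rfl fun i _ => ?_
    by_cases hiS : i ∈ S
    · simp only [V, if_pos hiS]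
      by_cases hU : i ∈ s ∧ True ∉ U i
      · have : ∀ W ⊆ B i, (if i ∈ s then {z | (z ∈ B i) ∈ U i} else Set.univ) ∩ W = ∅ := by
          intro W hW
          rw [if_pos hU.1]
          refine Set.eq_empty_of_forall_notMem fun z hz => hU.2 ?_
          have hzB : (z ∈ B i) = True := eq_true (hW hz.2)
          have := hz.1
          rwa [Set.mem_ofPred_eq, hzB] at this
        rw [this _ Set.inter_subset_left, this _ subset_rfl]
        simp
      · have : ∀ W ⊆ B i, (if i ∈ s then {z | (z ∈ B i) ∈ U i} else Set.univ) ∩ W = W := by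
          intro W hW
          refine Set.inter_eq_right.2 fun z hz => ?_
          split_ifs with his
          · have hT : True ∈ U i := by
              by_contra h; exact hU ⟨his, h⟩
            have hzB : (z ∈ B i) = True := eq_true (hW hz)
            rwa [Set.mem_ofPred_eq, hzB]
          · trivial
        rw [this _ Set.inter_subset_left, this _ subset_rfl, hκ]
    · simp only [V, if_neg hiS, one_mul]
  have hE₁ : MeasurableSet E₁ := by
    have : E₁ = (S : Set ℕ).pi fun m => B m ∩ C m := rfl
    rw [this]
    exact MeasurableSet.pi S.countable_toSet fun m _ => (hB m).inter (hC m)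
  have hE₂ : MeasurableSet E₂ := by
    have : E₂ = (S : Set ℕ).pi B := rfl
    rw [this]
    exact MeasurableSet.pi S.countable_toSet fun m _ => hB m
  have hap : ∀ {A : Set (ℕ → Prop)}, MeasurableSet A → ∀ E : Set (ℕ → Z),
      (Q.restrict E).map a A = Q (a ⁻¹' A ∩ E) := by
    intro A hA E
    rw [Measure.map_apply ha hA, Measure.restrict_apply (ha hA)]
  -- Square cylinders form a generating π-system, so the identity extends to all measurable sets of
  -- patterns.
  have hmeas : (Q.restrict E₁).map a = (∏ m ∈ S, κ m) • (Q.restrict E₂).map a := by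
    refine ext_of_generate_finite (squareCylinders fun _ : ℕ => {s : Set Prop | MeasurableSet s})
      (generateFrom_squareCylinders).symm
      (isPiSystem_squareCylinders (fun _ => MeasurableSpace.isPiSystem_measurableSet)
        (by simp)) ?_ ?_
    · rintro A ⟨s, U, hU, rfl⟩
      have hm : MeasurableSet ((s : Set ℕ).pi U) :=
        MeasurableSet.pi s.countable_toSet fun i _ => hU i trivial
      rw [Measure.smul_apply, hap hm, hap hm, smul_eq_mul, hcyl]
    · rw [Measure.smul_apply, hap .univ, hap .univ, smul_eq_mul]
      have := hcyl ∅ fun _ => Set.univ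
      simpa using this
  have := congrArg (fun m => m H) hmeas
  simp only [Measure.smul_apply, smul_eq_mul] at this
  rwa [hap hH, hap hH] at this

section Conditional

variable {Ω : Type*} [MeasurableSpace Ω] {P : Measure Ω} [IsProbabilityMeasure P]
  {lam h₁ : ℝ} {f : ℝ → ℝ} {η : ℝ}
  {K : Ω → ℕ} {τ : ℕ → Ω → ℝ} {D : ℕ → Ω → Cluster} {X : ℕ → Ω → ℝ}

lemma measurableSet_lt_length (t : ℝ) : MeasurableSet {c : Cluster | t < c.length} :=
  measurableSet_lt measurable_const Cluster.measurable_length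

lemma clusterLawAt_apply (h : ℝ) (f : ℝ → ℝ) (t : ℝ) {A : Set Cluster} (hA : MeasurableSet A) :
    clusterLawAt h f t A = clusterLaw h f {c | c.shift t ∈ A} :=
  Measure.map_apply (measurable_shift_right t) hA

lemma measurable_cond_clusterLawAt {h : ℝ} {f : ℝ → ℝ} (hf : IsDensity f) {A : Set Cluster}
    (hA : MeasurableSet A) :
    Measurable fun t => (clusterLawAt h f t)[|{c | -t < c.length}] A := by
  have := isProbabilityMeasure_clusterLaw (h := h) hf
  have hL : MeasurableSet {p : ℝ × Cluster | -p.1 < (p.2.shift p.1).length} :=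
    measurableSet_lt measurable_fst.neg (Cluster.measurable_length.comp Cluster.measurable_shift)
  have h1 : Measurable fun t => clusterLaw h f {c | -t < (c.shift t).length} :=
    measurable_measure_prodMk_left hL
  have h2 : Measurable fun t =>
      clusterLaw h f {c | c.shift t ∈ {c | -t < c.length} ∩ A} :=
    measurable_measure_prodMk_left (hL.inter (Cluster.measurable_shift hA))
  have e : ∀ t, (clusterLawAt h f t)[|{c | -t < c.length}] A =
      (clusterLaw h f {c | -t < (c.shift t).length})⁻¹ *
        clusterLaw h f {c | c.shift t ∈ {c | -t < c.length} ∩ A} := by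
    intro t
    rw [cond_apply (measurableSet_lt_length _),
      clusterLawAt_apply _ _ _ (measurableSet_lt_length _),
      clusterLawAt_apply _ _ _ ((measurableSet_lt_length _).inter hA)]
    rfl
  simp_rw [e]
  exact h1.inv.mul h2

/-- Acceptance multiplies the cluster law on `L > -t` by a factor depending on `t` alone. This
factor cancels in the conditional law given acceptance. In product form the identity needs no
positivity of the acceptance probability. -/
lemma drawLaw_accept_inter (hf : IsDensity f) (hh : 0 < h₁)
    (hh' : h₁ < 1) {η' : ℝ} (hη : 0 < η) (hηη' : η < η')
    (hint : Integrable (fun c : Cluster => Real.exp (η' * c.totalBirth)) (clusterLaw h₁ f))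
    (t : ℝ) {A : Set Cluster} (hA : MeasurableSet A) :
    drawLaw h₁ f η ({z | (t, z) ∈ acceptSet η} ∩ {z | z.1.shift t ∈ A}) =
      (clusterLawAt h₁ f t)[|{c | -t < c.length}] A *
        drawLaw h₁ f η {z | (t, z) ∈ acceptSet η} := by
  have := isProbabilityMeasure_clusterLaw (h := h₁) hf
  have : IsProbabilityMeasure (clusterLawAt h₁ f t) :=
    Measure.isProbabilityMeasure_map (measurable_shift_right t).aemeasurable
  have hacc : MeasurableSet {z : Cluster × ℝ | (t, z) ∈ acceptSet η} :=
    measurable_prodMk_left (measurableSet_acceptSet η)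
  have key : ∀ {B : Set Cluster}, MeasurableSet B →
      drawLaw h₁ f η ({z | (t, z) ∈ acceptSet η} ∩ {z | z.1.shift t ∈ B}) =
        ENNReal.ofReal (Real.exp (-(psiB h₁ f η + η * t))) *
          clusterLawAt h₁ f t ({c | -t < c.length} ∩ B) := by
    intro B hB
    have hsB : MeasurableSet {z : Cluster × ℝ | z.1.shift t ∈ B} :=
      ((measurable_shift_right t).comp measurable_fst) hB
    have hms : MeasurableSet {c : Cluster | c.shift t ∈ {c | -t < c.length} ∩ B} :=
      measurable_shift_right t ((measurableSet_lt_length _).inter hB)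
    have h1 := lintegral_accept hf hh hh' hη hηη' hint t
      (φ := B.indicator 1) (measurable_one.indicator hB)
    rw [clusterLawAt_apply _ _ _ ((measurableSet_lt_length _).inter hB),
      ← lintegral_indicator_one (hacc.inter hsB), ← lintegral_indicator_one hms]
    convert! h1 using 2
    · ext z
      by_cases hz : (t, z) ∈ acceptSet η
      · rw [Set.indicator_of_mem hz]
        by_cases hzB : z.1.shift t ∈ B
        · rw [Set.indicator_of_mem (by exact ⟨hz, hzB⟩), Set.indicator_of_mem (by exact hzB)]
          rfl
        · rw [Set.indicator_of_notMem (by exact fun h => hzB h.2),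
            Set.indicator_of_notMem (by exact hzB)]
      · rw [Set.indicator_of_notMem hz, Set.indicator_of_notMem (by exact fun h => hz h.1)]
    · refine lintegral_congr fun c => ?_
      have hiff : c.shift t ∈ {c | -t < c.length} ↔ -t < c.length := by
        rw [Set.mem_ofPred_eq, Cluster.length_shift]
      by_cases hc : -t < c.length
      · by_cases hcB : c.shift t ∈ B
        · rw [Set.indicator_of_mem (by exact ⟨hiff.2 hc, hcB⟩),
            Set.indicator_of_mem (by exact hc), Set.indicator_of_mem hcB]
          rfl
        · rw [Set.indicator_of_notMem (by exact fun h => hcB h.2),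
            Set.indicator_of_mem (by exact hc), Set.indicator_of_notMem hcB]
      · rw [Set.indicator_of_notMem (by exact fun h => hc (hiff.1 h.1)),
          Set.indicator_of_notMem (by exact hc)]
  have huniv := key MeasurableSet.univ
  simp only [Set.mem_univ, Set.inter_univ, Set.ofPred_true] at huniv
  rw [key hA, huniv, mul_left_comm, cond_mul_eq_inter (measurableSet_lt_length _)]

/-- Given the arrival times and the accepted iterations, the accepted clusters are independent and
follow the conditional law of a cluster that lasts past `0`. -/
theorem IsAlgorithmRun.conditional_law (run : IsAlgorithmRun P lam h₁ f η K τ D X)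
    (hf : IsDensity f) (hh : 0 < h₁) (hh' : h₁ < 1) {η' : ℝ} (hη : 0 < η) (hηη' : η < η')
    (hint : Integrable (fun c : Cluster => Real.exp (η' * c.totalBirth)) (clusterLaw h₁ f))
    (S : Finset ℕ) (A : ℕ → Set Cluster) (H : Set (ℕ × (ℕ → ℝ) × (ℕ → Prop)))
    (hA : ∀ m, MeasurableSet (A m)) (hH : MeasurableSet H) :
    P {ω | acceptanceData η K τ D X ω ∈ H ∧
        ∀ m ∈ S, Accepted η K τ D X m ω ∧ proposal τ D m ω ∈ A m} =
      ∫⁻ ω in {ω | acceptanceData η K τ D X ω ∈ H ∧ ∀ m ∈ S, Accepted η K τ D X m ω},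
        ∏ m ∈ S, (clusterLawAt h₁ f (τ m ω))[|{c | -τ m ω < c.length}] (A m) ∂P := by
  have := isProbabilityMeasure_proposalLaw hf hh hh' hη hηη' hint
  set Q := Measure.infinitePi fun _ : ℕ => drawLaw h₁ f η with hQ
  have hm1 := run.measurable_arrivals
  have hm2 := run.measurable_draw
  have hlaw : P.map (fun ω => ((K ω, fun m => τ m ω), fun m => (D m ω, X m ω))) =
      (P.map fun ω => (K ω, fun m => τ m ω)).prod Q := by
    rw [(indepFun_iff_map_prod_eq_prod_map_map hm1.aemeasurable hm2.aemeasurable).1 run.indep,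
      run.hasLaw_draw.map_eq]
  have hprob : IsProbabilityMeasure (P.map fun ω => (K ω, fun m => τ m ω)) :=
    Measure.isProbabilityMeasure_map hm1.aemeasurable
  -- Iterations `m ≥ K` are given an empty acceptance region, so that acceptance of all iterations
  -- is a membership pattern.
  let B : ℕ × (ℕ → ℝ) → ℕ → Set (Cluster × ℝ) := fun q m =>
    {z | m < q.1 ∧ (q.2 m, z) ∈ acceptSet η}
  let C : ℕ × (ℕ → ℝ) → ℕ → Set (Cluster × ℝ) := fun q m => {z | z.1.shift (q.2 m) ∈ A m}
  let κ : ℕ × (ℕ → ℝ) → ℕ → ℝ≥0∞ := fun q m =>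
    (clusterLawAt h₁ f (q.2 m))[|{c | -q.2 m < c.length}] (A m)
  have hpair : ∀ m, Measurable fun p : (ℕ × (ℕ → ℝ)) × (ℕ → Cluster × ℝ) =>
      (p.1.2 m, p.2 m) := fun m => by fun_prop
  have hBj : ∀ m, MeasurableSet {p : (ℕ × (ℕ → ℝ)) × (ℕ → Cluster × ℝ) | p.2 m ∈ B p.1 m} :=
    fun m => (measurableSet_lt measurable_const (measurable_fst.comp measurable_fst)).inter
      ((hpair m) (measurableSet_acceptSet η))
  have hCj : ∀ m, MeasurableSet {p : (ℕ × (ℕ → ℝ)) × (ℕ → Cluster × ℝ) | p.2 m ∈ C p.1 m} :=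
    fun m => (measurable_shift_draw.comp (hpair m)) (hA m)
  have hdata : Measurable fun p : (ℕ × (ℕ → ℝ)) × (ℕ → Cluster × ℝ) =>
      ((p.1.1, p.1.2, fun m => p.2 m ∈ B p.1 m) : ℕ × (ℕ → ℝ) × (ℕ → Prop)) :=
    (measurable_fst.comp measurable_fst).prodMk ((measurable_snd.comp measurable_fst).prodMk
      (measurable_pi_iff.2 fun m => (hBj m).mem))
  let E₁ : Set ((ℕ × (ℕ → ℝ)) × (ℕ → Cluster × ℝ)) :=
    {p | ((p.1.1, p.1.2, fun m => p.2 m ∈ B p.1 m) : ℕ × (ℕ → ℝ) × (ℕ → Prop)) ∈ H ∧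
      ∀ m ∈ S, p.2 m ∈ B p.1 m ∧ p.2 m ∈ C p.1 m}
  let E₂ : Set ((ℕ × (ℕ → ℝ)) × (ℕ → Cluster × ℝ)) :=
    {p | ((p.1.1, p.1.2, fun m => p.2 m ∈ B p.1 m) : ℕ × (ℕ → ℝ) × (ℕ → Prop)) ∈ H ∧
      ∀ m ∈ S, p.2 m ∈ B p.1 m}
  have hE₁ : MeasurableSet E₁ := by
    have : E₁ = (fun p : (ℕ × (ℕ → ℝ)) × (ℕ → Cluster × ℝ) =>
      ((p.1.1, p.1.2, fun m => p.2 m ∈ B p.1 m) : ℕ × (ℕ → ℝ) × (ℕ → Prop))) ⁻¹' H ∩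
        ⋂ m ∈ S, {p | p.2 m ∈ B p.1 m} ∩ {p | p.2 m ∈ C p.1 m} := by
      ext p; simp [E₁]
    rw [this]
    exact (hdata hH).inter (Finset.measurableSet_biInter _ fun m _ => (hBj m).inter (hCj m))
  have hE₂ : MeasurableSet E₂ := by
    have : E₂ = (fun p : (ℕ × (ℕ → ℝ)) × (ℕ → Cluster × ℝ) =>
      ((p.1.1, p.1.2, fun m => p.2 m ∈ B p.1 m) : ℕ × (ℕ → ℝ) × (ℕ → Prop))) ⁻¹' H ∩
        ⋂ m ∈ S, {p | p.2 m ∈ B p.1 m} := by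
      ext p; simp [E₂]
    rw [this]
    exact (hdata hH).inter (Finset.measurableSet_biInter _ fun m _ => hBj m)
  have hκm : Measurable fun q => ∏ m ∈ S, κ q m :=
    Finset.measurable_fun_prod _ fun m _ => (measurable_cond_clusterLawAt hf (hA m)).comp
      ((measurable_pi_apply m).comp measurable_snd)
  have hκm' : Measurable fun p : (ℕ × (ℕ → ℝ)) × (ℕ → Cluster × ℝ) => ∏ m ∈ S, κ p.1 m :=
    hκm.comp measurable_fst
  -- For fixed `(K, τ)` the draws are independent with fixed acceptance regions; integrating over
  -- `q` then gives the claim.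
  have hfiber : ∀ q, Q {z | (q, z) ∈ E₁} = (∏ m ∈ S, κ q m) * Q {z | (q, z) ∈ E₂} := by
    intro q
    have hBq : ∀ m, MeasurableSet (B q m) := fun m =>
      (MeasurableSet.const _).inter (measurable_prodMk_left (measurableSet_acceptSet η))
    have hCq : ∀ m, MeasurableSet (C q m) := fun m =>
      ((measurable_shift_right (q.2 m)).comp measurable_fst) (hA m)
    refine infinitePi_conditional hBq hCq S (κ := κ q) (fun m => ?_)
      (H := {a | (q.1, q.2, a) ∈ H}) ?_
    · by_cases hm : m < q.1
      · have e : B q m = {z | (q.2 m, z) ∈ acceptSet η} := by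
          ext z; exact and_iff_right hm
        rw [e]
        exact drawLaw_accept_inter hf hh hh' hη hηη' hint (q.2 m) (hA m)
      · have e : B q m = ∅ := Set.eq_empty_of_forall_notMem fun z hz => hm hz.1
        rw [e]
        simp
    · exact (measurable_prodMk_left.comp measurable_prodMk_left) hH
  have hmall : Measurable fun ω => ((K ω, fun m => τ m ω), fun m => (D m ω, X m ω)) :=
    hm1.prodMk hm2
  have hL : P {ω | acceptanceData η K τ D X ω ∈ H ∧
      ∀ m ∈ S, Accepted η K τ D X m ω ∧ proposal τ D m ω ∈ A m} =
      ((P.map fun ω => (K ω, fun m => τ m ω)).prod Q) E₁ := by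
    rw [← hlaw, Measure.map_apply hmall hE₁]
    rfl
  have hR : ∫⁻ ω in {ω | acceptanceData η K τ D X ω ∈ H ∧ ∀ m ∈ S, Accepted η K τ D X m ω},
      ∏ m ∈ S, (clusterLawAt h₁ f (τ m ω))[|{c | -τ m ω < c.length}] (A m) ∂P =
      ∫⁻ p in E₂, ∏ m ∈ S, κ p.1 m ∂((P.map fun ω => (K ω, fun m => τ m ω)).prod Q) := by
    rw [← hlaw, setLIntegral_map hE₂ hκm' hmall]
    rfl
  rw [hL, hR, Measure.prod_apply hE₁, ← lintegral_indicator hE₂,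
    lintegral_prod _ (hκm'.indicator hE₂).aemeasurable]
  refine lintegral_congr fun q => ?_
  change Q {z | (q, z) ∈ E₁} = _
  have hE₂q : MeasurableSet {z | (q, z) ∈ E₂} := measurable_prodMk_left hE₂
  rw [hfiber q, ← lintegral_indicator_const hE₂q]
  rfl

end Conditional

/-! ### Expected number of generated variables -/

lemma intensityOnPast_univ {lam ψ η : ℝ} (hlam : 0 ≤ lam) (hη : 0 < η) :
    intensityOnPast (fun t => lam * Real.exp (ψ + η * t)) Set.univ =
      ENNReal.ofReal (lam * Real.exp ψ / η) := by
  have e : ∀ t, lam * Real.exp (ψ + η * t) = lam * Real.exp ψ * Real.exp (η * t) := fun t => by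
    rw [Real.exp_add]; ring
  rw [intensityOnPast, withDensity_apply _ .univ, Measure.restrict_univ]
  simp_rw [e]
  rw [← ofReal_integral_eq_lintegral_ofReal]
  · rw [integral_const_mul, integral_exp_mul_Iic hη]
    simp [div_eq_mul_inv]
  · exact (integrableOn_exp_mul_Iic hη 0).const_mul _
  · exact Eventually.of_forall fun t => by positivity

/-- Expected number of random variables generated by the algorithm. -/
theorem IsAlgorithmRun.lintegral_numVariables {Ω : Type*} [MeasurableSpace Ω] {P : Measure Ω}
    {lam h₁ : ℝ} {f : ℝ → ℝ} {η : ℝ}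
    {K : Ω → ℕ} {τ : ℕ → Ω → ℝ} {D : ℕ → Ω → Cluster} {X : ℕ → Ω → ℝ}
    (run : IsAlgorithmRun P lam h₁ f η K τ D X) (hlam : 0 ≤ lam)
    (hf : IsDensity f) (hh : 0 < h₁) (hh' : h₁ < 1) {η' : ℝ} (hη : 0 < η) (hηη' : η < η')
    (hint : Integrable (fun c : Cluster => Real.exp (η' * c.totalBirth)) (clusterLaw h₁ f)) :
    ∫⁻ ω, numVariables K τ D ω ∂P =
      ENNReal.ofReal (lam * Real.exp (psiB h₁ f η) * (2 - h₁ - psiB h₁ f η) /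
        (η * (1 - h₁ - psiB h₁ f η))) := by
  classical
  have := isProbabilityMeasure_proposalLaw hf hh hh' hη hηη' hint
  obtain ⟨hfη, hk, hk0, hk1, -⟩ := tilted_parameters hf hh hh' hη hηη' hint
  have hmc : Measurable fun c : Cluster => (c.card : ℝ≥0∞) :=
    (Measurable.of_discrete (f := fun n : ℕ∞ => (n : ℝ≥0∞))).comp Cluster.measurable_card
  have hmc₁ : Measurable fun z : Cluster × ℝ => (z.1.card : ℝ≥0∞) := hmc.comp measurable_fst
  have hmu := intensityOnPast_univ (ψ := psiB h₁ f η) hlam hη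
  have hK : ∫⁻ ω, (K ω : ℝ≥0∞) ∂P = ENNReal.ofReal (lam * Real.exp (psiB h₁ f η) / η) := by
    have h1 := run.poisson.hasLaw Set.univ .univ (by rw [hmu]; exact ENNReal.ofReal_ne_top)
    have h2 := h1.lintegral_comp (f := fun x => x) measurable_id.aemeasurable
    have hid : Measurable fun x : ℝ≥0∞ => x := measurable_id
    rw [lintegral_map hid .of_discrete] at h2
    rw [lintegral_id_poissonMeasure, hmu, ENNReal.coe_toNNReal ENNReal.ofReal_ne_top] at h2
    rw [← h2]
    refine lintegral_congr fun ω => ?_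
    rw [Measure.finsetSum_apply]
    simp
  have hcard : ∀ m, ∫⁻ ω, ((D m ω).card : ℝ≥0∞) + 1 ∂P =
      ENNReal.ofReal (1 / (1 - (h₁ + psiB h₁ f η))) + 1 := by
    intro m
    have h1 := (run.draw_law m).lintegral_comp (f := fun z => (z.1.card : ℝ≥0∞) + 1)
      (hmc₁.add_const 1).aemeasurable
    rw [h1, lintegral_add_right _ measurable_const, lintegral_prod _
      hmc₁.aemeasurable]
    simp only [lintegral_const, measure_univ, mul_one]
    rw [lintegral_card_clusterLaw hfη (hk ▸ hk0) (hk ▸ hk1), hk]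
  -- The event that iteration `m` takes place depends on the arrivals only, hence is independent of
  -- the draw `D m`.
  have hterm : ∀ m, ∫⁻ ω, {ω | m < K ω}.indicator 1 ω * (((D m ω).card : ℝ≥0∞) + 1) ∂P =
      P {ω | m < K ω} * (ENNReal.ofReal (1 / (1 - (h₁ + psiB h₁ f η))) + 1) := by
    intro m
    rw [← hcard m, ← lintegral_indicator_one (run.measurableSet_lt_count m)]
    have hφ : Measurable fun q : ℕ × (ℕ → ℝ) => {q : ℕ × (ℕ → ℝ) | m < q.1}.indicator
        (1 : ℕ × (ℕ → ℝ) → ℝ≥0∞) q :=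
      measurable_one.indicator (measurableSet_lt measurable_const measurable_fst)
    have hψ : Measurable fun z : ℕ → Cluster × ℝ => ((z m).1.card : ℝ≥0∞) + 1 :=
      (hmc.comp (measurable_fst.comp (measurable_pi_apply m))).add_const 1
    exact lintegral_mul_eq_lintegral_mul_lintegral_of_indepFun
      (hφ.comp run.measurable_arrivals) (hψ.comp run.measurable_draw) (run.indep.comp hφ hψ)
  have hsum : ∀ ω, numVariables K τ D ω =
      ∑' m, {ω | m < K ω}.indicator 1 ω * (((D m ω).card : ℝ≥0∞) + 1) := by
    intro ω
    rw [numVariables, tsum_eq_sum (s := Finset.range (K ω))]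
    · refine Finset.sum_congr rfl fun m hm => ?_
      rw [Set.indicator_of_mem (by exact Finset.mem_range.1 hm), Pi.one_apply, one_mul]
      rfl
    · intro m hm
      rw [Set.indicator_of_notMem (by simpa using hm), zero_mul]
  have hKsum : ∑' m, P {ω | m < K ω} = ∫⁻ ω, (K ω : ℝ≥0∞) ∂P := by
    simp_rw [← lintegral_indicator_one (run.measurableSet_lt_count _)]
    rw [← lintegral_tsum fun m =>
      (measurable_one.indicator (run.measurableSet_lt_count m)).aemeasurable]
    refine lintegral_congr fun ω => ?_
    rw [tsum_eq_sum (s := Finset.range (K ω))]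
    · rw [Finset.sum_congr rfl fun m hm =>
        Set.indicator_of_mem (by exact Finset.mem_range.1 hm) _]
      simp
    · intro m hm
      rw [Set.indicator_of_notMem (by simpa using hm)]
  have hmt : ∀ m, Measurable fun ω =>
      {ω | m < K ω}.indicator (1 : Ω → ℝ≥0∞) ω * (((D m ω).card : ℝ≥0∞) + 1) := fun m =>
    (measurable_one.indicator (run.measurableSet_lt_count m)).mul
      ((hmc.comp (run.measurable_cluster m)).add_const 1)
  simp_rw [hsum]
  rw [lintegral_tsum fun m => (hmt m).aemeasurable]
  simp_rw [hterm]
  have hpos : 0 < 1 - (h₁ + psiB h₁ f η) := by linarith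
  rw [ENNReal.tsum_mul_right, hKsum, hK, ← ENNReal.ofReal_one,
    ← ENNReal.ofReal_add (by positivity) zero_le_one, ← ENNReal.ofReal_mul (by positivity)]
  congr 1
  have e : 1 - h₁ - psiB h₁ f η = 1 - (h₁ + psiB h₁ f η) := by ring
  rw [e]
  field_simp
  ring

end Hawkes

end

open Hawkes in
theorem theorem1 (lam h₁ : ℝ) (f : ℝ → ℝ) (hlam : 0 < lam) (hh₁ : 0 < h₁) (hh₁' : h₁ < 1)
    (hf : IsDensity f)
    (hlight : ∃ θ₀ > 0, IntegrableOn (fun t => Real.exp (θ₀ * t) * f t) (Set.Ioi 0)) :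
    -- the range of admissible tilting parameters is not empty
    (∃ θ₁ > 0, ∀ θ ∈ Set.Ioo 0 θ₁,
      Integrable (fun c : Cluster => Real.exp (θ * c.totalBirth)) (clusterLaw h₁ f)) ∧
    ∀ θ₁ : ℝ, (∀ θ ∈ Set.Ioo 0 θ₁,
      Integrable (fun c : Cluster => Real.exp (θ * c.totalBirth)) (clusterLaw h₁ f)) →
    ∀ η ∈ Set.Ioo 0 θ₁,
    ∀ {Ω : Type*} [MeasurableSpace Ω] (P : Measure Ω) [IsProbabilityMeasure P]
      (K : Ω → ℕ) (τ : ℕ → Ω → ℝ) (D : ℕ → Ω → Cluster) (X : ℕ → Ω → ℝ),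
      IsAlgorithmRun P lam h₁ f η K τ D X →
      -- the output has the law of `N₀`
      (∀ {Ω' : Type*} [MeasurableSpace Ω'] (P' : Measure Ω') [IsProbabilityMeasure P']
        (τ' : Idx → Ω' → ℝ) (D' : Idx → Ω' → Cluster),
        IsStationaryModel P' lam h₁ f τ' D' →
        IdentDistrib (outputProcess η K τ D X) (targetProcess τ' D') P P') ∧
      -- the arrival times of the returned clusters form a Poisson process
      IsPoissonProcess P (outputArrivals η K τ D X)
        (intensityOnPast fun t => lam * tailProb h₁ f (-t)) ∧
      -- given the arrival times and the accepted iterations, the returned clusters are independent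
      -- and follow the conditional law of a cluster given that its length exceeds `-τ m`
      (∀ (S : Finset ℕ) (A : ℕ → Set Cluster) (H : Set (ℕ × (ℕ → ℝ) × (ℕ → Prop))),
        (∀ m, MeasurableSet (A m)) → MeasurableSet H →
        P {ω | acceptanceData η K τ D X ω ∈ H ∧
            ∀ m ∈ S, Accepted η K τ D X m ω ∧ proposal τ D m ω ∈ A m} =
          ∫⁻ ω in {ω | acceptanceData η K τ D X ω ∈ H ∧ ∀ m ∈ S, Accepted η K τ D X m ω},
            ∏ m ∈ S, (clusterLawAt h₁ f (τ m ω))[|{c | -τ m ω < c.length}] (A m) ∂P) ∧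
      -- expected number of random variables generated
      ∫⁻ ω, numVariables K τ D ω ∂P =
        ENNReal.ofReal (lam * Real.exp (psiB h₁ f η) * (2 - h₁ - psiB h₁ f η) /
          (η * (1 - h₁ - psiB h₁ f η))) := by
  refine ⟨exists_integrable_exp_totalBirth hf hh₁ hh₁' hlight, ?_⟩
  intro θ₁ hθ₁ η hη Ω _ P _ K τ D X run
  -- Integrability strictly beyond `η` is what makes the tilted cluster strictly subcritical.
  obtain ⟨η', hηη', hη'⟩ := exists_between hη.2
  have hint := hθ₁ η' ⟨hη.1.trans hηη', hη'⟩
  refine ⟨?_, run.isPoissonProcess_outputArrivals hlam.le hf hh₁ hh₁' hη.1 hηη' hint,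
    run.conditional_law hf hh₁ hh₁' hη.1 hηη' hint,
    run.lintegral_numVariables hlam.le hf hh₁ hh₁' hη.1 hηη' hint⟩
  intro Ω' _ P' _ τ' D' model
  refine ⟨run.measurable_outputProcess.aemeasurable, model.measurable_targetProcess.aemeasurable,
    map_eq_of_laplace run.measurable_outputProcess model.measurable_targetProcess fun g hg => ?_⟩
  rw [run.laplace_output hlam.le hf hh₁ hh₁' hη.1 hηη' hint hg, model.laplace_target hf hg]
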